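/- Let $m\ge n\ge 0$ and let $M=(a_{ij})$ be an $m\times n$ integer matrix of rank $n$. Let $Y(M)$ be the underlying manifold of $$\{(x,y,z)\in\mathbb C^n\times\mathbb C^n\times(\mathbb C^*)^m \;:\; x_jy_j=\textstyle\prod_{i=1}^m z_i^{a_{ij}}+1,\ 1\le j\le n\},$$ and let $h:Y(M)\to\mathbb R^{n+m}$, $h(x,y,z)=(|x_i|^2-|y_i|^2,\ \log|z_k|)_{1\le i\le n,\,1\le k\le m}$. For $d\ge 1$ let $D\subset\mathbb C$ be the open unit disk and let $Y_d\to D$ be the elliptic fibration of type $I_d$: $Y_d$ is obtained from the copies $U_i$ ($i\in\mathbb Z/d$) of $\{(u,v)\in\mathbb C^2:|uv|<1\}$ by identifying $(u,v)\in U_i$, $v\neq 0$, with $(v^{-1},uv^2)\in U_{i+1}$, and the projection is $q=uv$. (The fibre over $q\ne0$ is $\mathbb C^*/q^{d\mathbb Z}$, and the fibre over $0$ is a cycle of $d$ projective lines.) The group $\mathbb Z/d$ acts on $Y_d$ over $D$ by shifting the index $i$. There exist an integer $d>0$ and integer $m\times m$ matrices $T,\bar M$ of full rank such that the first $n$ columns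 of $\bar M$ form $M$ and $T\bar M=\begin{pmatrix} dI_n&0\\0&I_{m-n}\end{pmatrix}$. For every such $d$, $T$, $\bar M$ let $$\mathcal N(T^T)=\Big\{\lambda\in(\mathbb C^*)^m:\ \textstyle\prod_{l}\lambda_l^{t_{lk}}=1,\ 1\le k\le m\Big\}.$$ Then: 1. $\mathcal N(T^T)$ is finite and contained in $(\mathbb Z/d)^n$, embedded in $(\mathbb C^*)^m$ by $a\mapsto(e^{2\pi i a_1/d},\dots,e^{2\pi i a_n/d},1,\dots,1)$; thus it acts on $Y_d^n$ over $D^n$. 2. The induced map $Y_d^n/\mathcal N(T^T)\to D^n$ is a proper holomorphic map, and a map of Kähler manifolds: there is a Kähler form $\eta$ on $Y_d$ for which $\mathbb Z/d$ acts by holomorphic isometries, and a Kähler form on the complex manifold $Y_d^n/\mathcal N(T^T)$ whose pullback to $Y_d^n$ is the product Kähler form $\sum_j \mathrm{pr}_j^*\eta$. 3. $h$ is the Cartesian product of $Y_d^n/\mathcal N(T^T)\to D^n$ and the trivial torus fibration $(\mathbb C^*)^{m-n}\to\mathbb R^{m-n}$, $w\mapsto(\log|w_k|)_k$: there are $C^\infty$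 diffeomorphisms $Y(M)\cong Y_d^n/\mathcal N(T^T)\times(\mathbb C^*)^{m-n}$ and $\mathbb R^{n+m}\cong D^n\times\mathbb R^{m-n}$ which carry $h$ to the product of the two maps. -/

import Mathlib

open scoped Manifold ContDiff

noncomputable section

open Set Filter Topology

namespace IsolatedCluster

/-! ## Complex manifolds presented by local parametrisations -/

/-- A holomorphic atlas on `X` given by inverse charts: a family of continuous open maps `param i`
from one open set `dom` of the complex normed space `E`, locally injective, jointly surjective,
and related to each other by (local) holomorphic changes of coordinates. -/
structure EtaleAtlas (ι E X : Type*) [NormedAddCommGroup E] [NormedSpace ℂ E]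
    [TopologicalSpace X] where
  dom : Set E
  isOpen_dom : IsOpen dom
  param : ι → E → X
  continuousOn : ∀ i, ContinuousOn (param i) dom
  isOpen_image : ∀ i W, IsOpen W → W ⊆ dom → IsOpen (param i '' W)
  locally_injective : ∀ i, ∀ x ∈ dom, ∃ W, IsOpen W ∧ x ∈ W ∧ W ⊆ dom ∧ InjOn (param i) W
  surjective : ∀ y, ∃ i, ∃ x ∈ dom, param i x = y
  transition : ∀ i j, ∀ x ∈ dom, ∀ y ∈ dom, param i x = param j y →
    ∃ φ : E → E, ContDiffAt ℂ ω φ x ∧ φ x = y ∧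
      ∀ᶠ x' in 𝓝 x, φ x' ∈ dom ∧ param j (φ x') = param i x'

namespace EtaleAtlas

variable {ι E X : Type*} [NormedAddCommGroup E] [NormedSpace ℂ E] [TopologicalSpace X]
  (A : EtaleAtlas ι E X)

/-- The restriction of `param i` to an open set on which it is injective, as a homeomorphism onto
its open image. -/
def paramHomeomorph (i : ι) (W : Set E) (hW : IsOpen W) (hd : W ⊆ A.dom)
    (hi : InjOn (A.param i) W) : OpenPartialHomeomorph E X :=
  OpenPartialHomeomorph.ofContinuousOpenRestrict (hi.toPartialEquiv (A.param i) W)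
    ((A.continuousOn i).mono hd)
    (by
      intro O hO
      obtain ⟨O', hO', rfl⟩ := isOpen_induced_iff.1 hO
      have h := A.isOpen_image i (W ∩ O') (hW.inter hO') (inter_subset_left.trans hd)
      convert h using 1
      ext y
      constructor
      · rintro ⟨⟨x, hx⟩, hxO, rfl⟩
        exact ⟨x, ⟨hx, hxO⟩, rfl⟩
      · rintro ⟨x, ⟨hx, hxO⟩, rfl⟩
        exact ⟨⟨x, hx⟩, hxO, rfl⟩)
    hW

/-- The charts are the local inverses of the parametrisations `param i`. -/
def charts : Set (OpenPartialHomeomorph X E) :=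
  {e | ∃ i W, ∃ (hW : IsOpen W) (hd : W ⊆ A.dom) (hi : InjOn (A.param i) W),
    e = (A.paramHomeomorph i W hW hd hi).symm}

theorem exists_chart (y : X) : ∃ e ∈ A.charts, y ∈ e.source := by
  obtain ⟨i, x, hx, rfl⟩ := A.surjective y
  obtain ⟨W, hW, hxW, hd, hi⟩ := A.locally_injective i x hx
  exact ⟨_, ⟨i, W, hW, hd, hi, rfl⟩, mem_image_of_mem _ hxW⟩

/-- The charted space structure whose charts are the local inverses of the parametrisations. -/
@[reducible] def chartedSpace : ChartedSpace E X where
  atlas := A.charts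
  chartAt y := (A.exists_chart y).choose
  mem_chart_source y := (A.exists_chart y).choose_spec.2
  chart_mem_atlas y := (A.exists_chart y).choose_spec.1

theorem contDiffOn_transition (e e' : OpenPartialHomeomorph X E) (he : e ∈ A.charts)
    (he' : e' ∈ A.charts) : ContDiffOn ℂ ω (e' ∘ e.symm) (e.symm ≫ₕ e').source := by
  obtain ⟨i, W, hW, hd, hi, rfl⟩ := he
  obtain ⟨j, W', hW', hd', hi', rfl⟩ := he'
  intro x hx
  have hxW : x ∈ W := hx.1
  have hx2 : A.param i x ∈ A.param j '' W' := hx.2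
  obtain ⟨y, hyW', hy⟩ := hx2
  obtain ⟨φ, hφ, hφx, hev⟩ := A.transition i j x (hd hxW) y (hd' hyW') hy.symm
  have hmem : ∀ᶠ x' in 𝓝 x, φ x' ∈ W' :=
    hφ.continuousAt.eventually_mem (by rw [hφx]; exact hW'.mem_nhds hyW')
  refine (hφ.congr_of_eventuallyEq ?_).contDiffWithinAt
  filter_upwards [hev, hmem] with x' h1 h2
  change (A.paramHomeomorph j W' hW' hd' hi').symm (A.param i x') = φ x'
  rw [← h1.2]
  exact (A.paramHomeomorph j W' hW' hd' hi').left_inv h2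

theorem isManifold : letI := A.chartedSpace; IsManifold 𝓘(ℂ, E) ω X := by
  let _ := A.chartedSpace
  refine isManifold_of_contDiffOn _ _ _ fun e e' he he' => ?_
  simpa using! A.contDiffOn_transition e e' he he'

theorem isManifold_real : letI := A.chartedSpace; IsManifold 𝓘(ℝ, E) ω X := by
  let _ := A.chartedSpace
  refine isManifold_of_contDiffOn _ _ _ fun e e' he he' => ?_
  simpa using! (A.contDiffOn_transition e e' he he').restrict_scalars ℝ

end EtaleAtlas

/-! ## The elliptic fibration of type `I_d` over the unit disk -/

/-- The local model `{(u, v) ∈ ℂ² : |uv| < 1}`, fibred over the unit disk by `(u, v) ↦ uv`. -/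
def modelDom : Set (ℂ × ℂ) := {p | ‖p.1 * p.2‖ < 1}

theorem isOpen_modelDom : IsOpen modelDom :=
  isOpen_lt (by fun_prop) continuous_const

theorem zero_mem_modelDom : (0 : ℂ × ℂ) ∈ modelDom := by simp [modelDom]

/-- The gluing of the `i`-th copy of the local model to the `(i+1)`-st one:
`(u, v)` with `v ≠ 0` is identified with `(v⁻¹, u v²)`. -/
def TateStep (d : ℕ) (a b : Σ _ : ZMod d, modelDom) : Prop :=
  b.1 = a.1 + 1 ∧ a.2.1.2 ≠ 0 ∧ b.2.1 = (a.2.1.2⁻¹, a.2.1.1 * a.2.1.2 ^ 2)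

/-- The total space `Y_d` of the elliptic fibration of type `I_d`: copies of the local model,
indexed by `ℤ/d`, glued cyclically. For `d = 0` this is the infinite chain, i.e. the
(blown up and punctured) `D × ℙ¹`, and `Y_d` is its quotient by `dℤ`. In the coordinate
`w = u q ^ i` (where `q = u v`) on the `i`-th copy, the fibre over `q ≠ 0` is `ℂˣ / q ^ (d ℤ)`;
the fibre over `0` is a cycle of `d` projective lines. -/
def TateFibration (d : ℕ) : Type := Quot (TateStep d)

instance (d : ℕ) : TopologicalSpace (TateFibration d) :=
  inferInstanceAs (TopologicalSpace (Quot (TateStep d)))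

namespace TateFibration

variable {d : ℕ}

/-- The class in `Y_d` of a point of the `i`-th copy of the local model. -/
def mk (i : ZMod d) (x : modelDom) : TateFibration d := Quot.mk _ ⟨i, x⟩

/-- The inclusion of the `i`-th copy of the local model (only meaningful on `modelDom`). -/
def param (i : ZMod d) (x : ℂ × ℂ) : TateFibration d :=
  open Classical in if h : x ∈ modelDom then mk i ⟨x, h⟩ else mk i ⟨0, zero_mem_modelDom⟩

theorem param_of_mem (i : ZMod d) {x : ℂ × ℂ} (h : x ∈ modelDom) : param i x = mk i ⟨x, h⟩ :=
  dif_pos h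

/-- The map `Y_d → ℂ`, `(u, v) ↦ u v`, with values in the unit disk. -/
def proj : TateFibration d → ℂ :=
  Quot.lift (fun a => a.2.1.1 * a.2.1.2) (by
    rintro a b ⟨-, h2, h3⟩
    rw [h3]
    field_simp)

theorem norm_proj_lt (y : TateFibration d) : ‖proj y‖ < 1 := by
  induction y using Quot.ind with
  | mk a => exact a.2.2

/-- The action of `ℤ/d` on `Y_d` by rotation of the cycle of local models: on the fibre
`ℂˣ / q ^ (d ℤ)` over `q ≠ 0` the class of `k` acts by multiplication by `q ^ k`. -/
instance : AddAction (ZMod d) (TateFibration d) where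
  vadd k := Quot.map (fun a => ⟨k + a.1, a.2⟩) (by
    rintro a b ⟨h1, h2, h3⟩
    exact ⟨by simp only [h1]; ring, h2, h3⟩)
  zero_vadd y := by
    induction y using Quot.ind with
    | mk a => exact congrArg (Quot.mk _) (by ext <;> simp)
  add_vadd k l y := by
    induction y using Quot.ind with
    | mk a => exact congrArg (Quot.mk _) (by ext <;> simp [add_assoc])

theorem vadd_mk (k i : ZMod d) (x : modelDom) : k +ᵥ mk i x = mk (k + i) x := rfl

theorem vadd_param (k i : ZMod d) (x : ℂ × ℂ) : k +ᵥ param i x = param (k + i) x := by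
  unfold param
  split_ifs <;> rfl

theorem proj_vadd (k : ZMod d) (y : TateFibration d) : proj (k +ᵥ y) = proj y := by
  induction y using Quot.ind with
  | mk a => rfl

/-! ### Changes of coordinates -/

/-- Near `a` there is a holomorphic map to the copy containing `b`, compatible with the gluing. -/
def Transport (a b : Σ _ : ZMod d, modelDom) : Prop :=
  ∃ φ : ℂ × ℂ → ℂ × ℂ, ContDiffAt ℂ ω φ a.2.1 ∧ φ a.2.1 = b.2.1 ∧
    ∀ᶠ x in 𝓝 a.2.1, φ x ∈ modelDom ∧ param b.1 (φ x) = param a.1 x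

theorem Transport.refl (a : Σ _ : ZMod d, modelDom) : Transport a a :=
  ⟨id, contDiffAt_id, rfl, by
    filter_upwards [isOpen_modelDom.mem_nhds a.2.2] with x hx
    exact ⟨hx, rfl⟩⟩

theorem Transport.trans {a b c : Σ _ : ZMod d, modelDom} (h : Transport a b)
    (h' : Transport b c) : Transport a c := by
  obtain ⟨φ, h1, h2, h3⟩ := h
  obtain ⟨ψ, k1, k2, k3⟩ := h'
  refine ⟨ψ ∘ φ, ContDiffAt.comp _ (by rw [h2]; exact k1) h1, by simp [h2, k2], ?_⟩
  have := h1.continuousAt.eventually (p := fun y => ψ y ∈ modelDom ∧ param c.1 (ψ y) = param b.1 y)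
    (by rw [h2]; exact k3)
  filter_upwards [h3, this] with x hx hx'
  exact ⟨hx'.1, hx'.2.trans hx.2⟩

theorem mem_of_step {x : ℂ × ℂ} (hx : x ∈ modelDom) (h : x.2 ≠ 0) :
    (x.2⁻¹, x.1 * x.2 ^ 2) ∈ modelDom := by
  have : x.2⁻¹ * (x.1 * x.2 ^ 2) = x.1 * x.2 := by field_simp
  simpa only [modelDom, mem_ofPred_eq, this] using hx

theorem mem_of_step_symm {x : ℂ × ℂ} (hx : x ∈ modelDom) (h : x.1 ≠ 0) :
    (x.1 ^ 2 * x.2, x.1⁻¹) ∈ modelDom := by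
  have : x.1 ^ 2 * x.2 * x.1⁻¹ = x.1 * x.2 := by field_simp
  simpa only [modelDom, mem_ofPred_eq, this] using hx

theorem param_step (i : ZMod d) {x : ℂ × ℂ} (hx : x ∈ modelDom) (h : x.2 ≠ 0) :
    param (i + 1) (x.2⁻¹, x.1 * x.2 ^ 2) = param i x := by
  rw [param_of_mem _ hx, param_of_mem _ (mem_of_step hx h)]
  exact (Quot.sound ⟨rfl, h, rfl⟩).symm

theorem Transport.of_step {a b : Σ _ : ZMod d, modelDom} (h : TateStep d a b) :
    Transport a b ∧ Transport b a := by
  obtain ⟨i, ⟨x, hx⟩⟩ := a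
  obtain ⟨j, ⟨y, hy⟩⟩ := b
  obtain ⟨h1, h2, h3⟩ := h
  simp only at h1 h2 h3
  subst h1
  have hy1 : y.1 ≠ 0 := by rw [h3]; exact inv_ne_zero h2
  constructor
  · refine ⟨fun x => (x.2⁻¹, x.1 * x.2 ^ 2), ?_, h3.symm, ?_⟩
    · exact (contDiffAt_snd.inv h2).prodMk (contDiffAt_fst.mul (contDiffAt_snd.pow 2))
    · filter_upwards [isOpen_modelDom.mem_nhds hx,
        continuousAt_snd.eventually_ne h2] with z hz hz2
      exact ⟨mem_of_step hz hz2, param_step _ hz hz2⟩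
  · refine ⟨fun x => (x.1 ^ 2 * x.2, x.1⁻¹), ?_, ?_, ?_⟩
    · exact ((contDiffAt_fst.pow 2).mul contDiffAt_snd).prodMk (contDiffAt_fst.inv hy1)
    · simp only [h3]
      ext
      · simp
        field_simp
      · simp
    · filter_upwards [isOpen_modelDom.mem_nhds hy,
        continuousAt_fst.eventually_ne hy1] with z hz hz1
      refine ⟨mem_of_step_symm hz hz1, ?_⟩
      have := param_step i (mem_of_step_symm hz hz1) (inv_ne_zero hz1)
      rw [← this]
      congr 1
      ext
      · simp
      · simp
        field_simp

theorem transport_of_eq {a b : Σ _ : ZMod d, modelDom}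
    (h : (Quot.mk (TateStep d) a) = Quot.mk _ b) : Transport a b := by
  have key : ∀ a b, Relation.EqvGen (TateStep d) a b → Transport a b ∧ Transport b a := by
    intro a b h
    induction h with
    | rel a b h => exact Transport.of_step h
    | refl a => exact ⟨.refl a, .refl a⟩
    | symm a b _ ih => exact ih.symm
    | trans a b c _ _ ih ih' => exact ⟨ih.1.trans ih'.1, ih'.2.trans ih.2⟩
  exact (key a b (Quot.eqvGen_exact h)).1

/-- The identifications between the copies of the local model, `k` steps apart. -/
def StepRel (k : ℤ) (x y : ℂ × ℂ) : Prop :=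
  x.1 * x.2 = y.1 * y.2 ∧
    ((x.1 * x.2 ≠ 0 ∧ y.1 * (x.1 * x.2) ^ k = x.1) ∨
      (x.1 * x.2 = 0 ∧ ((k = 0 ∧ x = y) ∨
        (k = 1 ∧ x.1 = 0 ∧ y.2 = 0 ∧ y.1 * x.2 = 1) ∨
        (k = -1 ∧ x.2 = 0 ∧ y.1 = 0 ∧ x.1 * y.2 = 1))))

theorem StepRel.symm {k : ℤ} {x y : ℂ × ℂ} (h : StepRel k x y) : StepRel (-k) y x := by
  obtain ⟨h0, ⟨h1, h2⟩ | ⟨h1, h2⟩⟩ := h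
  · refine ⟨h0.symm, Or.inl ⟨h0 ▸ h1, ?_⟩⟩
    rw [← h0, zpow_neg, mul_inv_eq_iff_eq_mul₀ (zpow_ne_zero _ h1), h2]
  · refine ⟨h0.symm, Or.inr ⟨h0 ▸ h1, ?_⟩⟩
    rcases h2 with ⟨rfl, rfl⟩ | ⟨rfl, h3, h4, h5⟩ | ⟨rfl, h3, h4, h5⟩
    · simp
    · exact Or.inr (Or.inr ⟨rfl, h4, h3, h5⟩)
    · exact Or.inr (Or.inl ⟨by simp, h4, h3, h5⟩)

theorem StepRel.trans {k l : ℤ} {x y z : ℂ × ℂ} (h : StepRel k x y) (h' : StepRel l y z) :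
    StepRel (k + l) x z := by
  obtain ⟨h0, ⟨h1, h2⟩ | ⟨h1, h2⟩⟩ := h
  · obtain ⟨k0, ⟨k1, k2⟩ | ⟨k1, k2⟩⟩ := h'
    · refine ⟨h0.trans k0, Or.inl ⟨h1, ?_⟩⟩
      rw [← h0] at k2
      rw [add_comm, zpow_add₀ h1, ← mul_assoc, k2, h2]
    · exact absurd (h0.trans k1) h1
  · obtain ⟨k0, ⟨k1, k2⟩ | ⟨k1, k2⟩⟩ := h'
    · exact absurd (h0.symm.trans h1) k1
    · refine ⟨h0.trans k0, Or.inr ⟨h1, ?_⟩⟩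
      rcases h2 with ⟨rfl, rfl⟩ | ⟨rfl, h3, h4, h5⟩ | ⟨rfl, h3, h4, h5⟩
      · simpa using k2
      · rcases k2 with ⟨rfl, rfl⟩ | ⟨rfl, k3, k4, k5⟩ | ⟨rfl, k3, k4, k5⟩
        · exact Or.inr (Or.inl ⟨by simp, h3, h4, h5⟩)
        · simp [k3] at h5
        · refine Or.inl ⟨by simp, Prod.ext (by rw [h3, k4]) ?_⟩
          exact mul_left_cancel₀ (left_ne_zero_of_mul_eq_one h5) (h5.trans k5.symm)
      · rcases k2 with ⟨rfl, rfl⟩ | ⟨rfl, k3, k4, k5⟩ | ⟨rfl, k3, k4, k5⟩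
        · exact Or.inr (Or.inr ⟨by simp, h3, h4, h5⟩)
        · refine Or.inl ⟨by simp, Prod.ext ?_ (by rw [h3, k4])⟩
          exact mul_right_cancel₀ (right_ne_zero_of_mul_eq_one h5) (h5.trans k5.symm)
        · simp [k3] at h5

theorem stepRel_of_eq {a b : Σ _ : ZMod d, modelDom}
    (hab : (Quot.mk (TateStep d) a) = Quot.mk _ b) : ∃ k : ℤ, StepRel k a.2.1 b.2.1 := by
  have h := Quot.eqvGen_exact hab
  clear hab
  induction h with
  | rel a b h =>
    obtain ⟨-, h2, h3⟩ := h
    refine ⟨1, ?_, ?_⟩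
    · rw [h3]; field_simp
    · by_cases h0 : a.2.1.1 = 0
      · right
        simp [h0, h3, h2]
      · left
        refine ⟨mul_ne_zero h0 h2, ?_⟩
        rw [h3]
        simp only [zpow_one]
        field_simp
  | refl a =>
    refine ⟨0, rfl, ?_⟩
    by_cases h : a.2.1.1 * a.2.1.2 = 0
    · exact Or.inr ⟨h, Or.inl ⟨rfl, rfl⟩⟩
    · exact Or.inl ⟨h, by simp⟩
  | symm a b _ ih => exact ⟨_, ih.choose_spec.symm⟩
  | trans a b c _ _ ih ih' => exact ⟨_, ih.choose_spec.trans ih'.choose_spec⟩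

theorem StepRel.swap {k : ℤ} {x y : ℂ × ℂ} (h : StepRel k x y) :
    StepRel (-k) x.swap y.swap := by
  obtain ⟨h0, ⟨h1, h2⟩ | ⟨h1, h2⟩⟩ := h
  · refine ⟨by simpa [mul_comm] using h0, Or.inl ⟨by simpa [mul_comm] using h1, ?_⟩⟩
    have hx1 : x.1 ≠ 0 := left_ne_zero_of_mul h1
    have hz := zpow_ne_zero k h1
    have hy1 : y.1 ≠ 0 := by
      intro h
      simp [h] at h2
      exact hx1 h2.symm
    simp only [Prod.fst_swap, Prod.snd_swap]
    rw [mul_comm x.2, zpow_neg, mul_inv_eq_iff_eq_mul₀ hz]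
    apply mul_left_cancel₀ hy1
    rw [← h0]
    calc x.1 * x.2 = (y.1 * (x.1 * x.2) ^ k) * x.2 := by rw [h2]
      _ = _ := by ring
  · refine ⟨by simpa [mul_comm] using h0, Or.inr ⟨by simpa [mul_comm] using h1, ?_⟩⟩
    rcases h2 with ⟨rfl, rfl⟩ | ⟨rfl, h3, h4, h5⟩ | ⟨rfl, h3, h4, h5⟩
    · simp
    · exact Or.inr (Or.inr ⟨by simp, h3, h4, by simpa [mul_comm] using h5⟩)
    · exact Or.inr (Or.inl ⟨by simp, h3, h4, by simpa [mul_comm] using h5⟩)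

theorem StepRel.norm_le {k : ℤ} {x y : ℂ × ℂ} (h : StepRel k x y) (hx : x ∈ modelDom)
    (h0 : x.1 * x.2 ≠ 0) (hk : 1 ≤ k) : ‖x.1‖ ≤ ‖y.1‖ * ‖x.1 * x.2‖ := by
  obtain ⟨-, ⟨-, h2⟩ | ⟨h1, -⟩⟩ := h
  · obtain ⟨l, rfl⟩ : ∃ l : ℕ, k = (l + 1 : ℕ) := ⟨(k - 1).toNat, by omega⟩
    rw [zpow_natCast] at h2
    calc ‖x.1‖ = ‖y.1‖ * ‖x.1 * x.2‖ ^ (l + 1) := by rw [← norm_pow, ← norm_mul, h2]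
      _ ≤ ‖y.1‖ * ‖x.1 * x.2‖ := by
        gcongr
        exact pow_le_of_le_one (norm_nonneg _) (le_of_lt hx) (by omega)
  · exact absurd h1 h0

theorem StepRel.eq_of_zero {x y : ℂ × ℂ} (h : StepRel 0 x y) : x = y := by
  obtain ⟨h0, ⟨h1, h2⟩ | ⟨h1, ⟨-, h2⟩ | ⟨h2, -⟩ | ⟨h2, -⟩⟩⟩ := h
  · have h3 : y.1 = x.1 := by simpa using h2
    refine Prod.ext h3.symm (mul_left_cancel₀ (left_ne_zero_of_mul h1) ?_)
    rw [h0, h3]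
  · exact h2
  · simp at h2
  · simp at h2

theorem exists_nhd_aux (c : ℂ × ℂ) (hc : c ∈ modelDom) (h1 : c.1 ≠ 0) :
    ∃ W, IsOpen W ∧ c ∈ W ∧ W ⊆ modelDom ∧
      ∀ k : ℤ, ∀ x ∈ W, ∀ y ∈ W, StepRel k x y → x = y := by
  obtain ⟨ρ, hρ, hρ1⟩ := exists_between (show ‖c.1 * c.2‖ < 1 from hc)
  have hρ0 : 0 ≤ ρ := (norm_nonneg _).trans hρ.le
  have hc1 : 0 < ‖c.1‖ := norm_pos_iff.2 h1
  refine ⟨{x | ‖x.1 * x.2‖ < ρ ∧ 2 * ρ * ‖c.1‖ < (1 + ρ) * ‖x.1‖ ∧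
    (1 + ρ) * ‖x.1‖ < 2 * ‖c.1‖}, ?_, ⟨hρ, by nlinarith, by nlinarith⟩,
    fun x hx => hx.1.trans hρ1, ?_⟩
  · refine IsOpen.and (isOpen_lt ?_ ?_) (IsOpen.and (isOpen_lt ?_ ?_) (isOpen_lt ?_ ?_)) <;>
      fun_prop
  have key : ∀ k : ℤ, 1 ≤ k → ∀ x y : ℂ × ℂ, StepRel k x y →
      ‖x.1 * x.2‖ < ρ → 2 * ρ * ‖c.1‖ < (1 + ρ) * ‖x.1‖ → (1 + ρ) * ‖y.1‖ < 2 * ‖c.1‖ →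
      False := by
    intro k hk x y h hx1 hx2 hy
    have hx0 : x.1 ≠ 0 := by
      intro h
      simp only [h, norm_zero, mul_zero] at hx2
      nlinarith [mul_nonneg hρ0 hc1.le]
    by_cases h0 : x.1 * x.2 = 0
    · obtain ⟨-, ⟨h1, -⟩ | ⟨-, ⟨h2, -⟩ | ⟨-, h2, -⟩ | ⟨h2, -⟩⟩⟩ := h
      · exact h1 h0
      · omega
      · exact hx0 h2
      · omega
    · have := h.norm_le (show ‖x.1 * x.2‖ < 1 from hx1.trans hρ1) h0 hk
      have h3 : ‖y.1‖ * ‖x.1 * x.2‖ ≤ ‖y.1‖ * ρ := by gcongr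
      have h4 : (1 + ρ) * ‖x.1‖ ≤ (1 + ρ) * (‖y.1‖ * ρ) := by gcongr; linarith
      nlinarith
  rintro k x ⟨hx1, hx2, hx3⟩ y ⟨hy1, hy2, hy3⟩ h
  rcases lt_trichotomy k 0 with hk | rfl | hk
  · exact (key (-k) (by omega) y x h.symm hy1 hy2 hx3).elim
  · exact h.eq_of_zero
  · exact (key k (by omega) x y h hx1 hx2 hy3).elim

theorem exists_nhd (c : ℂ × ℂ) (hc : c ∈ modelDom) :
    ∃ W, IsOpen W ∧ c ∈ W ∧ W ⊆ modelDom ∧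
      ∀ k : ℤ, ∀ x ∈ W, ∀ y ∈ W, StepRel k x y → x = y := by
  by_cases h1 : c.1 = 0
  · by_cases h2 : c.2 = 0
    · refine ⟨{x | ‖x.1‖ < 1 ∧ ‖x.2‖ < 1}, ?_, by simp [h1, h2], ?_, ?_⟩
      · refine IsOpen.and (isOpen_lt ?_ ?_) (isOpen_lt ?_ ?_) <;> fun_prop
      · rintro x ⟨hx1, hx2⟩
        simp only [modelDom, mem_ofPred_eq, norm_mul]
        nlinarith [norm_nonneg x.1, norm_nonneg x.2]
      have key : ∀ k : ℤ, 1 ≤ k → ∀ x y : ℂ × ℂ, StepRel k x y →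
          ‖x.1‖ < 1 → ‖x.2‖ < 1 → ‖y.1‖ < 1 → False := by
        intro k hk x y h hx1 hx2 hy1
        have hx : x ∈ modelDom := by
          simp only [modelDom, mem_ofPred_eq, norm_mul]
          nlinarith [norm_nonneg x.1, norm_nonneg x.2]
        by_cases h0 : x.1 * x.2 = 0
        · obtain ⟨-, ⟨h1, -⟩ | ⟨-, ⟨h2, -⟩ | ⟨-, -, -, h2⟩ | ⟨h2, -⟩⟩⟩ := h
          · exact h1 h0
          · omega
          · have := congrArg norm h2
            rw [norm_mul, norm_one] at this
            nlinarith [norm_nonneg y.1, norm_nonneg x.2]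
          · omega
        · have h3 := h.norm_le hx h0 hk
          rw [norm_mul] at h3
          have h4 : 0 < ‖x.1‖ := norm_pos_iff.2 (left_ne_zero_of_mul h0)
          have h5 : ‖y.1‖ * ‖x.2‖ < 1 := by nlinarith [norm_nonneg y.1, norm_nonneg x.2]
          nlinarith
      rintro k x ⟨hx1, hx2⟩ y ⟨hy1, hy2⟩ h
      rcases lt_trichotomy k 0 with hk | rfl | hk
      · exact (key (-k) (by omega) y x h.symm hy1 hy2 hx1).elim
      · exact h.eq_of_zero
      · exact (key k (by omega) x y h hx1 hx2 hy1).elim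
    · obtain ⟨W, hW, hcW, hd, hi⟩ := exists_nhd_aux c.swap
        (by simpa [modelDom, mul_comm] using hc) h2
      refine ⟨Prod.swap ⁻¹' W, hW.preimage continuous_swap, hcW, fun x hx => ?_, ?_⟩
      · have := hd hx
        simpa [modelDom, mul_comm] using this
      · intro k x hx y hy h
        exact Prod.swap_injective (hi _ _ hx _ hy h.swap)
  · exact exists_nhd_aux c hc h1

theorem stepRel_of_param_eq {i j : ZMod d} {x y : ℂ × ℂ} (hx : x ∈ modelDom) (hy : y ∈ modelDom)
    (h : param i x = param j y) : ∃ k : ℤ, StepRel k x y := by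
  rw [param_of_mem _ hx, param_of_mem _ hy] at h
  exact stepRel_of_eq h

theorem exists_transition {i j : ZMod d} {x y : ℂ × ℂ} (hx : x ∈ modelDom) (hy : y ∈ modelDom)
    (h : param i x = param j y) : ∃ φ : ℂ × ℂ → ℂ × ℂ, ContDiffAt ℂ ω φ x ∧ φ x = y ∧
      ∀ᶠ x' in 𝓝 x, φ x' ∈ modelDom ∧ param j (φ x') = param i x' := by
  rw [param_of_mem _ hx, param_of_mem _ hy] at h
  exact transport_of_eq h

theorem exists_param (y : TateFibration d) : ∃ i, ∃ x ∈ modelDom, param i x = y := by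
  induction y using Quot.ind with
  | mk a => exact ⟨a.1, a.2.1, a.2.2, param_of_mem _ a.2.2⟩

theorem continuousOn_param (i : ZMod d) : ContinuousOn (param i) modelDom := by
  rw [continuousOn_iff_continuous_domRestrict]
  have : modelDom.domRestrict (param i) = fun x => Quot.mk (TateStep d) ⟨i, x⟩ := by
    ext x
    exact param_of_mem i x.2
  rw [this]
  exact continuous_quot_mk.comp continuous_sigmaMk

theorem isOpen_image_param (i : ZMod d) (W : Set (ℂ × ℂ)) (hW : IsOpen W) (hd : W ⊆ modelDom) :
    IsOpen (param i '' W) := by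
  refine isOpen_coinduced.2 (isOpen_sigma_iff.2 fun j => ?_)
  rw [isOpen_iff_mem_nhds]
  rintro ⟨x, hx⟩ ⟨y, hyW, hy⟩
  have hy' : param j x = param i y := by rw [param_of_mem _ hx, hy]; rfl
  obtain ⟨φ, h1, h2, h3⟩ := exists_transition hx (hd hyW) hy'
  have h4 := h1.continuousAt.eventually_mem (by rw [h2]; exact hW.mem_nhds hyW)
  have h5 := (continuous_subtype_val.tendsto (⟨x, hx⟩ : modelDom)).eventually (h3.and h4)
  filter_upwards [h5] with z hz
  exact ⟨φ z, hz.2, hz.1.2.trans (param_of_mem _ z.2)⟩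

/-- The holomorphic atlas of `Y_d`. -/
def etaleAtlas (d : ℕ) : EtaleAtlas (ZMod d) (ℂ × ℂ) (TateFibration d) where
  dom := modelDom
  isOpen_dom := isOpen_modelDom
  param := param
  continuousOn := continuousOn_param
  isOpen_image := isOpen_image_param
  locally_injective i x hx := by
    obtain ⟨W, h1, h2, h3, h4⟩ := exists_nhd x hx
    refine ⟨W, h1, h2, h3, fun y hy z hz h => ?_⟩
    obtain ⟨k, hk⟩ := stepRel_of_param_eq (h3 hy) (h3 hz) h
    exact h4 k y hy z hz hk
  surjective := exists_param
  transition i j x hx y hy h := exists_transition hx hy h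

instance (d : ℕ) : ChartedSpace (ℂ × ℂ) (TateFibration d) := (etaleAtlas d).chartedSpace

instance (d : ℕ) : IsManifold 𝓘(ℂ, ℂ × ℂ) ω (TateFibration d) := (etaleAtlas d).isManifold

instance (d : ℕ) : ContinuousConstVAdd (ZMod d) (TateFibration d) where
  continuous_const_vadd k := by
    refine continuous_quot_lift _ (continuous_quot_mk.comp ?_)
    exact continuous_sigma fun i => continuous_sigmaMk (σ := fun _ => modelDom) (i := k + i)

end TateFibration

/-! ## Quotients of `Y_d ^ n` -/

/-- The quotient of the `n`-fold product `Y_d ^ n` by a subgroup of `(ℤ/d) ^ n`. -/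
def TateQuotient {n d : ℕ} (Γ : AddSubgroup (Fin n → ZMod d)) : Type :=
  Quotient (AddAction.orbitRel Γ (Fin n → TateFibration d))

namespace TateQuotient

open TateFibration

variable {n d : ℕ} (Γ : AddSubgroup (Fin n → ZMod d))

instance : TopologicalSpace (TateQuotient Γ) :=
  inferInstanceAs (TopologicalSpace (Quotient (AddAction.orbitRel Γ (Fin n → TateFibration d))))

/-- The quotient map `Y_d ^ n → Y_d ^ n / Γ`. -/
def mk (y : Fin n → TateFibration d) : TateQuotient Γ :=
  Quotient.mk (AddAction.orbitRel Γ (Fin n → TateFibration d)) y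

variable {Γ} in
theorem mk_eq_iff {y z : Fin n → TateFibration d} :
    mk Γ y = mk Γ z ↔ ∃ a ∈ Γ, ∀ j, a j +ᵥ z j = y j := by
  refine Quotient.eq.trans ?_
  constructor
  · rintro ⟨a, ha⟩
    exact ⟨a.1, a.2, fun j => congrFun ha j⟩
  · rintro ⟨a, ha, h⟩
    exact ⟨⟨a, ha⟩, funext h⟩

/-- The open unit polydisk `D ^ n`, as an open submanifold of `ℂ ^ n`. -/
def polydisk (n : ℕ) : TopologicalSpace.Opens (Fin n → ℂ) where
  carrier := {t | ∀ j, ‖t j‖ < 1}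
  is_open' := by
    simp only [ofPred_forall]
    exact isOpen_iInter_of_finite fun j => isOpen_lt (by fun_prop) (by fun_prop)

/-- The map `Y_d ^ n / Γ → D ^ n` induced by the `n`-fold product of `Y_d → D`. -/
def proj : TateQuotient Γ → polydisk n :=
  Quotient.lift (fun y => ⟨fun j => (y j).proj, fun j => norm_proj_lt (y j)⟩) (by
    intro y z h
    obtain ⟨a, -, h⟩ := mk_eq_iff.1 (Quotient.sound h : mk Γ y = mk Γ z)
    ext j
    simp only [← h j, proj_vadd])

/-- The inclusion of the copy of the `n`-th power of the local model with index `i`. -/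
def param (i : Fin n → ZMod d) (x : Fin n → ℂ × ℂ) : TateQuotient Γ :=
  mk Γ fun j => TateFibration.param (i j) (x j)

theorem continuous_mk : Continuous (mk Γ) := continuous_quot_mk

theorem isOpenMap_mk : IsOpenMap (mk Γ) := by
  have : ContinuousConstVAdd Γ (Fin n → TateFibration d) :=
    ⟨fun a => continuous_pi fun j => (continuous_const_vadd (a.1 j)).comp (continuous_apply j)⟩
  exact isOpenMap_quotient_mk'_add

variable {Γ} in
theorem exists_vadd {i i' : Fin n → ZMod d} {x y : Fin n → ℂ × ℂ}
    (h : param Γ i x = param Γ i' y) : ∃ a ∈ Γ, ∀ j,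
      TateFibration.param (i j) (x j) = TateFibration.param (a j + i' j) (y j) := by
  obtain ⟨a, ha, h⟩ := mk_eq_iff.1 h
  exact ⟨a, ha, fun j => by rw [← h j, vadd_param]⟩

/-- The holomorphic atlas of `Y_d ^ n / Γ`. -/
def etaleAtlas : EtaleAtlas (Fin n → ZMod d) (Fin n → ℂ × ℂ) (TateQuotient Γ) where
  dom := Set.univ.pi fun _ => modelDom
  isOpen_dom := isOpen_set_pi finite_univ fun _ _ => isOpen_modelDom
  param := param Γ
  continuousOn i := by
    refine (continuous_mk Γ).comp_continuousOn (continuousOn_pi.2 fun j => ?_)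
    exact (continuousOn_param (i j)).comp (continuous_apply j).continuousOn
      fun x hx => hx j (mem_univ j)
  isOpen_image i W hW hd := by
    rw [isOpen_iff_mem_nhds]
    rintro _ ⟨x, hx, rfl⟩
    obtain ⟨V, hV, hVW⟩ := isOpen_pi_iff'.1 hW x hx
    have h1 : IsOpen (mk Γ '' (Set.univ.pi fun j =>
        TateFibration.param (i j) '' (V j ∩ modelDom))) :=
      isOpenMap_mk Γ _ (isOpen_set_pi finite_univ fun j _ => isOpen_image_param _ _
        ((hV j).1.inter isOpen_modelDom) inter_subset_right)
    refine mem_of_superset (h1.mem_nhds (mem_image_of_mem _ fun j _ =>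
      ⟨x j, ⟨(hV j).2, hd hx j (mem_univ j)⟩, rfl⟩)) ?_
    rintro _ ⟨y, hy, rfl⟩
    choose z hz hzy using fun j => hy j (mem_univ j)
    exact ⟨z, hVW fun j _ => (hz j).1, congrArg (mk Γ) (funext hzy)⟩
  locally_injective i x hx := by
    choose W h1 h2 h3 h4 using fun j => exists_nhd (x j) (hx j (mem_univ j))
    refine ⟨Set.univ.pi W, isOpen_set_pi finite_univ fun j _ => h1 j, fun j _ => h2 j,
      fun y hy j _ => h3 j (hy j (mem_univ j)), fun y hy z hz h => ?_⟩
    obtain ⟨a, -, ha⟩ := exists_vadd h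
    ext1 j
    have hyj := hy j (mem_univ j)
    have hzj := hz j (mem_univ j)
    obtain ⟨k, hk⟩ := stepRel_of_param_eq (h3 j hyj) (h3 j hzj) (ha j)
    exact h4 j k _ hyj _ hzj hk
  surjective y := by
    induction y using Quotient.ind with
    | _ y =>
      choose i x hx h using fun j => exists_param (y j)
      exact ⟨i, x, fun j _ => hx j, congrArg (mk Γ) (funext h)⟩
  transition i i' x hx y hy h := by
    obtain ⟨a, ha, h⟩ := exists_vadd h
    choose φ h1 h2 h3 using fun j =>
      exists_transition (hx j (mem_univ j)) (hy j (mem_univ j)) (h j)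
    refine ⟨fun z j => φ j (z j), contDiffAt_pi.2 fun j => ?_, funext h2, ?_⟩
    · exact (h1 j).comp x (contDiff_apply ℂ (ℂ × ℂ) j).contDiffAt
    · have := eventually_all.2 fun j => (continuous_apply j).continuousAt.eventually (h3 j)
      filter_upwards [this] with z hz
      refine ⟨fun j _ => (hz j).1, ?_⟩
      refine (mk_eq_iff.2 ⟨a, ha, fun j => ?_⟩ : mk Γ _ = mk Γ _).symm
      rw [vadd_param, (hz j).2]

instance : ChartedSpace (Fin n → ℂ × ℂ) (TateQuotient Γ) := (etaleAtlas Γ).chartedSpace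

instance : IsManifold 𝓘(ℂ, Fin n → ℂ × ℂ) ω (TateQuotient Γ) := (etaleAtlas Γ).isManifold

instance : IsManifold 𝓘(ℝ, Fin n → ℂ × ℂ) ω (TateQuotient Γ) := (etaleAtlas Γ).isManifold_real

end TateQuotient

/-! ## Kähler forms -/

/-- A Kähler form on a complex manifold `X` modelled on `E`, given by its local expressions
`form e` in the charts `e` of the atlas: a smooth real 2-form which is alternating, invariant under
multiplication by `i`, positive, closed, and compatible with changes of charts. -/
structure KahlerForm (E X : Type*) [NormedAddCommGroup E] [NormedSpace ℂ E]
    [TopologicalSpace X] [ChartedSpace E X] where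
  form : OpenPartialHomeomorph X E → E → E →L[ℝ] E →L[ℝ] ℝ
  contDiffOn : ∀ e ∈ atlas E X, ContDiffOn ℝ ∞ (form e) e.target
  alternating : ∀ e ∈ atlas E X, ∀ x ∈ e.target, ∀ v, form e x v v = 0
  invariant : ∀ e ∈ atlas E X, ∀ x ∈ e.target, ∀ v w,
    form e x (Complex.I • v) (Complex.I • w) = form e x v w
  positive : ∀ e ∈ atlas E X, ∀ x ∈ e.target, ∀ v ≠ 0, 0 < form e x v (Complex.I • v)
  closed : ∀ e ∈ atlas E X, ∀ x ∈ e.target, ∀ u v w,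
    fderiv ℝ (form e) x u v w + fderiv ℝ (form e) x v w u + fderiv ℝ (form e) x w u v = 0
  compatible : ∀ e ∈ atlas E X, ∀ e' ∈ atlas E X, ∀ x ∈ e.target, e.symm x ∈ e'.source →
    ∀ v w, form e x v w =
      form e' (e' (e.symm x)) (fderiv ℝ (e' ∘ e.symm) x v) (fderiv ℝ (e' ∘ e.symm) x w)

/-- A self-map of `X` which is holomorphic and preserves the Kähler form `η`. -/
def KahlerForm.IsPreservedBy {E X : Type*} [NormedAddCommGroup E] [NormedSpace ℂ E]
    [TopologicalSpace X] [ChartedSpace E X] (η : KahlerForm E X) (f : X → X) : Prop :=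
  ContMDiff 𝓘(ℂ, E) 𝓘(ℂ, E) ω f ∧
    ∀ e ∈ atlas E X, ∀ e' ∈ atlas E X, ∀ x ∈ e.target, f (e.symm x) ∈ e'.source → ∀ v w,
      η.form e x v w = η.form e' (e' (f (e.symm x)))
        (fderiv ℝ (e' ∘ f ∘ e.symm) x v) (fderiv ℝ (e' ∘ f ∘ e.symm) x w)

/-- The Kähler form `Θ` on `Y_d ^ n / Γ` is induced by the Kähler form `η` on `Y_d`: its pullback
to `Y_d ^ n` is the product Kähler form, the sum of the pullbacks of `η` along the `n`
projections. -/
def TateQuotient.IsInducedBy {n d : ℕ} {Γ : AddSubgroup (Fin n → ZMod d)}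
    (Θ : KahlerForm (Fin n → ℂ × ℂ) (TateQuotient Γ))
    (η : KahlerForm (ℂ × ℂ) (TateFibration d)) : Prop :=
  ∀ e : Fin n → OpenPartialHomeomorph (TateFibration d) (ℂ × ℂ),
    (∀ j, e j ∈ atlas (ℂ × ℂ) (TateFibration d)) →
    ∀ e' ∈ atlas (Fin n → ℂ × ℂ) (TateQuotient Γ), ∀ x : Fin n → ℂ × ℂ,
      (∀ j, x j ∈ (e j).target) →
      TateQuotient.mk Γ (fun j => (e j).symm (x j)) ∈ e'.source →
      let F : (Fin n → ℂ × ℂ) → (Fin n → ℂ × ℂ) :=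
        fun x => e' (TateQuotient.mk Γ (fun j => (e j).symm (x j)))
      ∀ v w : Fin n → ℂ × ℂ,
        Θ.form e' (F x) (fderiv ℝ F x v) (fderiv ℝ F x w) =
          ∑ j, η.form (e j) (x j) (v j) (w j)

/-! ## Integer matrices and finite subgroups of tori -/

/-- The endomorphism `𝒫(A)` of `(ℂˣ) ^ m`, `λ ↦ (∏ j, λ_j ^ a_ij)_i`. -/
def torusHom {m : ℕ} (A : Matrix (Fin m) (Fin m) ℤ) : (Fin m → ℂˣ) →* (Fin m → ℂˣ) where
  toFun l i := ∏ j, l j ^ A i j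
  map_one' := by ext; simp
  map_mul' l l' := by
    ext i
    simp [mul_zpow, Finset.prod_mul_distrib]

/-- `d`, `T` and some `M'` satisfy `T M' = diag(d, …, d, 1, …, 1)` (with `n` entries `d`), where
`d > 0`, `T` and `M'` are `m × m` of full rank, and the first `n` columns of `M'` form `M`. -/
def IsCoveringData {m n : ℕ} (hmn : n ≤ m) (M : Matrix (Fin m) (Fin n) ℤ) (d : ℕ)
    (T : Matrix (Fin m) (Fin m) ℤ) : Prop :=
  0 < d ∧ T.det ≠ 0 ∧ ∃ M' : Matrix (Fin m) (Fin m) ℤ, M'.det ≠ 0 ∧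
    (∀ i j, M' i (Fin.castLE hmn j) = M i j) ∧
    T * M' = Matrix.diagonal fun k : Fin m => if (k : ℕ) < n then (d : ℤ) else 1

/-- The embedding of `(ℤ/d) ^ n` into `(ℂˣ) ^ m` sending `a` to
`(exp (2πi a_1 / d), …, exp (2πi a_n / d), 1, …, 1)`. -/
def rootVector {n d : ℕ} [NeZero d] (m : ℕ) (a : Fin n → ZMod d) (k : Fin m) : ℂˣ :=
  if h : (k : ℕ) < n then Circle.toUnits (ZMod.toCircle (a ⟨k, h⟩)) else 1

theorem rootVector_zero {n d : ℕ} [NeZero d] (m : ℕ) :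
    rootVector m (0 : Fin n → ZMod d) = 1 := by
  ext k
  simp [rootVector]

theorem rootVector_add {n d : ℕ} [NeZero d] (m : ℕ) (a b : Fin n → ZMod d) :
    rootVector m (a + b) = rootVector m a * rootVector m b := by
  ext k
  by_cases h : (k : ℕ) < n <;> simp [rootVector, h, AddChar.map_add_eq_mul]

theorem rootVector_neg {n d : ℕ} [NeZero d] (m : ℕ) (a : Fin n → ZMod d) :
    rootVector m (-a) = (rootVector m a)⁻¹ := by
  rw [eq_inv_iff_mul_eq_one, ← rootVector_add, neg_add_cancel, rootVector_zero]

/-- The group `𝒩(Tᵀ)`, the kernel of `𝒫(Tᵀ)`, viewed as a subgroup of `(ℤ/d) ^ n`. -/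
def deckGroup {m : ℕ} (n d : ℕ) [NeZero d] (T : Matrix (Fin m) (Fin m) ℤ) :
    AddSubgroup (Fin n → ZMod d) where
  carrier := {a | rootVector m a ∈ (torusHom T.transpose).ker}
  zero_mem' := by
    rw [mem_ofPred_eq, rootVector_zero]
    exact one_mem _
  add_mem' {a b} ha hb := by
    rw [mem_ofPred_eq] at ha hb ⊢
    rw [rootVector_add]
    exact mul_mem ha hb
  neg_mem' {a} ha := by
    rw [mem_ofPred_eq] at ha ⊢
    rw [rootVector_neg]
    exact inv_mem ha

/-! ## The space `Y(M)` and its fibration -/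

/-- The isolated cluster variety of `M` in `ℂ ^ n × ℂ ^ n × (ℂˣ) ^ m`, with coordinates
`(x, y, z)`. Its underlying manifold is `Y(M)`. -/
def clusterVariety {m n : ℕ} (M : Matrix (Fin m) (Fin n) ℤ) :
    Set ((Fin n → ℂ) × (Fin n → ℂ) × (Fin m → ℂ)) :=
  {p | (∀ k, p.2.2 k ≠ 0) ∧ ∀ j, p.1 j * p.2.1 j = ∏ i, p.2.2 i ^ M i j + 1}

/-- The map `(x, y, z) ↦ (|x_i|² - |y_i|², log |z_k|)` (to be restricted to `Y(M)`). -/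
def lagrangianMap {m n : ℕ} (p : (Fin n → ℂ) × (Fin n → ℂ) × (Fin m → ℂ)) :
    (Fin n → ℝ) × (Fin m → ℝ) :=
  (fun i => ‖p.1 i‖ ^ 2 - ‖p.2.1 i‖ ^ 2, fun k => Real.log ‖p.2.2 k‖)

/-- The torus `(ℂˣ) ^ k`, as an open submanifold of `ℂ ^ k`. -/
def algTorus (k : ℕ) : TopologicalSpace.Opens (Fin k → ℂ) where
  carrier := {w | ∀ j, w j ≠ 0}
  is_open' := by
    simp only [ofPred_forall]
    exact isOpen_iInter_of_finite fun j => isOpen_ne.preimage (continuous_apply j)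

/-- `f` is a diffeomorphism of the manifold `X` onto the embedded submanifold `S` of the real
vector space `V`: a smooth embedding (an immersion which is a homeomorphism onto its image) with
image `S`. -/
structure IsDiffeoOnto {B H X V : Type*} [NormedAddCommGroup B] [NormedSpace ℝ B]
    [TopologicalSpace H] (I : ModelWithCorners ℝ B H) [TopologicalSpace X] [ChartedSpace H X]
    [NormedAddCommGroup V] [NormedSpace ℝ V] (S : Set V) (f : X → V) : Prop where
  contMDiff : ContMDiff I 𝓘(ℝ, V) ∞ f
  injective_mfderiv : ∀ x, Function.Injective (mfderiv I 𝓘(ℝ, V) f x)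
  isEmbedding : IsEmbedding f
  range_eq : range f = S

end IsolatedCluster

end

open IsolatedCluster

/-!
The Kähler form comes from theta functions. On a copy of the local model put
`fₙ = u ^ (n (n + 1) / 2) v ^ (n (n - 1) / 2)` for `n ∈ ℤ`. These monomials form a holomorphic map
`thetaMap` into `ℓ²(ℤ)`, and the gluing `(u, v) ↦ (v⁻¹, u v²)` changes it by a shift of the
coordinates and the factor `v⁻¹`. So `log ‖thetaMap‖²` changes by a pluriharmonic function, and the
pullback of the Fubini–Study form (`modelForm`) glues to a form on `Y_d` invariant under `ℤ/d`. It
is positive since `f₀, f₁, f₋₁` are `1, u, v` (`modelForm_pos`). The sum of these forms over the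
factors of `Y_d ^ n` descends to the quotient (`isInducedBy_kahlerForm`). The projection to the
polydisk is proper because each point of `Y_d` has a representative with `|u|, |v| ≤ 1`
(`exists_param_norm_le`).

Suitable `d`, `T` and an extension `M'` of `M` to a square matrix exist by the Smith normal form
(`exists_isCoveringData`). As
`M'ᵀ Tᵀ = diag (d, …, d, 1, …, 1)`, an element of `𝒩(Tᵀ)` has entries whose `d`-th powers,
respectively the entries themselves, are `1` (`exists_rootVector_eq`).

The main point is the case `m = n = 1`: a `C^∞` diffeomorphism from `Y_d` to the surface
`X Y = L ^ d + 1`, `L ≠ 0`. The circle acts on `Y_d` by `(c u, c̄ v)`. Its moment map is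
`t = ∑ n |fₙ|² / ∑ |fₙ|²` (`moment`), which increases by `1` under the gluing and is strictly
increasing along the flow `(e^s u, e^{-s} v)` by positivity of the Kähler form. Hence `(q, t)`, with
`q = u v`, determines a point of the local model up to the circle. An angle `θ` (`exists_angle`)
agrees with `2 π t` except close to the node, where it is modified to have an explicit normal form
(the moment map itself is not that explicit). Let `q / √(1 - |q|²) = α + 2 i (r - 1 / r)` and
`Z = -r² e^{iθ}`. On the window `-1/2 < t < 5/6`, which contains a fundamental domain of the gluing,
there are smooth functions `X`, `Y` of weights `1`, `-1` for the circle with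

* `X Y = 1 + Z` (`xCoord_mul_yCoord`) and `|X|² - |Y|² = r α` (`norm_sq_sub_coord`),
* the same values at points which the gluing identifies (`coord_stepMap`).

The moduli of `X` and `Y` are forced by these equations; near `t = 0` they are, up to unit factors,
multiples of `u' + v̄'` and `ū' - v'` for rescaled coordinates `(u', v')`, and for larger `t` only
the phase of `X` is deformed. With a `d`-th root `L` of `Z`, which the action of `ℤ/d` multiplies by
roots of unity, the map `(X, Y, L)` is a bijection (`eq_of_functions_eq`, `exists_functions_eq`) and
an immersion (`eq_zero_of_fderiv_coord`). In these terms `q` and `(|X|² - |Y|², log |L|)` determine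
each other through `baseMap`, a diffeomorphism of the plane to the disk.

In general, the point with coordinates `y ∈ Y_d ^ n` and `w ∈ (ℂˣ) ^ (m - n)` is sent to
`(X(y), Y(y), z)`, where `z` is the image of `(L(y_1), …, L(y_n), w)` under the endomorphism `Tᵀ` of
the torus (`clusterMap`). The kernel of this endomorphism is `𝒩(Tᵀ)`, and its multiplication on
`(L, w)` is, up to inversion, the effect of its action on `Y_d ^ n`, so the map is well defined and
injective on the quotient. Since the endomorphism `M'ᵀ` takes `z` to
`(L_1 ^ d, …, L_n ^ d, w)`, the image satisfies the equations of `Y(M)` and the map is an immersion;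
it is an embedding because its composition with `h` is proper. The diffeomorphism of the bases
(`baseDiffeomorph`) combines `baseMap` with the linear map `M'ᵀ` on the logarithms.
-/

open scoped Manifold ContDiff

noncomputable section

open Set Filter Topology

set_option maxSynthPendingDepth 3

namespace IsolatedCluster

/-! ### Locally normally convergent series of holomorphic maps -/

/-- The target space is quantified over inside the induction on `k`, which passes from a series to
the series of its derivatives. -/
theorem contDiffOn_nat_tsum_of_summable_norm {ι E : Type} [NormedAddCommGroup E] [NormedSpace ℂ E]
    (k : ℕ) : ∀ {F : Type} [NormedAddCommGroup F] [NormedSpace ℂ F] [CompleteSpace F]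
    {f : ι → E → F} {u : ι → ℝ} {U : Set E}, Summable u → IsOpen U →
    (∀ i, ContDiffOn ℂ ∞ (f i) U) → (∀ i, ∀ x ∈ U, ‖f i x‖ ≤ u i) →
    ContDiffOn ℂ k (fun x => ∑' i, f i x) U := by
  have key : ∀ {F : Type} [NormedAddCommGroup F] [NormedSpace ℂ F] [CompleteSpace F]
      {f : ι → E → F} {u : ι → ℝ} {U : Set E}, Summable u → IsOpen U →
      (∀ i, ContDiffOn ℂ ∞ (f i) U) → (∀ i, ∀ x ∈ U, ‖f i x‖ ≤ u i) → ∀ x₀ ∈ U, ∃ R > 0,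
      Metric.ball x₀ R ⊆ U ∧
      (∀ i, ∀ x ∈ Metric.ball x₀ R, ‖fderiv ℂ (f i) x‖ ≤ (2 / R) * u i) ∧
      ∀ x ∈ Metric.ball x₀ R,
        HasFDerivAt (fun x => ∑' i, f i x) (∑' i, fderiv ℂ (f i) x) x := by
    intro F _ _ _ f u U hu hU hf hb x₀ hx₀
    obtain ⟨R, hR, hRU⟩ := Metric.isOpen_iff.1 hU x₀ hx₀
    have hbd : ∀ i, ∀ x ∈ Metric.ball x₀ (R / 2),
        ‖fderiv ℂ (f i) x‖ ≤ (2 / (R / 2)) * u i := by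
      intro i x hx
      have hsub : Metric.ball x (R / 2) ⊆ U := fun y hy => hRU <| by
        have := Metric.mem_ball.1 hx
        have h' := Metric.mem_ball.1 hy
        have := dist_triangle y x x₀
        exact Metric.mem_ball.2 (by linarith)
      -- The Cauchy estimate on the ball of radius `R / 2` around `x`.
      have := Complex.norm_fderiv_le_div_of_mapsTo_ball (f := f i) (c := x) (R₁ := R / 2)
        (R₂ := 2 * u i) (((hf i).differentiableOn (by simp)).mono hsub) (fun y hy => by
          rw [mem_closedBall_iff_norm]
          have h1 := hb i y (hsub hy)
          have h2 := hb i x (hsub (Metric.mem_ball_self (by linarith)))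
          linarith [norm_sub_le (f i y) (f i x)]) (by linarith)
      calc _ ≤ _ := this
        _ = _ := by ring
    have hsub : Metric.ball x₀ (R / 2) ⊆ U :=
      (Metric.ball_subset_ball (by linarith)).trans hRU
    refine ⟨R / 2, by linarith, hsub, hbd, fun x hx => ?_⟩
    refine hasFDerivAt_tsum_of_isPreconnected (hu.mul_left (2 / (R / 2))) Metric.isOpen_ball
      (convex_ball x₀ (R / 2)).isPreconnected (fun i y hy => ?_) hbd
      (Metric.mem_ball_self (by linarith))
      (Summable.of_norm_bounded hu fun i => hb i x₀ hx₀) hx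
    exact (((hf i).differentiableOn (by simp)).differentiableAt
      (hU.mem_nhds (hsub hy))).hasFDerivAt
  induction k with
  | zero =>
    intro F _ _ _ f u U hu hU hf hb
    rw [Nat.cast_zero, contDiffOn_zero]
    exact continuousOn_tsum (fun i => (hf i).continuousOn) hu hb
  | succ k ih =>
    intro F _ _ _ f u U hu hU hf hb x₀ hx₀
    obtain ⟨R, hR, hsub, hbd, hder⟩ := key hu hU hf hb x₀ hx₀
    have : ContDiffOn ℂ ((k : ℕ) + 1) (fun x => ∑' i, f i x) (Metric.ball x₀ R) := by
      rw [contDiffOn_succ_iff_fderiv_of_isOpen Metric.isOpen_ball]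
      refine ⟨fun x hx => (hder x hx).differentiableAt.differentiableWithinAt, by simp, ?_⟩
      refine (ih (hu.mul_left (2 / R)) Metric.isOpen_ball (fun i => ?_) hbd).congr
        fun x hx => (hder x hx).fderiv
      exact ((hf i).mono hsub).fderiv_of_isOpen Metric.isOpen_ball (by simp)
    exact ((this.contDiffAt (Metric.isOpen_ball.mem_nhds
      (Metric.mem_ball_self hR))).contDiffWithinAt)

/-- A normally convergent series of holomorphic maps on an open set is smooth. By the Cauchy
estimates the series of derivatives converges normally on smaller balls. -/
theorem contDiffOn_tsum_of_summable_norm {ι E F : Type} [NormedAddCommGroup E] [NormedSpace ℂ E]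
    [NormedAddCommGroup F] [NormedSpace ℂ F] [CompleteSpace F]
    {f : ι → E → F} {u : ι → ℝ} {U : Set E} (hu : Summable u) (hU : IsOpen U)
    (hf : ∀ i, ContDiffOn ℂ ∞ (f i) U) (hb : ∀ i, ∀ x ∈ U, ‖f i x‖ ≤ u i) :
    ContDiffOn ℂ ∞ (fun x => ∑' i, f i x) U :=
  contDiffOn_infty.2 fun k => contDiffOn_nat_tsum_of_summable_norm k hu hU hf hb

/-! ### The theta functions `u ^ (n (n + 1) / 2) v ^ (n (n - 1) / 2)` -/

/-- The exponent `n (n + 1) / 2`, a natural number for every integer `n`. -/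
def triExp (n : ℤ) : ℕ := (n * (n + 1) / 2).toNat

theorem two_mul_triExp (n : ℤ) : 2 * (triExp n : ℤ) = n * (n + 1) := by
  have h1 : 0 ≤ n * (n + 1) := by
    rcases le_or_gt 0 n with h | h
    · positivity
    · nlinarith
  have h2 : 2 ∣ n * (n + 1) := (Int.even_mul_succ_self n).two_dvd
  unfold triExp
  omega

theorem triExp_neg (n : ℤ) : triExp (-n) = triExp (n - 1) := by
  have h1 := two_mul_triExp (-n)
  have h2 := two_mul_triExp (n - 1)
  have : (triExp (-n) : ℤ) = triExp (n - 1) := by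
    linarith [h1, h2, show (-n) * (-n + 1) = (n - 1) * (n - 1 + 1) by ring]
  exact_mod_cast this

theorem triExp_eq (n : ℤ) : (triExp n : ℤ) = triExp (n - 1) + n := by
  have h1 := two_mul_triExp n
  have h2 := two_mul_triExp (n - 1)
  linarith [show n * (n + 1) = (n - 1) * (n - 1 + 1) + 2 * n by ring]

@[simp] theorem triExp_zero : triExp 0 = 0 := rfl
@[simp] theorem triExp_one : triExp 1 = 1 := rfl
@[simp] theorem triExp_neg_one : triExp (-1) = 0 := rfl
@[simp] theorem triExp_neg_two : triExp (-2) = 1 := rfl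

/-- The `n`-th theta monomial `u ^ (n (n + 1) / 2) v ^ (n (n - 1) / 2)`. In the coordinate `w = u`
on `ℂˣ / q ^ ℤ` it is the `n`-th term `q ^ (n (n - 1) / 2) w ^ n` of a theta series. -/
def thetaMonomial (n : ℤ) (x : ℂ × ℂ) : ℂ := x.1 ^ triExp n * x.2 ^ triExp (n - 1)

@[simp] theorem thetaMonomial_zero (x : ℂ × ℂ) : thetaMonomial 0 x = 1 := by
  simp [thetaMonomial]

@[simp] theorem thetaMonomial_one (x : ℂ × ℂ) : thetaMonomial 1 x = x.1 := by
  simp [thetaMonomial]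

@[simp] theorem thetaMonomial_neg_one (x : ℂ × ℂ) : thetaMonomial (-1) x = x.2 := by
  simp [thetaMonomial]

theorem contDiff_thetaMonomial (n : ℤ) {m : WithTop ℕ∞} : ContDiff ℂ m (thetaMonomial n) := by
  unfold thetaMonomial; fun_prop

theorem thetaMonomial_swap (n : ℤ) (x : ℂ × ℂ) :
    thetaMonomial n x.swap = thetaMonomial (-n) x := by
  have h : triExp (-n - 1) = triExp n := by
    have := triExp_neg (n + 1)
    rwa [neg_add', add_sub_cancel_right] at this
  simp only [thetaMonomial, Prod.fst_swap, Prod.snd_swap, triExp_neg, h]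
  ring

theorem thetaMonomial_of_pos (n : ℕ) (x : ℂ × ℂ) :
    thetaMonomial n x = (x.1 * x.2) ^ triExp (n - 1) * x.1 ^ n := by
  have h : triExp n = triExp (n - 1) + n := by
    have := triExp_eq n
    exact_mod_cast this
  simp only [thetaMonomial, h]
  ring

/-- The gluing map of the copies of the local model. -/
def stepMap (x : ℂ × ℂ) : ℂ × ℂ := (x.2⁻¹, x.1 * x.2 ^ 2)

/-- The gluing shifts the theta monomials, up to the common factor `v⁻¹`. -/
theorem thetaMonomial_stepMap (n : ℤ) {x : ℂ × ℂ} (h : x.2 ≠ 0) :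
    thetaMonomial n (stepMap x) = x.2⁻¹ * thetaMonomial (n - 1) x := by
  have h2 := triExp_eq n
  have h3 := triExp_eq (n - 1)
  simp only [thetaMonomial, stepMap, mul_pow, ← pow_mul, inv_pow]
  field_simp
  have e1 : 2 * triExp (n - 1) + 1 = triExp (n - 1 - 1) + triExp n := by omega
  rw [mul_assoc, ← pow_succ, e1, pow_add]
  ring

/-- A neighbourhood of a point of the local model on which the theta series converges normally. -/
def normalNhd (R r : ℝ) : Set (ℂ × ℂ) := {x | ‖x.1‖ < R ∧ ‖x.2‖ < R ∧ ‖x.1 * x.2‖ < r}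

theorem isOpen_normalNhd (R r : ℝ) : IsOpen (normalNhd R r) := by
  refine IsOpen.and (isOpen_lt ?_ ?_) (IsOpen.and (isOpen_lt ?_ ?_) (isOpen_lt ?_ ?_)) <;> fun_prop

theorem exists_mem_normalNhd {x : ℂ × ℂ} (hx : x ∈ modelDom) :
    ∃ R r, 0 < R ∧ 0 < r ∧ r < 1 ∧ x ∈ normalNhd R r := by
  obtain ⟨r, h1, h2⟩ := exists_between (show ‖x.1 * x.2‖ < 1 from hx)
  refine ⟨‖x.1‖ + ‖x.2‖ + 1, r, by positivity, (norm_nonneg _).trans_lt h1, h2, ?_, ?_, h1⟩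
  · linarith [norm_nonneg x.2]
  · linarith [norm_nonneg x.1]

/-- A bound for the theta monomials on `normalNhd R r`. -/
def thetaBound (R r : ℝ) (n : ℤ) : ℝ := r ^ triExp ((n.natAbs : ℤ) - 1) * R ^ n.natAbs

theorem norm_thetaMonomial_le {R r : ℝ} (n : ℤ) {x : ℂ × ℂ} (hx : x ∈ normalNhd R r) :
    ‖thetaMonomial n x‖ ≤ thetaBound R r n := by
  have key : ∀ (n : ℕ) (x : ℂ × ℂ), x ∈ normalNhd R r → ‖thetaMonomial n x‖ ≤ thetaBound R r n := by
    intro n x hx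
    rw [thetaMonomial_of_pos, norm_mul, norm_pow, norm_pow]
    unfold thetaBound
    rw [Int.natAbs_natCast]
    gcongr
    · exact pow_nonneg ((norm_nonneg _).trans hx.2.2.le) _
    · exact hx.2.2.le
    · exact hx.1.le
  rcases Int.natAbs_eq n with h | h
  · have := key n.natAbs x hx
    rwa [← h] at this
  · have := key n.natAbs x.swap ⟨hx.2.1, hx.1, by simpa [mul_comm] using hx.2.2⟩
    rw [thetaMonomial_swap, ← h] at this
    simpa only [thetaBound, Int.natAbs_natCast] using this

theorem summable_thetaBound {R r : ℝ} (hR : 0 < R) (hr : 0 < r) (hr1 : r < 1) :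
    Summable (thetaBound R r) := by
  have h : Summable fun n : ℕ => r ^ triExp ((n : ℤ) - 1) * R ^ n := by
    refine summable_of_ratio_test_tendsto_lt_one (l := 0) one_pos
      (Eventually.of_forall fun n => (by positivity)) ?_
    have h1 : Tendsto (fun n : ℕ => r ^ n * R) atTop (𝓝 0) := by
      simpa using (tendsto_pow_atTop_nhds_zero_of_lt_one hr.le hr1).mul_const R
    refine h1.congr fun n => ?_
    have h2 : triExp (((n + 1 : ℕ) : ℤ) - 1) = triExp ((n : ℤ) - 1) + n := by
      have := triExp_eq n
      push_cast
      rw [add_sub_cancel_right]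
      omega
    rw [h2, Real.norm_of_nonneg (by positivity), Real.norm_of_nonneg (by positivity)]
    field_simp
    ring
  refine Summable.of_nat_of_neg ?_ ?_ <;> simpa [thetaBound] using! h

/-! ### The theta map into the Hilbert space `ℓ²(ℤ)` -/

/-- The Hilbert space `ℓ²(ℤ)`. -/
abbrev EllTwo : Type := lp (fun _ : ℤ => ℂ) 2

/-- The map with coordinates the theta monomials. -/
def thetaMap (x : ℂ × ℂ) : EllTwo := ∑' n : ℤ, lp.single 2 n (thetaMonomial n x)

theorem norm_single_thetaMonomial_le {R r : ℝ} (n : ℤ) {x : ℂ × ℂ} (hx : x ∈ normalNhd R r) :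
    ‖(lp.single 2 n (thetaMonomial n x) : EllTwo)‖ ≤ thetaBound R r n := by
  rw [lp.norm_single (by simp)]
  exact norm_thetaMonomial_le n hx

theorem contDiffOn_thetaMap : ContDiffOn ℂ ∞ thetaMap modelDom := by
  intro x hx
  obtain ⟨R, r, hR, hr, hr1, hxn⟩ := exists_mem_normalNhd hx
  have : ContDiffOn ℂ ∞ thetaMap (normalNhd R r) :=
    contDiffOn_tsum_of_summable_norm (summable_thetaBound hR hr hr1)
      (isOpen_normalNhd R r)
      (fun n => ((lp.singleContinuousLinearMap ℂ (fun _ : ℤ => ℂ) 2 n).contDiff.comp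
        (contDiff_thetaMonomial n)).contDiffOn)
      (fun n x hx => norm_single_thetaMonomial_le n hx)
  exact (this.contDiffAt ((isOpen_normalNhd R r).mem_nhds hxn)).contDiffWithinAt

theorem thetaMap_apply {x : ℂ × ℂ} (hx : x ∈ modelDom) (n : ℤ) :
    thetaMap x n = thetaMonomial n x := by
  obtain ⟨R, r, hR, hr, hr1, hxn⟩ := exists_mem_normalNhd hx
  have hs : Summable fun n : ℤ => (lp.single 2 n (thetaMonomial n x) : EllTwo) :=
    Summable.of_norm_bounded (summable_thetaBound hR hr hr1)
      fun n => norm_single_thetaMonomial_le n hxn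
  have h := (lp.evalCLM ℂ (fun _ : ℤ => ℂ) 2 n).map_tsum hs
  change lp.evalCLM ℂ (fun _ : ℤ => ℂ) 2 n (thetaMap x) = _
  rw [thetaMap, h, tsum_eq_single n]
  · simp [lp.evalCLM]
  · intro m hm
    simp [lp.evalCLM, hm.symm]

theorem two_le_infty : (2 : WithTop ℕ∞) ≤ ∞ := WithTop.coe_le_coe.2 le_top

/-! ### The form `i ∂∂̄ φ` of a real function -/

section Levi

variable {V W : Type*} [NormedAddCommGroup V] [NormedSpace ℂ V]
  [NormedAddCommGroup W] [NormedSpace ℂ W]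

/-- Multiplication by `i`, as a real linear map. -/
def mulI (V : Type*) [NormedAddCommGroup V] [NormedSpace ℂ V] : V →L[ℝ] V :=
  (Complex.I • ContinuousLinearMap.id ℂ V).restrictScalars ℝ

/-- The linear map sending a bilinear form `B` to `(v, w) ↦ B w (i v) - B v (i w)`. -/
def leviOp (V : Type*) [NormedAddCommGroup V] [NormedSpace ℂ V] :
    (V →L[ℝ] V →L[ℝ] ℝ) →L[ℝ] (V →L[ℝ] V →L[ℝ] ℝ) :=
  ((ContinuousLinearMap.flipₗᵢ ℝ V V ℝ).toContinuousLinearEquiv.toContinuousLinearMap -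
    ContinuousLinearMap.id ℝ _).comp
    (ContinuousLinearMap.compL ℝ V (V →L[ℝ] ℝ) (V →L[ℝ] ℝ)
      ((ContinuousLinearMap.compL ℝ V V ℝ).flip (mulI V)))

theorem leviOp_apply (B : V →L[ℝ] V →L[ℝ] ℝ) (v w : V) :
    leviOp V B v w = B w (Complex.I • v) - B v (Complex.I • w) := rfl

/-- The real `(1, 1)`-form `d dᶜ φ` (a positive multiple of `i ∂∂̄ φ`) of a function `φ`,
computed from the second derivative of `φ`. -/
def leviForm (φ : V → ℝ) (x : V) : V →L[ℝ] V →L[ℝ] ℝ :=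
  leviOp V (fderiv ℝ (fderiv ℝ φ) x)

theorem leviForm_apply (φ : V → ℝ) (x v w : V) :
    leviForm φ x v w =
      fderiv ℝ (fderiv ℝ φ) x w (Complex.I • v) - fderiv ℝ (fderiv ℝ φ) x v (Complex.I • w) := rfl

theorem leviForm_congr {φ φ' : V → ℝ} {x : V} (h : φ =ᶠ[𝓝 x] φ') :
    leviForm φ x = leviForm φ' x := by
  unfold leviForm
  rw [Filter.EventuallyEq.fderiv_eq h.fderiv]

theorem leviForm_add {φ φ' : V → ℝ} {x : V} (h : ContDiffAt ℝ 2 φ x) (h' : ContDiffAt ℝ 2 φ' x) :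
    leviForm (φ + φ') x = leviForm φ x + leviForm φ' x := by
  have e : fderiv ℝ (φ + φ') =ᶠ[𝓝 x] fderiv ℝ φ + fderiv ℝ φ' := by
    filter_upwards [h.eventually (by simp), h'.eventually (by simp)] with y hy hy'
    exact fderiv_add (hy.differentiableAt (by simp)) (hy'.differentiableAt (by simp))
  unfold leviForm
  rw [e.fderiv_eq, fderiv_add, map_add]
  · exact (h.fderiv_right (m := 1) (by norm_num)).differentiableAt (by simp)
  · exact (h'.fderiv_right (m := 1) (by norm_num)).differentiableAt (by simp)

theorem leviForm_self (φ : V → ℝ) (x v : V) : leviForm φ x v v = 0 := by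
  simp [leviForm_apply]

theorem fderiv_fderiv_symm {F : Type*} [NormedAddCommGroup F] [NormedSpace ℝ F]
    {φ : V → F} {x : V} (h : ContDiffAt ℝ 2 φ x) (v w : V) :
    fderiv ℝ (fderiv ℝ φ) x v w = fderiv ℝ (fderiv ℝ φ) x w v :=
  (h.isSymmSndFDerivAt (by simp)) v w

theorem leviForm_I_smul {φ : V → ℝ} {x : V} (h : ContDiffAt ℝ 2 φ x) (v w : V) :
    leviForm φ x (Complex.I • v) (Complex.I • w) = leviForm φ x v w := by
  have h1 := fderiv_fderiv_symm h (Complex.I • v) w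
  have h2 := fderiv_fderiv_symm h (Complex.I • w) v
  simp only [leviForm_apply, smul_smul, Complex.I_mul_I, neg_smul, one_smul, map_neg]
  rw [h1, h2]
  ring

theorem contDiffAt_leviForm {φ : V → ℝ} {x : V} (h : ContDiffAt ℝ ∞ φ x) :
    ContDiffAt ℝ ∞ (leviForm φ) x :=
  ContDiffAt.comp (g := leviOp V) x (leviOp V).contDiff.contDiffAt
    ((h.fderiv_right (m := ∞) (by simp)).fderiv_right (m := ∞) (by simp))

theorem leviForm_closed {φ : V → ℝ} {x : V} (h : ContDiffAt ℝ ∞ φ x) (u v w : V) :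
    fderiv ℝ (leviForm φ) x u v w + fderiv ℝ (leviForm φ) x v w u +
      fderiv ℝ (leviForm φ) x w u v = 0 := by
  have h1 : ContDiffAt ℝ ∞ (fderiv ℝ φ) x := h.fderiv_right (m := ∞) (by simp)
  have h2 : ContDiffAt ℝ ∞ (fderiv ℝ (fderiv ℝ φ)) x := h1.fderiv_right (m := ∞) (by simp)
  have e : fderiv ℝ (leviForm φ) x =
      (leviOp V).comp (fderiv ℝ (fderiv ℝ (fderiv ℝ φ)) x) :=
    (((leviOp V).hasFDerivAt).comp x (h2.differentiableAt (by simp)).hasFDerivAt).fderiv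
  have s := fderiv_fderiv_symm (φ := fderiv ℝ φ) (h1.of_le two_le_infty)
  rw [e]
  simp only [ContinuousLinearMap.comp_apply, leviOp_apply]
  rw [s u v, s v w, s w u]
  ring

theorem fderiv_real_I_smul {ψ : V → W} {x : V} (h : DifferentiableAt ℂ ψ x) (w : V) :
    fderiv ℝ ψ x (Complex.I • w) = Complex.I • fderiv ℝ ψ x w := by
  rw [h.fderiv_restrictScalars ℝ]
  simp

theorem fderiv_real_apply {ψ : V → W} {x : V} (h : DifferentiableAt ℂ ψ x) (v : V) :
    fderiv ℝ ψ x v = fderiv ℂ ψ x v := by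
  rw [h.fderiv_restrictScalars ℝ]
  rfl

theorem fderiv_fderiv_real_I_smul {ψ : V → W} {x : V} (h : ContDiffAt ℂ 2 ψ x) (v w : V) :
    fderiv ℝ (fderiv ℝ ψ) x v (Complex.I • w) = Complex.I • fderiv ℝ (fderiv ℝ ψ) x v w := by
  have h1 : DifferentiableAt ℝ (fderiv ℝ ψ) x :=
    ((h.restrict_scalars ℝ).fderiv_right (m := 1) (by norm_num)).differentiableAt (by simp)
  have a1 : HasFDerivAt (fun y => fderiv ℝ ψ y (Complex.I • w)) _ x :=
    h1.hasFDerivAt.clm_apply (hasFDerivAt_const (Complex.I • w) x)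
  have a2 : HasFDerivAt (fun y => fderiv ℝ ψ y w) _ x :=
    h1.hasFDerivAt.clm_apply (hasFDerivAt_const w x)
  have a3 := ((mulI W).hasFDerivAt (x := fderiv ℝ ψ x w)).comp x a2
  have e : (fun y => fderiv ℝ ψ y (Complex.I • w)) =ᶠ[𝓝 x]
      mulI W ∘ fun y => fderiv ℝ ψ y w := by
    filter_upwards [h.eventually (by simp)] with y hy
    exact fderiv_real_I_smul (hy.differentiableAt (by simp)) w
  have := congrArg (fun L => L v) (a1.unique (a3.congr_of_eventuallyEq e))
  simpa using! this

/-- The form `d dᶜ φ` is natural under holomorphic maps. -/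
theorem leviForm_comp {φ : W → ℝ} {ψ : V → W} {x : V} (hφ : ContDiffAt ℝ 2 φ (ψ x))
    (hψ : ContDiffAt ℂ 2 ψ x) (v w : V) :
    leviForm (φ ∘ ψ) x v w = leviForm φ (ψ x) (fderiv ℝ ψ x v) (fderiv ℝ ψ x w) := by
  have hψ' := hψ.restrict_scalars ℝ
  have e : fderiv ℝ (φ ∘ ψ) =ᶠ[𝓝 x] fun y => (fderiv ℝ φ (ψ y)).comp (fderiv ℝ ψ y) := by
    filter_upwards [hψ'.eventually (by simp),
      hψ'.continuousAt.eventually (hφ.eventually (by simp))] with y hy hy'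
    exact fderiv_comp y (hy'.differentiableAt (by simp)) (hy.differentiableAt (by simp))
  have h1 : DifferentiableAt ℝ (fderiv ℝ φ) (ψ x) :=
    (hφ.fderiv_right (m := 1) (by norm_num)).differentiableAt (by simp)
  have h2 : DifferentiableAt ℝ (fderiv ℝ ψ) x :=
    (hψ'.fderiv_right (m := 1) (by norm_num)).differentiableAt (by simp)
  have h3 := (h1.hasFDerivAt.comp x
    (hψ'.differentiableAt (by simp)).hasFDerivAt).clm_comp h2.hasFDerivAt
  have key : ∀ v w, fderiv ℝ (fderiv ℝ (φ ∘ ψ)) x v w =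
      fderiv ℝ φ (ψ x) (fderiv ℝ (fderiv ℝ ψ) x v w) +
        fderiv ℝ (fderiv ℝ φ) (ψ x) (fderiv ℝ ψ x v) (fderiv ℝ ψ x w) := by
    intro v w
    rw [e.fderiv_eq]
    have := congrArg (fun L => L v w) h3.fderiv
    simpa using! this
  have hd := hψ.differentiableAt (by simp)
  simp only [leviForm_apply, key, fderiv_fderiv_real_I_smul hψ, fderiv_real_I_smul hd]
  rw [fderiv_fderiv_symm hψ' v w]
  ring

end Levi

/-! ### The Fubini–Study potential `log ‖h‖²` -/

section FubiniStudy

variable {H : Type*} [NormedAddCommGroup H] [InnerProductSpace ℂ H]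

/-- The Fubini–Study potential on a complex inner product space. -/
def logNormSq (h : H) : ℝ := Real.log (‖h‖ ^ 2)

theorem contDiffAt_logNormSq {h : H} (hh : h ≠ 0) {m : WithTop ℕ∞} :
    ContDiffAt ℝ m (logNormSq (H := H)) h := by
  refine ContDiffAt.log (contDiff_norm_sq ℂ).contDiffAt ?_
  positivity

theorem logNormSq_smul {c : ℂ} (hc : c ≠ 0) {h : H} (hh : h ≠ 0) :
    logNormSq (c • h) = logNormSq c + logNormSq h := by
  unfold logNormSq
  rw [norm_smul, mul_pow, Real.log_mul (by positivity) (by positivity)]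

theorem leviForm_logNormSq {h : H} (hh : h ≠ 0) (ξ η : H) :
    leviForm logNormSq h ξ η = 4 / (‖h‖ ^ 2) ^ 2 *
      (‖h‖ ^ 2 * (inner ℂ ξ η).im - (inner ℂ ξ h * inner ℂ h η).im) := by
  let _ : InnerProductSpace ℝ H := InnerProductSpace.complexToReal
  have hN : ∀ {h : H}, h ≠ 0 → ‖h‖ ^ 2 ≠ 0 := fun hh => by positivity
  have d0 : ∀ h : H, HasFDerivAt (fun h : H => ‖h‖ ^ 2) (2 • innerSL ℝ h) h :=
    fun h => (hasStrictFDerivAt_norm_sq h).hasFDerivAt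
  have d1 : ∀ h : H, h ≠ 0 → fderiv ℝ (logNormSq (H := H)) h =
      (‖h‖ ^ 2)⁻¹ • (2 • innerSL ℝ h) := fun h hh => ((d0 h).log (hN hh)).fderiv
  have d2 : ∀ v w, fderiv ℝ (fderiv ℝ (logNormSq (H := H))) h v w =
      2 * inner ℝ v w / ‖h‖ ^ 2 - 4 * inner ℝ h v * inner ℝ h w / (‖h‖ ^ 2) ^ 2 := by
    intro v w
    have e : fderiv ℝ (logNormSq (H := H)) =ᶠ[𝓝 h]
        fun h => (‖h‖ ^ 2)⁻¹ • (2 • innerSL ℝ h) := by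
      filter_upwards [isOpen_ne.mem_nhds hh] with y hy using d1 y hy
    have i1 : HasFDerivAt (fun h : H => (‖h‖ ^ 2)⁻¹) _ h :=
      (hasDerivAt_inv (hN hh)).comp_hasFDerivAt h (d0 h)
    have i2 : HasFDerivAt (fun h : H => (2 : ℕ) • innerSL ℝ h) ((2 : ℕ) • innerSL ℝ) h :=
      ((innerSL ℝ (E := H)).hasFDerivAt).const_smul (2 : ℕ)
    have i3 := (i1.smul i2).fderiv
    have i4 := congrArg (fun L => L v w) i3
    rw [e.fderiv_eq]
    refine i4.trans ?_
    have e2 : innerSL ℝ v w = inner ℝ v w := rfl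
    simp [e2]
    field_simp
    ring
  rw [leviForm_apply, d2, d2]
  simp only [real_inner_eq_re_inner ℂ, inner_smul_right]
  have s1 : (inner ℂ η ξ).im = -(inner ℂ ξ η).im := by rw [← inner_conj_symm, Complex.conj_im]
  have s2 : (inner ℂ ξ h).im = -(inner ℂ h ξ).im := by rw [← inner_conj_symm, Complex.conj_im]
  have s3 : (inner ℂ ξ h).re = (inner ℂ h ξ).re := by rw [← inner_conj_symm, Complex.conj_re]
  have := hN hh
  simp [s1, s2, s3]
  field_simp
  ring

/-- The function `log |c|²` is pluriharmonic. -/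
theorem leviForm_logNormSq_complex {c : ℂ} (hc : c ≠ 0) : leviForm logNormSq c = 0 := by
  ext ξ η
  rw [leviForm_logNormSq hc]
  have : (inner ℂ ξ c * inner ℂ c η).im = ‖c‖ ^ 2 * (inner ℂ ξ η).im := by
    rw [← Complex.normSq_eq_norm_sq, Complex.normSq_apply]
    simp
    ring
  rw [this]
  simp

/-- The strict Cauchy–Schwarz inequality: the Fubini–Study form is positive off the radial
direction. -/
theorem leviForm_logNormSq_pos {h : H} (hh : h ≠ 0) {ξ : H} (hξ : ∀ c : ℂ, ξ ≠ c • h) :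
    0 < leviForm logNormSq h ξ (Complex.I • ξ) := by
  rw [leviForm_logNormSq hh]
  have hN : 0 < ‖h‖ ^ 2 := by positivity
  have h1 : (inner ℂ ξ (Complex.I • ξ)).im = ‖ξ‖ ^ 2 := by
    rw [inner_smul_right, inner_self_eq_norm_sq_to_K]
    simp [← Complex.ofReal_pow]
  have h2 : (inner ℂ ξ h * inner ℂ h (Complex.I • ξ)).im = ‖(inner ℂ h ξ : ℂ)‖ ^ 2 := by
    rw [inner_smul_right, ← inner_conj_symm ξ h, mul_left_comm, mul_comm _ (inner ℂ h ξ),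
      Complex.mul_conj]
    simp [Complex.normSq_eq_norm_sq]
    norm_cast
  rw [h1, h2]
  have h3 : ‖(inner ℂ h ξ : ℂ)‖ < ‖h‖ * ‖ξ‖ := by
    refine lt_of_le_of_ne (norm_inner_le_norm h ξ) fun h4 => ?_
    have h5 : h = 0 ∨ ∃ r : ℂ, ξ = r • h := ((norm_inner_eq_norm_tfae ℂ h ξ).out 0 2).1 h4
    obtain ⟨r, hr⟩ := h5.resolve_left hh
    exact hξ r hr
  have h4 : ‖(inner ℂ h ξ : ℂ)‖ ^ 2 < (‖h‖ * ‖ξ‖) ^ 2 := by gcongr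
  have : 0 < ‖h‖ ^ 2 * ‖ξ‖ ^ 2 - ‖(inner ℂ h ξ : ℂ)‖ ^ 2 := by nlinarith
  positivity

end FubiniStudy

/-! ### Maps out of a manifold presented by parametrisations -/

namespace EtaleAtlas

variable {ι E X : Type*} [NormedAddCommGroup E] [NormedSpace ℂ E] [TopologicalSpace X]
  (A : EtaleAtlas ι E X)

theorem exists_param_eq {e : OpenPartialHomeomorph X E} (he : e ∈ A.charts) :
    ∃ i, e.target ⊆ A.dom ∧ ∀ x, e.symm x = A.param i x := by
  obtain ⟨i, W, hW, hd, hi, rfl⟩ := he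
  exact ⟨i, hd, fun x => rfl⟩

theorem exists_chart_param (i : ι) {x : E} (hx : x ∈ A.dom) :
    ∃ e ∈ A.charts, x ∈ e.target ∧ ∀ x, e.symm x = A.param i x := by
  obtain ⟨W, hW, hxW, hd, hi⟩ := A.locally_injective i x hx
  exact ⟨_, ⟨i, W, hW, hd, hi, rfl⟩, hxW, fun x => rfl⟩

/-- A local lift of a map through a parametrisation is its expression in the charts. -/
theorem chart_comp_eventuallyEq {Z : Type*} [TopologicalSpace Z]
    {e : OpenPartialHomeomorph X E} {j : ι} (hej : ∀ x, e.symm x = A.param j x)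
    {g : Z → X} {ψ : Z → E} {x : Z} (hψ : ContinuousAt ψ x) (hx : ψ x ∈ e.target)
    (h : ∀ᶠ x' in 𝓝 x, A.param j (ψ x') = g x') : e ∘ g =ᶠ[𝓝 x] ψ := by
  filter_upwards [h, hψ.eventually_mem (e.open_target.mem_nhds hx)] with x' h1 h2
  rw [Function.comp_apply, ← h1, ← hej, e.right_inv h2]

variable {𝕜 : Type*} [NontriviallyNormedField 𝕜] [NormedSpace 𝕜 E] {n : WithTop ℕ∞}

theorem contMDiffAt_param : letI := A.chartedSpace; ∀ [IsManifold 𝓘(𝕜, E) n X] (i : ι) {x : E},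
    x ∈ A.dom → ContMDiffAt 𝓘(𝕜, E) 𝓘(𝕜, E) n (A.param i) x := by
  let _ := A.chartedSpace
  intro _ i x hx
  obtain ⟨e, he, hxe, h⟩ := A.exists_chart_param i hx
  have h1 := contMDiffOn_symm_of_mem_maximalAtlas (I := 𝓘(𝕜, E)) (n := n)
    (IsManifold.subset_maximalAtlas he)
  exact (h1.congr fun y _ => (h y).symm).contMDiffAt (e.open_target.mem_nhds hxe)

/-- A map is smooth near `param i x` if its composition with `param i` is smooth near `x`. -/
theorem contMDiffAt_of_param {E' H' M' : Type*} [NormedAddCommGroup E'] [NormedSpace 𝕜 E']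
    [TopologicalSpace H'] {I' : ModelWithCorners 𝕜 E' H'} [TopologicalSpace M']
    [ChartedSpace H' M'] : letI := A.chartedSpace; ∀ [IsManifold 𝓘(𝕜, E) n X] {f : X → M'}
    {i : ι} {x : E}, x ∈ A.dom → ContMDiffAt 𝓘(𝕜, E) I' n (f ∘ A.param i) x →
      ContMDiffAt 𝓘(𝕜, E) I' n f (A.param i x) := by
  let _ := A.chartedSpace
  intro _ f i x hx hf
  obtain ⟨e, he, hxe, h⟩ := A.exists_chart_param i hx
  have hy : A.param i x ∈ e.source := h x ▸ e.map_target hxe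
  have h1 := contMDiffOn_of_mem_maximalAtlas (I := 𝓘(𝕜, E)) (n := n)
    (IsManifold.subset_maximalAtlas he)
  have h2 := h1.contMDiffAt (e.open_source.mem_nhds hy)
  have h3 : e (A.param i x) = x := by rw [← h, e.right_inv hxe]
  rw [← h3] at hf
  refine (hf.comp (A.param i x) h2).congr_of_eventuallyEq ?_
  filter_upwards [e.open_source.mem_nhds hy] with z hz
  simp only [Function.comp_apply, ← h, e.left_inv hz]

end EtaleAtlas

/-! ### The Kähler potential of the theta map -/

theorem hasSum_norm_sq_thetaMonomial {x : ℂ × ℂ} (hx : x ∈ modelDom) :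
    HasSum (fun n => ‖thetaMonomial n x‖ ^ 2) (‖thetaMap x‖ ^ 2) := by
  have h := lp.hasSum_norm (p := 2) (by simp) (thetaMap x)
  simpa [thetaMap_apply hx] using! h

theorem thetaMap_ne_zero {x : ℂ × ℂ} (hx : x ∈ modelDom) : thetaMap x ≠ 0 := by
  intro h
  have h1 := thetaMap_apply hx 0
  rw [h] at h1
  simp at h1

theorem one_le_norm_sq_thetaMap {x : ℂ × ℂ} (hx : x ∈ modelDom) : 1 ≤ ‖thetaMap x‖ ^ 2 := by
  have h := le_hasSum (hasSum_norm_sq_thetaMonomial hx) 0 fun n _ => by positivity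
  simpa using h

theorem contDiffAt_thetaMap {x : ℂ × ℂ} (hx : x ∈ modelDom) : ContDiffAt ℂ ∞ thetaMap x :=
  contDiffOn_thetaMap.contDiffAt (isOpen_modelDom.mem_nhds hx)

theorem stepMap_mem {x : ℂ × ℂ} (hx : x ∈ modelDom) (h : x.2 ≠ 0) : stepMap x ∈ modelDom :=
  TateFibration.mem_of_step hx h

theorem norm_thetaMap_stepMap {x : ℂ × ℂ} (hx : x ∈ modelDom) (h : x.2 ≠ 0) :
    ‖thetaMap (stepMap x)‖ = ‖x.2⁻¹‖ * ‖thetaMap x‖ := by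
  have h1 := hasSum_norm_sq_thetaMonomial (stepMap_mem hx h)
  have h2 := ((Equiv.subRight (1 : ℤ)).hasSum_iff.2 (hasSum_norm_sq_thetaMonomial hx)).mul_left
    (‖x.2⁻¹‖ ^ 2)
  have h3 : ‖thetaMap (stepMap x)‖ ^ 2 = ‖x.2⁻¹‖ ^ 2 * ‖thetaMap x‖ ^ 2 := by
    refine h1.unique (h2.congr_fun ?_)
    intro n
    simp only [Function.comp_apply, Equiv.subRight_apply]
    rw [thetaMonomial_stepMap n h, norm_mul, mul_pow]
  rw [← mul_pow] at h3
  exact (pow_left_inj₀ (norm_nonneg _) (by positivity) two_ne_zero).1 h3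

/-- The Kähler potential `log ∑ₙ |u ^ (n (n + 1) / 2) v ^ (n (n - 1) / 2)|²` of the local model. -/
def kahlerPotential (x : ℂ × ℂ) : ℝ := logNormSq (thetaMap x)

theorem contDiffAt_kahlerPotential {x : ℂ × ℂ} (hx : x ∈ modelDom) :
    ContDiffAt ℝ ∞ kahlerPotential x :=
  (contDiffAt_logNormSq (thetaMap_ne_zero hx)).comp x ((contDiffAt_thetaMap hx).restrict_scalars ℝ)

/-- The pullback of the Fubini–Study form by the theta map. -/
def modelForm (x : ℂ × ℂ) : (ℂ × ℂ) →L[ℝ] (ℂ × ℂ) →L[ℝ] ℝ := leviForm kahlerPotential x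

theorem fderiv_thetaMap_apply {x : ℂ × ℂ} (hx : x ∈ modelDom) (v : ℂ × ℂ) (n : ℤ) :
    fderiv ℂ thetaMap x v n = fderiv ℂ (thetaMonomial n) x v := by
  have h1 := ((lp.evalCLM ℂ (fun _ : ℤ => ℂ) 2 n).hasFDerivAt (x := thetaMap x)).comp x
    ((contDiffAt_thetaMap hx).differentiableAt (by simp)).hasFDerivAt
  have h2 : HasFDerivAt (thetaMonomial n)
      ((lp.evalCLM ℂ (fun _ : ℤ => ℂ) 2 n).comp (fderiv ℂ thetaMap x)) x := by
    refine h1.congr_of_eventuallyEq ?_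
    filter_upwards [isOpen_modelDom.mem_nhds hx] with y hy
    exact (thetaMap_apply hy n).symm
  rw [h2.fderiv]
  rfl

/-- A kernel vector of the pullback is sent by the derivative of the theta map to a multiple of the
theta map itself. The coordinate `f₀ = 1` shows that the multiple is zero, and then the coordinates
`f₁ = u` and `f₋₁ = v` show that the vector is zero. -/
theorem modelForm_pos {x : ℂ × ℂ} (hx : x ∈ modelDom) {v : ℂ × ℂ} (hv : v ≠ 0) :
    0 < modelForm x v (Complex.I • v) := by
  have hd := (contDiffAt_thetaMap hx).differentiableAt (by simp)
  unfold modelForm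
  change 0 < leviForm (logNormSq ∘ thetaMap) x v (Complex.I • v)
  rw [leviForm_comp (contDiffAt_logNormSq (thetaMap_ne_zero hx))
    ((contDiffAt_thetaMap hx).of_le two_le_infty), fderiv_real_I_smul hd,
    fderiv_real_apply hd]
  refine leviForm_logNormSq_pos (thetaMap_ne_zero hx) fun c hc => hv ?_
  have key : ∀ n : ℤ, fderiv ℂ (thetaMonomial n) x v = c * thetaMonomial n x := by
    intro n
    rw [← fderiv_thetaMap_apply hx, ← thetaMap_apply hx]
    exact congrArg (fun f : EllTwo => f n) hc
  have e0 : thetaMonomial 0 = fun _ => 1 := funext thetaMonomial_zero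
  have e1 : thetaMonomial 1 = Prod.fst := funext thetaMonomial_one
  have e2 : thetaMonomial (-1) = Prod.snd := funext thetaMonomial_neg_one
  have h0 := key 0
  have h1 := key 1
  have h2 := key (-1)
  rw [e0] at h0
  rw [e1, fderiv_fst] at h1
  rw [e2, fderiv_snd] at h2
  simp only [fderiv_fun_const, Pi.zero_apply, zero_apply, mul_one] at h0
  rw [← h0, zero_mul] at h1 h2
  exact Prod.ext h1 h2

/-- The gluing changes the potential by the pluriharmonic function `log |v⁻¹|²`. -/
theorem modelForm_stepMap {x : ℂ × ℂ} (hx : x ∈ modelDom) (h : x.2 ≠ 0) (v w : ℂ × ℂ) :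
    modelForm (stepMap x) (fderiv ℝ stepMap x v) (fderiv ℝ stepMap x w) = modelForm x v w := by
  have hs : ContDiffAt ℂ 2 stepMap x :=
    (contDiffAt_snd.inv h).prodMk (contDiffAt_fst.mul (contDiffAt_snd.pow 2))
  have hi : ContDiffAt ℂ 2 (fun y : ℂ × ℂ => y.2⁻¹) x := contDiffAt_snd.inv h
  have hl : ContDiffAt ℝ 2 (logNormSq (H := ℂ)) x.2⁻¹ := contDiffAt_logNormSq (inv_ne_zero h)
  have e : kahlerPotential ∘ stepMap =ᶠ[𝓝 x]
      (logNormSq ∘ fun y : ℂ × ℂ => y.2⁻¹) + kahlerPotential := by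
    filter_upwards [isOpen_modelDom.mem_nhds hx, continuousAt_snd.eventually_ne h] with y hy h2
    have h3 : kahlerPotential (stepMap y) = logNormSq (y.2⁻¹ • thetaMap y) := by
      unfold kahlerPotential logNormSq
      rw [norm_thetaMap_stepMap hy h2, norm_smul]
    rw [Function.comp_apply, h3, logNormSq_smul (inv_ne_zero h2) (thetaMap_ne_zero hy)]
    rfl
  unfold modelForm
  rw [← leviForm_comp ((contDiffAt_kahlerPotential (stepMap_mem hx h)).of_le two_le_infty) hs,
    leviForm_congr e, leviForm_add (hl.comp x (hi.restrict_scalars ℝ))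
    ((contDiffAt_kahlerPotential hx).of_le two_le_infty), add_apply, add_apply,
    leviForm_comp (ψ := fun y : ℂ × ℂ => y.2⁻¹) hl hi,
    leviForm_logNormSq_complex (inv_ne_zero h)]
  simp

/-! ### The Kähler form on `Y_d` -/

namespace TateFibration

variable {d : ℕ}

/-- Near `a` there is a holomorphic map to the copy containing `b`, compatible with the gluing
and preserving the form `modelForm`. -/
def FormTransport (a b : Σ _ : ZMod d, modelDom) : Prop :=
  ∃ φ : ℂ × ℂ → ℂ × ℂ, ContDiffAt ℂ ω φ a.2.1 ∧ φ a.2.1 = b.2.1 ∧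
    (∀ᶠ x in 𝓝 a.2.1, param b.1 (φ x) = param a.1 x) ∧
    ∀ v w, modelForm b.2.1 (fderiv ℝ φ a.2.1 v) (fderiv ℝ φ a.2.1 w) = modelForm a.2.1 v w

theorem FormTransport.refl (a : Σ _ : ZMod d, modelDom) : FormTransport a a :=
  ⟨id, contDiffAt_id, rfl, Eventually.of_forall fun _ => rfl, by simp⟩

theorem FormTransport.trans {a b c : Σ _ : ZMod d, modelDom} (h : FormTransport a b)
    (h' : FormTransport b c) : FormTransport a c := by
  obtain ⟨φ, h1, h2, h3, h4⟩ := h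
  obtain ⟨ψ, k1, k2, k3, k4⟩ := h'
  rw [← h2] at k1 k3
  refine ⟨ψ ∘ φ, k1.comp _ h1, by simp [h2, k2], ?_, fun v w => ?_⟩
  · filter_upwards [h3, h1.continuousAt.eventually k3] with x hx hx'
    exact hx'.trans hx
  · rw [fderiv_comp _ ((k1.restrict_scalars ℝ).differentiableAt (by simp))
      ((h1.restrict_scalars ℝ).differentiableAt (by simp)), h2]
    exact (k4 _ _).trans (h4 v w)

theorem FormTransport.of_step {a b : Σ _ : ZMod d, modelDom} (h : TateStep d a b) :
    FormTransport a b ∧ FormTransport b a := by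
  obtain ⟨i, ⟨x, hx⟩⟩ := a
  obtain ⟨j, ⟨y, hy⟩⟩ := b
  obtain ⟨h1, h2, h3⟩ := h
  simp only at h1 h2 h3
  subst h1
  have hy1 : y.1 ≠ 0 := by rw [h3]; exact inv_ne_zero h2
  have hs : ContDiffAt ℂ ω stepMap x :=
    (contDiffAt_snd.inv h2).prodMk (contDiffAt_fst.mul (contDiffAt_snd.pow 2))
  constructor
  · refine ⟨stepMap, hs, h3.symm, ?_, fun v w => ?_⟩
    · filter_upwards [isOpen_modelDom.mem_nhds hx, continuousAt_snd.eventually_ne h2] with z hz hz2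
      exact param_step _ hz hz2
    · rw [← modelForm_stepMap hx h2]
      simp only [h3]
      rfl
  · let r : ℂ × ℂ → ℂ × ℂ := fun x => (x.1 ^ 2 * x.2, x.1⁻¹)
    have hr : ContDiffAt ℂ ω r y :=
      ((contDiffAt_fst.pow 2).mul contDiffAt_snd).prodMk (contDiffAt_fst.inv hy1)
    have hrx : r y = x := by
      simp only [r, h3]
      ext
      · simp
        field_simp
      · simp
    have hsr : ∀ z : ℂ × ℂ, z.1 ≠ 0 → stepMap (r z) = z := by
      intro z hz
      ext
      · simp [stepMap, r]
      · simp [stepMap, r]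
        field_simp
    have hev : stepMap ∘ r =ᶠ[𝓝 y] id := by
      filter_upwards [continuousAt_fst.eventually_ne hy1] with z hz using hsr z hz
    refine ⟨r, hr, hrx, ?_, fun v w => ?_⟩
    · filter_upwards [isOpen_modelDom.mem_nhds hy,
        continuousAt_fst.eventually_ne hy1] with z hz hz1
      have := param_step i (mem_of_step_symm hz hz1) (inv_ne_zero hz1)
      refine this.symm.trans (congrArg _ ?_)
      exact hsr z hz1
    · have e := hev.fderiv_eq (𝕜 := ℝ)
      rw [fderiv_comp y (by rw [hrx]; exact (hs.restrict_scalars ℝ).differentiableAt (by simp))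
        ((hr.restrict_scalars ℝ).differentiableAt (by simp)), hrx, fderiv_id] at e
      have e' : ∀ v, fderiv ℝ stepMap x (fderiv ℝ r y v) = v := fun v => congrArg (fun L => L v) e
      change modelForm x _ _ = modelForm y _ _
      rw [← modelForm_stepMap hx h2, e', e']
      simp only [h3]
      rfl

theorem formTransport_of_eq {a b : Σ _ : ZMod d, modelDom}
    (h : (Quot.mk (TateStep d) a) = Quot.mk _ b) : FormTransport a b := by
  have key : ∀ a b, Relation.EqvGen (TateStep d) a b → FormTransport a b ∧ FormTransport b a := by
    intro a b h
    induction h with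
    | rel a b h => exact FormTransport.of_step h
    | refl a => exact ⟨.refl a, .refl a⟩
    | symm a b _ ih => exact ih.symm
    | trans a b c _ _ ih ih' => exact ⟨ih.1.trans ih'.1, ih'.2.trans ih.2⟩
  exact (key a b (Quot.eqvGen_exact h)).1

theorem exists_form_transition {i j : ZMod d} {x y : ℂ × ℂ} (hx : x ∈ modelDom)
    (hy : y ∈ modelDom) (h : param i x = param j y) :
    ∃ φ : ℂ × ℂ → ℂ × ℂ, ContDiffAt ℂ ω φ x ∧ φ x = y ∧
      (∀ᶠ x' in 𝓝 x, param j (φ x') = param i x') ∧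
      ∀ v w, modelForm y (fderiv ℝ φ x v) (fderiv ℝ φ x w) = modelForm x v w := by
  rw [param_of_mem _ hx, param_of_mem _ hy] at h
  exact formTransport_of_eq h

/-- The Kähler form on `Y_d`. Its expression is `modelForm` in every chart, as the charts are local
inverses of the inclusions of the local model. -/
def kahlerForm (d : ℕ) : KahlerForm (ℂ × ℂ) (TateFibration d) where
  form _ := modelForm
  contDiffOn e he x hx := by
    obtain ⟨i, h1, -⟩ := (etaleAtlas d).exists_param_eq he
    exact (contDiffAt_leviForm (contDiffAt_kahlerPotential (h1 hx))).contDiffWithinAt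
  alternating e he x hx v := leviForm_self _ _ _
  invariant e he x hx v w := by
    obtain ⟨i, h1, -⟩ := (etaleAtlas d).exists_param_eq he
    exact leviForm_I_smul ((contDiffAt_kahlerPotential (h1 hx)).of_le two_le_infty) v w
  positive e he x hx v hv := by
    obtain ⟨i, h1, -⟩ := (etaleAtlas d).exists_param_eq he
    exact modelForm_pos (h1 hx) hv
  closed e he x hx u v w := by
    obtain ⟨i, h1, -⟩ := (etaleAtlas d).exists_param_eq he
    exact leviForm_closed (contDiffAt_kahlerPotential (h1 hx)) u v w
  compatible e he e' he' x hx hxe v w := by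
    obtain ⟨i, h1, h2⟩ := (etaleAtlas d).exists_param_eq he
    obtain ⟨j, k1, k2⟩ := (etaleAtlas d).exists_param_eq he'
    have hy := e'.map_source hxe
    obtain ⟨φ, a1, a2, a3, a4⟩ := exists_form_transition (i := i) (j := j) (h1 hx) (k1 hy)
      ((h2 x).symm.trans (((k2 _).symm.trans (e'.left_inv hxe)).symm))
    have := (etaleAtlas d).chart_comp_eventuallyEq k2 a1.continuousAt (a2 ▸ hy)
      (g := e.symm) (a3.mono fun x' hx' => hx'.trans (h2 x').symm)
    rw [this.fderiv_eq]
    exact (a4 v w).symm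

theorem isPreservedBy_vadd (k : ZMod d) : (kahlerForm d).IsPreservedBy fun y => k +ᵥ y := by
  constructor
  · intro y
    obtain ⟨i, x, hx, rfl⟩ := exists_param y
    refine (etaleAtlas d).contMDiffAt_of_param hx ?_
    refine ((etaleAtlas d).contMDiffAt_param (k + i) hx).congr_of_eventuallyEq ?_
    exact Eventually.of_forall fun z => vadd_param k i z
  · intro e he e' he' x hx hxe v w
    obtain ⟨i, h1, h2⟩ := (etaleAtlas d).exists_param_eq he
    obtain ⟨j, k1, k2⟩ := (etaleAtlas d).exists_param_eq he'
    have hy := e'.map_source hxe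
    have h3 : ∀ z, k +ᵥ e.symm z = param (k + i) z := fun z => by
      rw [← vadd_param, h2]
      rfl
    obtain ⟨φ, a1, a2, a3, a4⟩ := exists_form_transition (i := k + i) (j := j) (h1 hx) (k1 hy)
      ((h3 x).symm.trans (((k2 _).symm.trans (e'.left_inv hxe)).symm))
    have := (etaleAtlas d).chart_comp_eventuallyEq k2 a1.continuousAt (a2 ▸ hy)
      (g := (fun y => k +ᵥ y) ∘ e.symm) (a3.mono fun x' hx' => hx'.trans (h3 x').symm)
    rw [this.fderiv_eq]
    exact (a4 v w).symm

end TateFibration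

/-! ### The Kähler form on `Y_d ^ n / Γ` -/

theorem leviForm_sum {V ι : Type*} [NormedAddCommGroup V] [NormedSpace ℂ V] (s : Finset ι)
    {φ : ι → V → ℝ} {x : V} (h : ∀ i, ContDiffAt ℝ 2 (φ i) x) :
    leviForm (∑ i ∈ s, φ i) x = ∑ i ∈ s, leviForm (φ i) x := by
  classical
  induction s using Finset.induction_on with
  | empty =>
    have : fderiv ℝ (0 : V → ℝ) = 0 := fderiv_zero
    simp [leviForm, this, fderiv_zero]
  | insert a s ha ih =>
    have hs : ContDiffAt ℝ 2 (∑ i ∈ s, φ i) x := by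
      have := ContDiffAt.sum (s := s) fun i _ => h i
      convert this using 1
      ext
      simp
    rw [Finset.sum_insert ha, Finset.sum_insert ha, leviForm_add (h a) hs, ih]

/-- The sum over the `n` factors of the forms `modelForm`, again the form of a potential. -/
def productForm {n : ℕ} (x : Fin n → ℂ × ℂ) :
    (Fin n → ℂ × ℂ) →L[ℝ] (Fin n → ℂ × ℂ) →L[ℝ] ℝ :=
  leviForm (∑ j, fun x : Fin n → ℂ × ℂ => kahlerPotential (x j)) x

section productForm

variable {n : ℕ} {x : Fin n → ℂ × ℂ}

theorem contDiffAt_productPotential (hx : ∀ j, x j ∈ modelDom) :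
    ContDiffAt ℝ ∞ (∑ j, fun x : Fin n → ℂ × ℂ => kahlerPotential (x j)) x := by
  have : ContDiffAt ℝ ∞ (fun x : Fin n → ℂ × ℂ => ∑ j, kahlerPotential (x j)) x :=
    ContDiffAt.sum fun j _ => ContDiffAt.comp (g := kahlerPotential) x
      (contDiffAt_kahlerPotential (hx j)) (contDiff_apply ℝ (ℂ × ℂ) j).contDiffAt
  convert this using 1
  ext
  simp

theorem productForm_apply (hx : ∀ j, x j ∈ modelDom) (v w : Fin n → ℂ × ℂ) :
    productForm x v w = ∑ j, modelForm (x j) (v j) (w j) := by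
  have h : ∀ j, ContDiffAt ℝ 2 (fun x : Fin n → ℂ × ℂ => kahlerPotential (x j)) x := fun j =>
    (ContDiffAt.comp (g := kahlerPotential) (f := fun x : Fin n → ℂ × ℂ => x j) x
      (contDiffAt_kahlerPotential (hx j)) (contDiff_apply ℝ (ℂ × ℂ) j).contDiffAt).of_le
      two_le_infty
  unfold productForm
  rw [leviForm_sum _ h]
  simp only [sum_apply]
  refine Finset.sum_congr rfl fun j _ => ?_
  have h1 : ContDiffAt ℂ 2 (fun x : Fin n → ℂ × ℂ => x j) x :=
    (contDiff_apply ℂ (ℂ × ℂ) j).contDiffAt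
  have h2 := leviForm_comp (φ := kahlerPotential) (ψ := fun x : Fin n → ℂ × ℂ => x j)
    ((contDiffAt_kahlerPotential (hx j)).of_le two_le_infty) h1 v w
  refine h2.trans ?_
  have h3 : fderiv ℝ (fun x : Fin n → ℂ × ℂ => x j) x = ContinuousLinearMap.proj j :=
    (hasFDerivAt_apply j x).fderiv
  rw [h3]
  rfl

theorem productForm_pos (hx : ∀ j, x j ∈ modelDom) {v : Fin n → ℂ × ℂ} (hv : v ≠ 0) :
    0 < productForm x v (Complex.I • v) := by
  rw [productForm_apply hx]
  have h0 : ∀ j, 0 ≤ modelForm (x j) (v j) ((Complex.I • v) j) := fun j => by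
    by_cases h : v j = 0
    · simp [h]
    · exact (modelForm_pos (hx j) h).le
  obtain ⟨j, hj⟩ := Function.ne_iff.1 hv
  exact Finset.sum_pos' (fun j _ => h0 j) ⟨j, Finset.mem_univ j, modelForm_pos (hx j) hj⟩

theorem fderiv_piMap {φ : Fin n → ℂ × ℂ → ℂ × ℂ} (h : ∀ j, DifferentiableAt ℝ (φ j) (x j))
    (v : Fin n → ℂ × ℂ) (j : Fin n) :
    fderiv ℝ (fun z j => φ j (z j)) x v j = fderiv ℝ (φ j) (x j) (v j) := by
  have : HasFDerivAt (fun (z : Fin n → ℂ × ℂ) j => φ j (z j))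
      (ContinuousLinearMap.pi fun j =>
        (fderiv ℝ (φ j) (x j)).comp (ContinuousLinearMap.proj j)) x :=
    hasFDerivAt_pi.2 fun j => (h j).hasFDerivAt.comp x (hasFDerivAt_apply j x)
  rw [this.fderiv]
  rfl

end productForm

namespace TateQuotient

open TateFibration

variable {n d : ℕ} {Γ : AddSubgroup (Fin n → ZMod d)}

theorem exists_form_transition {i i' : Fin n → ZMod d} {x y : Fin n → ℂ × ℂ}
    (hx : ∀ j, x j ∈ modelDom) (hy : ∀ j, y j ∈ modelDom) (h : param Γ i x = param Γ i' y) :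
    ∃ φ : (Fin n → ℂ × ℂ) → (Fin n → ℂ × ℂ), ContDiffAt ℂ ω φ x ∧ φ x = y ∧
      (∀ᶠ x' in 𝓝 x, param Γ i' (φ x') = param Γ i x') ∧
      ∀ v w, productForm y (fderiv ℝ φ x v) (fderiv ℝ φ x w) =
        ∑ j, modelForm (x j) (v j) (w j) := by
  obtain ⟨a, ha, h⟩ := exists_vadd h
  choose φ h1 h2 h3 h4 using fun j => TateFibration.exists_form_transition (hx j) (hy j) (h j)
  refine ⟨fun z j => φ j (z j), contDiffAt_pi.2 fun j => ?_, funext h2, ?_, fun v w => ?_⟩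
  · exact (h1 j).comp x (contDiff_apply ℂ (ℂ × ℂ) j).contDiffAt
  · have := eventually_all.2 fun j => (continuous_apply j).continuousAt.eventually (h3 j)
    filter_upwards [this] with z hz
    refine (mk_eq_iff.2 ⟨a, ha, fun j => ?_⟩ : mk Γ _ = mk Γ _).symm
    rw [vadd_param, hz j]
  · have hd : ∀ j, DifferentiableAt ℝ (φ j) (x j) := fun j =>
      ((h1 j).restrict_scalars ℝ).differentiableAt (by simp)
    rw [productForm_apply hy]
    refine Finset.sum_congr rfl fun j _ => ?_
    refine Eq.trans ?_ (h4 j (v j) (w j))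
    exact congrArg₂ (fun v w => modelForm (y j) v w) (fderiv_piMap hd v j) (fderiv_piMap hd w j)

theorem mem_dom {x : Fin n → ℂ × ℂ} (hx : x ∈ (etaleAtlas Γ).dom) (j : Fin n) :
    x j ∈ modelDom := hx j (mem_univ j)

/-- The Kähler form on `Y_d ^ n / Γ`, with expression `productForm` in every chart. -/
def kahlerForm (Γ : AddSubgroup (Fin n → ZMod d)) :
    KahlerForm (Fin n → ℂ × ℂ) (TateQuotient Γ) where
  form _ := productForm
  contDiffOn e he x hx := by
    obtain ⟨i, h1, -⟩ := (etaleAtlas Γ).exists_param_eq he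
    exact (contDiffAt_leviForm (contDiffAt_productPotential (mem_dom (h1 hx)))).contDiffWithinAt
  alternating e he x hx v := leviForm_self _ _ _
  invariant e he x hx v w := by
    obtain ⟨i, h1, -⟩ := (etaleAtlas Γ).exists_param_eq he
    exact leviForm_I_smul ((contDiffAt_productPotential (mem_dom (h1 hx))).of_le two_le_infty) v w
  positive e he x hx v hv := by
    obtain ⟨i, h1, -⟩ := (etaleAtlas Γ).exists_param_eq he
    exact productForm_pos (mem_dom (h1 hx)) hv
  closed e he x hx u v w := by
    obtain ⟨i, h1, -⟩ := (etaleAtlas Γ).exists_param_eq he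
    exact leviForm_closed (contDiffAt_productPotential (mem_dom (h1 hx))) u v w
  compatible e he e' he' x hx hxe v w := by
    obtain ⟨i, h1, h2⟩ := (etaleAtlas Γ).exists_param_eq he
    obtain ⟨j, k1, k2⟩ := (etaleAtlas Γ).exists_param_eq he'
    have hy := e'.map_source hxe
    obtain ⟨φ, a1, a2, a3, a4⟩ := exists_form_transition (i := i) (i' := j) (mem_dom (h1 hx))
      (mem_dom (k1 hy)) ((h2 x).symm.trans (((k2 _).symm.trans (e'.left_inv hxe)).symm))
    have := (etaleAtlas Γ).chart_comp_eventuallyEq k2 a1.continuousAt (a2 ▸ hy)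
      (g := e.symm) (a3.mono fun x' hx' => hx'.trans (h2 x').symm)
    rw [this.fderiv_eq]
    exact (productForm_apply (mem_dom (h1 hx)) v w).trans (a4 v w).symm

theorem isInducedBy_kahlerForm (Γ : AddSubgroup (Fin n → ZMod d)) :
    IsInducedBy (kahlerForm Γ) (TateFibration.kahlerForm d) := by
  intro e he e' he' x hx hxe F v w
  choose i h1 h2 using fun j => (TateFibration.etaleAtlas d).exists_param_eq (he j)
  obtain ⟨i', k1, k2⟩ := (etaleAtlas Γ).exists_param_eq he'
  have hy := e'.map_source hxe
  have h3 : ∀ x : Fin n → ℂ × ℂ, mk Γ (fun j => (e j).symm (x j)) = param Γ i x := fun x =>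
    congrArg (mk Γ) (funext fun j => h2 j (x j))
  obtain ⟨φ, a1, a2, a3, a4⟩ := exists_form_transition (i := i) (i' := i')
    (fun j => h1 j (hx j)) (mem_dom (k1 hy))
    ((h3 x).symm.trans (((k2 _).symm.trans (e'.left_inv hxe)).symm))
  have : F =ᶠ[𝓝 x] φ := (etaleAtlas Γ).chart_comp_eventuallyEq k2 a1.continuousAt (a2 ▸ hy)
    (g := fun x => mk Γ (fun j => (e j).symm (x j)))
    (a3.mono fun x' hx' => hx'.trans (h3 x').symm)
  rw [this.fderiv_eq]
  exact a4 v w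

/-! ### The projection `Y_d ^ n / Γ → D ^ n` -/

theorem proj_param (i : Fin n → ZMod d) {x : Fin n → ℂ × ℂ} (hx : ∀ j, x j ∈ modelDom) :
    (proj Γ (param Γ i x)).1 = fun j => (x j).1 * (x j).2 := by
  ext j
  change TateFibration.proj (TateFibration.param (i j) (x j)) = _
  rw [param_of_mem _ (hx j)]
  rfl

theorem contMDiff_proj (Γ : AddSubgroup (Fin n → ZMod d)) :
    ContMDiff 𝓘(ℂ, Fin n → ℂ × ℂ) 𝓘(ℂ, Fin n → ℂ) ω (proj Γ) := by
  intro y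
  obtain ⟨i, x, hx, rfl⟩ := (etaleAtlas Γ).surjective y
  refine (etaleAtlas Γ).contMDiffAt_of_param hx ?_
  have hev : (fun x => (proj Γ (param Γ i x)).1) =ᶠ[𝓝 x] fun x j => (x j).1 * (x j).2 := by
    filter_upwards [(etaleAtlas Γ).isOpen_dom.mem_nhds hx] with z hz
    exact proj_param i (mem_dom hz)
  have hd : ContDiffAt ℂ ω (fun x => (proj Γ (param Γ i x)).1) x := by
    refine ContDiffAt.congr_of_eventuallyEq ?_ hev
    exact ContDiff.contDiffAt (by fun_prop)
  rw [contMDiffAt_iff_target]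
  exact ⟨IsInducing.subtypeVal.continuousAt_iff.2 hd.continuousAt, hd.contMDiffAt⟩

end TateQuotient

/-- If `|v| > 1`, a gluing step replaces `(|u|, |v|)` by `(1 / |v|, |uv| |v|)`, with `|uv| < 1`;
similarly for `|u| > 1` and the inverse step. So finitely many steps suffice. -/
theorem TateFibration.exists_param_norm_le {d : ℕ} (y : TateFibration d) :
    ∃ i, ∃ x ∈ modelDom, ‖x.1‖ ≤ 1 ∧ ‖x.2‖ ≤ 1 ∧ param i x = y := by
  obtain ⟨i, x, hx, rfl⟩ := exists_param y
  obtain ⟨k, hk1, hk2⟩ : ∃ k : ℕ, ‖x.1‖ * ‖x.1 * x.2‖ ^ k ≤ 1 ∧ ‖x.2‖ * ‖x.1 * x.2‖ ^ k ≤ 1 := by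
    have h0 := tendsto_pow_atTop_nhds_zero_of_lt_one (norm_nonneg (x.1 * x.2)) hx
    have h1 := h0.const_mul ‖x.1‖
    have h2 := h0.const_mul ‖x.2‖
    rw [mul_zero] at h1 h2
    exact ((h1.eventually_le_const one_pos).and (h2.eventually_le_const one_pos)).exists
  rcases le_total ‖x.1‖ 1 with h | h
  · clear hk1
    induction k generalizing i x with
    | zero => exact ⟨i, x, hx, h, by simpa using hk2, rfl⟩
    | succ k ih =>
      by_cases h2 : ‖x.2‖ ≤ 1
      · exact ⟨i, x, hx, h, h2, rfl⟩
      · push Not at h2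
        have h0 : x.2 ≠ 0 := norm_pos_iff.1 (one_pos.trans h2)
        have hq : (stepMap x).1 * (stepMap x).2 = x.1 * x.2 := by
          simp only [stepMap]
          field_simp
        have := ih (i + 1) (stepMap x) (stepMap_mem hx h0) (by
          rw [hq]
          simp only [stepMap]
          refine le_trans (le_of_eq ?_) hk2
          rw [pow_succ]
          simp only [norm_mul, norm_pow]
          ring) (by
          simp only [stepMap, norm_inv]
          exact inv_le_one_of_one_le₀ h2.le)
        rwa [show param (i + 1) (stepMap x) = param i x from param_step i hx h0] at this
  · have h' : ‖x.2‖ ≤ 1 := by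
      have : ‖x.1 * x.2‖ < 1 := hx
      rw [norm_mul] at this
      nlinarith [norm_nonneg x.2]
    clear hk2 h
    induction k generalizing i x with
    | zero => exact ⟨i, x, hx, by simpa using hk1, h', rfl⟩
    | succ k ih =>
      by_cases h2 : ‖x.1‖ ≤ 1
      · exact ⟨i, x, hx, h2, h', rfl⟩
      · push Not at h2
        have h0 : x.1 ≠ 0 := norm_pos_iff.1 (one_pos.trans h2)
        have hq : x.1 ^ 2 * x.2 * x.1⁻¹ = x.1 * x.2 := by field_simp
        have := ih (i - 1) (x.1 ^ 2 * x.2, x.1⁻¹) (mem_of_step_symm hx h0) (by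
          simp only [hq]
          refine le_trans (le_of_eq ?_) hk1
          rw [pow_succ]
          simp only [norm_mul, norm_pow]
          ring) (by
          simp only [norm_inv]
          exact inv_le_one_of_one_le₀ h2.le)
        have e := param_step (i - 1) (mem_of_step_symm hx h0) (inv_ne_zero h0)
        have e' : ((x.1⁻¹)⁻¹, x.1 ^ 2 * x.2 * x.1⁻¹ ^ 2) = x := by
          ext
          · simp
          · simp
            field_simp
        rw [sub_add_cancel, e'] at e
        rwa [← e] at this

theorem TateQuotient.isProperMap_proj {n d : ℕ} [NeZero d] (Γ : AddSubgroup (Fin n → ZMod d)) :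
    IsProperMap (proj Γ) := by
  have : LocallyCompactSpace (polydisk n) := (polydisk n).isOpen.locallyCompactSpace
  rw [isProperMap_iff_isCompact_preimage]
  refine ⟨(contMDiff_proj Γ).continuous, fun K hK => ?_⟩
  let m : (Fin n → ℂ × ℂ) → (Fin n → ℂ) := fun x j => (x j).1 * (x j).2
  have hm : Continuous m := by fun_prop
  have hK' : IsCompact (Subtype.val '' K) := hK.image continuous_subtype_val
  let C : Set (Fin n → ℂ × ℂ) := Metric.closedBall 0 1 ∩ m ⁻¹' (Subtype.val '' K)
  have hC : IsCompact C := (isCompact_closedBall 0 1).inter_right (hK'.isClosed.preimage hm)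
  have hCd : C ⊆ (etaleAtlas Γ).dom := by
    rintro x ⟨-, q, -, hq⟩ j -
    have := q.2 j
    rw [hq] at this
    exact this
  -- The preimage is the union of finitely many images of a compact set, since `ℤ/d` is finite.
  have : proj Γ ⁻¹' K = ⋃ i, param Γ i '' C := by
    ext y
    simp only [mem_iUnion]
    constructor
    · intro hy
      induction y using Quotient.ind with
      | _ y =>
        choose i x hx h1 h2 h3 using fun j => TateFibration.exists_param_norm_le (y j)
        have e : param Γ i x = mk Γ y := congrArg (mk Γ) (funext h3)
        refine ⟨i, x, ⟨?_, proj Γ (mk Γ y), hy, ?_⟩, e⟩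
        · rw [mem_closedBall_zero_iff, pi_norm_le_iff_of_nonneg zero_le_one]
          exact fun j => by rw [Prod.norm_def]; exact max_le (h1 j) (h2 j)
        · rw [← e, proj_param i hx]
    · rintro ⟨i, x, hx, rfl⟩
      obtain ⟨-, q, hqK, hq⟩ := id hx
      have e := proj_param (Γ := Γ) i (mem_dom (hCd hx))
      rw [mem_preimage, show proj Γ (param Γ i x) = q from Subtype.ext (e.trans hq.symm)]
      exact hqK
  rw [this]
  exact isCompact_iUnion fun i => hC.image_of_continuousOn
    (((etaleAtlas Γ).continuousOn i).mono hCd)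

/-! ### Integer matrices -/

/-- By the Smith normal form, an integer matrix with `n` columns becomes zero below its first `n`
rows after an invertible change of basis of the target. -/
theorem exists_unimodular_mul_eq_zero {m n : ℕ} (M : Matrix (Fin m) (Fin n) ℤ) :
    ∃ P P' : Matrix (Fin m) (Fin m) ℤ, P' * P = 1 ∧
      ∀ (i : Fin m) (j : Fin n), n ≤ (i : ℕ) → (P' * M) i j = 0 := by
  obtain ⟨n', o, hno, bO, bN, a, h⟩ := Submodule.exists_smith_normal_form_of_le
    (Pi.basisFun ℤ (Fin m)) (LinearMap.range M.mulVecLin) ⊤ le_top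
  have hn' : n' ≤ n := by
    have h1 := LinearMap.finrank_range_le M.mulVecLin
    rw [Module.finrank_eq_card_basis bN] at h1
    simpa using h1
  let b := bO.map (Submodule.topEquiv (R := ℤ) (M := Fin m → ℤ))
  obtain rfl : m = o := by
    have := Module.finrank_eq_card_basis b
    simpa using this
  refine ⟨LinearMap.toMatrix' (b.equivFun.symm : (Fin m → ℤ) →ₗ[ℤ] _),
    LinearMap.toMatrix' (b.equivFun : (Fin m → ℤ) →ₗ[ℤ] _), ?_, fun i j hi => ?_⟩
  · rw [← LinearMap.toMatrix'_comp]
    simp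
  · have hmem : M.col j ∈ LinearMap.range M.mulVecLin := ⟨Pi.single j 1, by simp⟩
    have e : (LinearMap.toMatrix' (b.equivFun : (Fin m → ℤ) →ₗ[ℤ] _) * M) i j =
        b.repr (M.col j) i := by
      have : (LinearMap.toMatrix' (b.equivFun : (Fin m → ℤ) →ₗ[ℤ] _)).mulVec (M.col j) =
          b.equivFun (M.col j) := by
        rw [LinearMap.toMatrix'_mulVec]
        rfl
      exact congrFun this i
    have key : ∀ y : LinearMap.range M.mulVecLin, b.repr (y : Fin m → ℤ) i = 0 := by
      intro y
      have hb : ∀ k, (bN k : Fin m → ℤ) = a k • b (Fin.castLE hno k) := fun k => by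
        rw [h k]
        simp [b]
      rw [← bN.sum_repr y]
      simp only [Submodule.coe_sum, Submodule.coe_smul, hb, map_sum, map_smul,
        Finsupp.coe_finsetSum, Finset.sum_apply, Finsupp.smul_apply, Module.Basis.repr_self]
      refine Finset.sum_eq_zero fun k _ => ?_
      rw [Finsupp.single_eq_of_ne, smul_zero, smul_zero]
      intro hk
      have := congrArg Fin.val hk
      have hk2 := k.2
      simp at this
      omega
    rw [e]
    exact key ⟨_, hmem⟩

theorem mulVec_injective_of_rank {m n : ℕ} {M : Matrix (Fin m) (Fin n) ℤ}
    (hM : (M.map (Int.cast : ℤ → ℚ)).rank = n) {v : Fin n → ℤ} (hv : M.mulVec v = 0) : v = 0 := by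
  have h1 : Function.Injective (M.map (Int.cast : ℤ → ℚ)).mulVecLin := by
    rw [← LinearMap.ker_eq_bot, ← Submodule.finrank_eq_zero]
    have := LinearMap.finrank_range_add_finrank_ker (M.map (Int.cast : ℤ → ℚ)).mulVecLin
    rw [← Matrix.rank, hM] at this
    simpa using this
  have h2 : (fun j => (v j : ℚ)) = 0 := by
    apply h1
    ext i
    have := congrFun hv i
    simp only [Matrix.mulVec, dotProduct, Pi.zero_apply] at this
    simp only [Matrix.mulVecLin_apply, Matrix.mulVec, dotProduct, Matrix.map_apply,
      Pi.zero_apply, mul_zero, Finset.sum_const_zero]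
    exact_mod_cast this
  ext j
  have := congrFun h2 j
  simpa using this

theorem exists_isCoveringData {m n : ℕ} (hmn : n ≤ m) (M : Matrix (Fin m) (Fin n) ℤ)
    (hM : (M.map (Int.cast : ℤ → ℚ)).rank = n) :
    ∃ (d : ℕ) (T : Matrix (Fin m) (Fin m) ℤ), IsCoveringData hmn M d T := by
  obtain ⟨P, P', hP, h0⟩ := exists_unimodular_mul_eq_zero M
  have hP' : P * P' = 1 := mul_eq_one_comm.1 hP
  obtain ⟨k, rfl⟩ := Nat.exists_eq_add_of_le hmn
  let B : Matrix (Fin n) (Fin n) ℤ := fun i j => (P' * M) (Fin.castAdd k i) j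
  have hB : B.det ≠ 0 := by
    intro h
    obtain ⟨v, hv, hBv⟩ := Matrix.exists_mulVec_eq_zero_iff.2 h
    refine hv (mulVec_injective_of_rank hM ?_)
    have h1 : (P' * M).mulVec v = 0 := by
      ext i
      refine Fin.addCases (fun i => congrFun hBv i) (fun i => ?_) i
      simp only [Matrix.mulVec, dotProduct, Pi.zero_apply]
      exact Finset.sum_eq_zero fun j _ => by rw [h0 _ _ (by simp), zero_mul]
    calc M.mulVec v = P.mulVec ((P' * M).mulVec v) := by
          rw [Matrix.mulVec_mulVec, ← Matrix.mul_assoc, hP', Matrix.one_mul]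
      _ = 0 := by rw [h1, Matrix.mulVec_zero]
  -- In the new basis the extended matrix is `diag (B, 1)`; its inverse up to the factor
  -- `d = (det B) ^ 2 > 0` on the first block is `diag (det B • adjugate B, 1)`.
  let f : Matrix (Fin n ⊕ Fin k) (Fin n ⊕ Fin k) ℤ → Matrix (Fin (n + k)) (Fin (n + k)) ℤ :=
    Matrix.reindex finSumFinEquiv finSumFinEquiv
  have hf : ∀ X Y, f X * f Y = f (X * Y) := fun X Y => by
    simp [f, Matrix.submatrix_mul_equiv]
  let C := f (Matrix.fromBlocks B 0 0 1)
  let S := f (Matrix.fromBlocks (B.det • B.adjugate) 0 0 1)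
  let d : ℕ := B.det.natAbs ^ 2
  have hdZ : (d : ℤ) = B.det * B.det := by
    simp only [d, Nat.cast_pow, Int.natCast_natAbs, sq_abs]
    ring
  have hd : 0 < d := by positivity
  have hSC : S * C = Matrix.diagonal fun i : Fin (n + k) => if (i : ℕ) < n then (d : ℤ) else 1 := by
    simp only [S, C, hf, Matrix.fromBlocks_multiply]
    ext i j
    refine Fin.addCases (fun i => ?_) (fun i => ?_) i <;>
      refine Fin.addCases (fun j => ?_) (fun j => ?_) j
    · have e : (B.det • B.adjugate) * B = (B.det * B.det) • (1 : Matrix (Fin n) (Fin n) ℤ) := by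
        rw [Matrix.smul_mul, Matrix.adjugate_mul, smul_smul]
      rw [e, Matrix.diagonal_apply]
      simp only [f, Matrix.reindex_apply, Matrix.submatrix_apply, finSumFinEquiv_symm_apply_castAdd,
        Matrix.fromBlocks_apply₁₁, Matrix.zero_mul, Matrix.mul_zero,
        Matrix.smul_apply, Matrix.one_apply, add_zero, smul_eq_mul,
        Fin.castAdd_inj, Fin.val_castAdd, i.2, if_true, hdZ]
      split_ifs <;> simp
    · simp [f, Matrix.diagonal_apply, Fin.ext_iff]
      omega
    · simp [f, Matrix.diagonal_apply, Fin.ext_iff]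
      omega
    · simp [f, Matrix.diagonal_apply, Matrix.one_apply]
  have hprod : S * P' * (P * C) =
      Matrix.diagonal fun i : Fin (n + k) => if (i : ℕ) < n then (d : ℤ) else 1 := by
    rw [Matrix.mul_assoc, ← Matrix.mul_assoc P', hP, Matrix.one_mul, hSC]
  have hdet : (S * P').det * (P * C).det ≠ 0 := by
    rw [← Matrix.det_mul, hprod, Matrix.det_diagonal, Finset.prod_ne_zero_iff]
    intro i _
    split_ifs
    · exact_mod_cast hd.ne'
    · exact one_ne_zero
  refine ⟨d, S * P', hd, left_ne_zero_of_mul hdet, P * C, right_ne_zero_of_mul hdet,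
    fun i j => ?_, hprod⟩
  have hC : ∀ i, C i (Fin.castAdd k j) = (P' * M) i j := fun i => by
    refine Fin.addCases (fun i => ?_) (fun i => ?_) i
    · simp [C, f, B]
      rfl
    · rw [h0 _ _ (by simp)]
      simp [C, f]
  calc (P * C) i (Fin.castLE hmn j) = (P * (P' * M)) i j := by
        rw [Matrix.mul_apply, Matrix.mul_apply]
        exact Finset.sum_congr rfl fun l _ => by rw [← hC]; rfl
    _ = M i j := by rw [← Matrix.mul_assoc, hP', Matrix.one_mul]

/-! ### Finite subgroups of tori -/

theorem torusHom_mul {m : ℕ} (A B : Matrix (Fin m) (Fin m) ℤ) (l : Fin m → ℂˣ) :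
    torusHom (A * B) l = torusHom A (torusHom B l) := by
  ext1 i
  change ∏ j, l j ^ (A * B) i j = ∏ k, (∏ j, l j ^ B k j) ^ A i k
  simp only [← Finset.prod_zpow, ← zpow_mul]
  rw [Finset.prod_comm]
  refine Finset.prod_congr rfl fun j _ => ?_
  rw [Matrix.mul_apply]
  have h : l j ^ ∑ k, A i k * B k j = ∏ k, l j ^ (A i k * B k j) :=
    map_sum (zpowersHom ℂˣ (l j)).toAdditiveRight (fun k => A i k * B k j) Finset.univ
  rw [h]
  exact Finset.prod_congr rfl fun k _ => by rw [mul_comm]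

theorem torusHom_diagonal {m : ℕ} (a : Fin m → ℤ) (l : Fin m → ℂˣ) (i : Fin m) :
    torusHom (Matrix.diagonal a) l i = l i ^ a i := by
  change ∏ j, l j ^ Matrix.diagonal a i j = _
  rw [Finset.prod_eq_single i]
  · simp
  · intro j _ hj
    simp [Matrix.diagonal_apply_ne _ hj.symm]
  · simp

theorem exists_toCircle_eq {d : ℕ} [NeZero d] {l : ℂˣ} (hl : l ^ d = 1) :
    ∃ a : ZMod d, Circle.toUnits (ZMod.toCircle a) = l := by
  obtain ⟨i, -, hi⟩ := (Complex.mem_rootsOfUnity d l).1 hl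
  refine ⟨(i : ZMod d), Units.ext ?_⟩
  rw [← hi, Circle.toUnits_apply, Units.val_mk0, ZMod.toCircle_natCast]
  congr 1
  ring

/-- On the kernel of the endomorphism `Tᵀ` of the torus, `M'ᵀ Tᵀ = diag (d, …, d, 1, …, 1)` is
trivial. -/
theorem exists_rootVector_eq {m n : ℕ} {hmn : n ≤ m} {M : Matrix (Fin m) (Fin n) ℤ} {d : ℕ}
    [NeZero d] {T : Matrix (Fin m) (Fin m) ℤ} (h : IsCoveringData hmn M d T)
    {l : Fin m → ℂˣ} (hl : l ∈ (torusHom T.transpose).ker) :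
    ∃ a : Fin n → ZMod d, rootVector m a = l := by
  obtain ⟨-, -, M', -, -, hTM⟩ := h
  have h1 : ∀ i : Fin m, l i ^ (if (i : ℕ) < n then (d : ℤ) else 1) = 1 := fun i => by
    have h2 := torusHom_mul M'.transpose T.transpose l
    rw [MonoidHom.mem_ker.1 hl, map_one, ← Matrix.transpose_mul, hTM,
      Matrix.diagonal_transpose] at h2
    rw [← torusHom_diagonal (fun i : Fin m => if (i : ℕ) < n then (d : ℤ) else 1), h2]
    rfl
  have h3 : ∀ j : Fin n, l (Fin.castLE hmn j) ^ d = 1 := fun j => by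
    simpa using h1 (Fin.castLE hmn j)
  choose a ha using fun j => exists_toCircle_eq (h3 j)
  refine ⟨a, funext fun k => ?_⟩
  unfold rootVector
  split_ifs with hk
  · exact ha ⟨k, hk⟩
  · have := h1 k
    rw [if_neg hk, zpow_one] at this
    exact this.symm

theorem finite_ker_torusHom {m n : ℕ} {hmn : n ≤ m} {M : Matrix (Fin m) (Fin n) ℤ} {d : ℕ}
    [NeZero d] {T : Matrix (Fin m) (Fin m) ℤ} (h : IsCoveringData hmn M d T) :
    Finite (torusHom T.transpose).ker := by
  have : Finite (Fin n → ZMod d) := inferInstance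
  refine Set.Finite.to_subtype ((Set.finite_range (rootVector (n := n) (d := d) m)).subset ?_)
  intro l hl
  exact exists_rootVector_eq h hl

/-- The endomorphism of the torus defined by an integer matrix of nonzero determinant is onto. -/
theorem torusHom_surjective {m : ℕ} {A : Matrix (Fin m) (Fin m) ℤ} (hA : A.det ≠ 0) :
    Function.Surjective (torusHom A) := by
  intro z
  let A' : Matrix (Fin m) (Fin m) ℂ := A.map (Int.cast : ℤ → ℂ)
  have hA' : IsUnit A'.det := by
    have : A'.det = (A.det : ℂ) := (Int.cast_det A).symm
    rw [this, isUnit_iff_ne_zero]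
    exact_mod_cast hA
  let c : Fin m → ℂ := fun i => Complex.log (z i)
  let b : Fin m → ℂ := A'⁻¹.mulVec c
  have hb : A'.mulVec b = c := by
    rw [Matrix.mulVec_mulVec, Matrix.mul_nonsing_inv _ hA', Matrix.one_mulVec]
  refine ⟨fun j => Units.mk0 (Complex.exp (b j)) (Complex.exp_ne_zero _), ?_⟩
  ext i
  change ((∏ j, Units.mk0 (Complex.exp (b j)) (Complex.exp_ne_zero _) ^ A i j : ℂˣ) : ℂ) = z i
  push_cast
  simp only [Units.val_mk0, ← Complex.exp_int_mul, ← Complex.exp_sum]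
  have := congrFun hb i
  simp only [Matrix.mulVec, dotProduct, A', Matrix.map_apply] at this
  rw [this]
  exact Complex.exp_log (z i).ne_zero

/-! ### The moment map of the circle action on the local model -/

section Levi

variable {V : Type*} [NormedAddCommGroup V] [NormedSpace ℂ V]

/-- If `φ` is invariant under the circle action generated by `i σ`, where `σ` is a linear
involution, then the derivative of `φ` along `σ` grows along `σ` at the rate given by the Levi form
of `φ`. -/
theorem fderiv_fderiv_apply_involution {φ : V → ℝ} {x : V} (h : ContDiffAt ℝ 2 φ x) (σ : V →L[ℂ] V)
    (hσ : ∀ y, σ (σ y) = y) (h0 : ∀ᶠ y in 𝓝 x, fderiv ℝ φ y (Complex.I • σ y) = 0) :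
    fderiv ℝ (fun y => fderiv ℝ φ y (σ y)) x (σ x) = leviForm φ x (σ x) (Complex.I • σ x) := by
  have h1 : HasFDerivAt (fderiv ℝ φ) (fderiv ℝ (fderiv ℝ φ) x) x :=
    ((h.fderiv_right (m := 1) (by norm_num)).differentiableAt (by simp)).hasFDerivAt
  have h2 : HasFDerivAt (fun y => σ y) (σ.restrictScalars ℝ) x :=
    (σ.restrictScalars ℝ).hasFDerivAt
  have h3 : HasFDerivAt (fun y => Complex.I • σ y) ((Complex.I • σ).restrictScalars ℝ) x :=
    ((Complex.I • σ).restrictScalars ℝ).hasFDerivAt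
  have e1 := (h1.clm_apply h2).fderiv
  have e2 := (h1.clm_apply h3).fderiv
  have e3 : fderiv ℝ (fun y => fderiv ℝ φ y (Complex.I • σ y)) x = 0 := by
    have : (fun y => fderiv ℝ φ y (Complex.I • σ y)) =ᶠ[𝓝 x] fun _ => 0 := h0
    rw [this.fderiv_eq]
    simp
  rw [e3] at e2
  have e4 := congrArg (fun L => L (Complex.I • σ x)) e2
  simp [hσ, smul_smul] at e4
  rw [e1, leviForm_apply]
  simp [hσ, smul_smul]
  linarith

end Levi

/-- The generator `(u, -v)` of the real flow `(e^s u, e^{-s} v)`. -/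
def hyperField : (ℂ × ℂ) →L[ℂ] (ℂ × ℂ) :=
  (ContinuousLinearMap.fst ℂ ℂ ℂ).prod (-ContinuousLinearMap.snd ℂ ℂ ℂ)

@[simp] theorem hyperField_apply (x : ℂ × ℂ) : hyperField x = (x.1, -x.2) := rfl

/-- The flow `(e^s u, e^{-s} v)`, which preserves the fibres of `(u, v) ↦ u v`. -/
def hyperFlow (s : ℝ) (x : ℂ × ℂ) : ℂ × ℂ := (Real.exp s * x.1, Real.exp (-s) * x.2)

/-- The action `(c u, c̄ v)` of a unit complex number `c`. -/
def rotMap (c : ℂ) (x : ℂ × ℂ) : ℂ × ℂ := (c * x.1, star c * x.2)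

@[simp] theorem hyperFlow_zero (x : ℂ × ℂ) : hyperFlow 0 x = x := by simp [hyperFlow]

theorem hyperFlow_mul (s : ℝ) (x : ℂ × ℂ) :
    (hyperFlow s x).1 * (hyperFlow s x).2 = x.1 * x.2 := by
  have : (Real.exp s : ℂ) * Real.exp (-s) = 1 := by
    rw [← Complex.ofReal_mul, ← Real.exp_add]; simp
  simp only [hyperFlow]
  linear_combination (x.1 * x.2) * this

theorem hyperFlow_mem {s : ℝ} {x : ℂ × ℂ} (hx : x ∈ modelDom) : hyperFlow s x ∈ modelDom := by
  simpa only [modelDom, mem_ofPred_eq, hyperFlow_mul] using hx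

theorem hyperFlow_add (s r : ℝ) (x : ℂ × ℂ) :
    hyperFlow (s + r) x = hyperFlow s (hyperFlow r x) := by
  simp only [hyperFlow, neg_add, Real.exp_add]
  ext <;> push_cast <;> ring

theorem rotMap_mul {c : ℂ} (hc : ‖c‖ = 1) (x : ℂ × ℂ) :
    (rotMap c x).1 * (rotMap c x).2 = x.1 * x.2 := by
  have : c * star c = 1 := by
    rw [Complex.star_def, Complex.mul_conj, Complex.normSq_eq_norm_sq, hc]
    simp
  simp only [rotMap]
  linear_combination (x.1 * x.2) * this

theorem rotMap_mem {c : ℂ} (hc : ‖c‖ = 1) {x : ℂ × ℂ} (hx : x ∈ modelDom) :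
    rotMap c x ∈ modelDom := by
  simpa only [modelDom, mem_ofPred_eq, rotMap_mul hc] using hx

theorem swap_mem {x : ℂ × ℂ} (hx : x ∈ modelDom) : x.swap ∈ modelDom := by
  simpa [modelDom, mul_comm] using hx

theorem hyperFlow_rotMap (s : ℝ) (c : ℂ) (x : ℂ × ℂ) :
    hyperFlow s (rotMap c x) = rotMap c (hyperFlow s x) := by
  simp only [hyperFlow, rotMap]
  ext <;> ring

theorem hyperFlow_swap (s : ℝ) (x : ℂ × ℂ) :
    hyperFlow s x.swap = (hyperFlow (-s) x).swap := by
  simp [hyperFlow]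

theorem hyperFlow_stepMap (s : ℝ) (x : ℂ × ℂ) :
    hyperFlow s (stepMap x) = stepMap (hyperFlow s x) := by
  have : (Real.exp s : ℂ) * Real.exp (-s) = 1 := by
    rw [← Complex.ofReal_mul, ← Real.exp_add]; simp
  have h0 : (Real.exp s : ℂ) ≠ 0 := left_ne_zero_of_mul_eq_one this
  have h1 : (Real.exp (-s) : ℂ) = (Real.exp s : ℂ)⁻¹ := eq_inv_of_mul_eq_one_right this
  simp only [hyperFlow, stepMap, h1]
  ext
  · simp [mul_comm]
  · simp
    field_simp

theorem hasDerivAt_hyperFlow (x : ℂ × ℂ) (s : ℝ) :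
    HasDerivAt (fun s => hyperFlow s x) (hyperField (hyperFlow s x)) s := by
  have h1 : HasDerivAt (fun s : ℝ => (Real.exp s : ℂ) * x.1) ((Real.exp s : ℂ) * x.1) s :=
    (Real.hasDerivAt_exp s).ofReal_comp.mul_const x.1
  have h2 : HasDerivAt (fun s : ℝ => (Real.exp (-s) : ℂ) * x.2)
      (-((Real.exp (-s) : ℂ) * x.2)) s := by
    have := ((Real.hasDerivAt_exp (-s)).comp s (hasDerivAt_neg s)).ofReal_comp.mul_const x.2
    convert! this using 1
    push_cast
    ring
  exact h1.prodMk h2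

theorem hasDerivAt_comp_hyperFlow {G : Type*} [NormedAddCommGroup G] [NormedSpace ℝ G]
    {f : ℂ × ℂ → G} {x : ℂ × ℂ} {s : ℝ} (hf : DifferentiableAt ℝ f (hyperFlow s x)) :
    HasDerivAt (fun s => f (hyperFlow s x)) (fderiv ℝ f (hyperFlow s x)
      (hyperField (hyperFlow s x))) s :=
  hf.hasFDerivAt.comp_hasDerivAt s (hasDerivAt_hyperFlow x s)

theorem hasDerivAt_comp_hyperFlow_zero {G : Type*} [NormedAddCommGroup G] [NormedSpace ℝ G]
    {f : ℂ × ℂ → G} {x : ℂ × ℂ} (hf : DifferentiableAt ℝ f x) :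
    HasDerivAt (fun s => f (hyperFlow s x)) (fderiv ℝ f x (hyperField x)) 0 := by
  have := hasDerivAt_comp_hyperFlow (f := f) (x := x) (s := 0) (by simpa using hf)
  simpa only [hyperFlow_zero] using this

theorem norm_thetaMap_eq {x y : ℂ × ℂ} (hx : x ∈ modelDom) (hy : y ∈ modelDom)
    (h : ∀ n, ‖thetaMonomial n x‖ = ‖thetaMonomial n y‖) : ‖thetaMap x‖ = ‖thetaMap y‖ := by
  have h1 := hasSum_norm_sq_thetaMonomial hx
  simp only [h] at h1
  exact (pow_left_inj₀ (norm_nonneg _) (norm_nonneg _) two_ne_zero).1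
    (h1.unique (hasSum_norm_sq_thetaMonomial hy))

theorem kahlerPotential_rotMap {c : ℂ} (hc : ‖c‖ = 1) {x : ℂ × ℂ} (hx : x ∈ modelDom) :
    kahlerPotential (rotMap c x) = kahlerPotential x := by
  unfold kahlerPotential logNormSq
  rw [norm_thetaMap_eq (rotMap_mem hc hx) hx fun n => ?_]
  simp [thetaMonomial, rotMap, hc]

theorem kahlerPotential_swap {x : ℂ × ℂ} (hx : x ∈ modelDom) :
    kahlerPotential x.swap = kahlerPotential x := by
  have h1 := hasSum_norm_sq_thetaMonomial (swap_mem hx)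
  have h2 := (Equiv.neg ℤ).hasSum_iff.2 (hasSum_norm_sq_thetaMonomial hx)
  unfold kahlerPotential logNormSq
  rw [h1.unique (h2.congr_fun fun n => ?_)]
  rw [thetaMonomial_swap]
  rfl

theorem kahlerPotential_stepMap {x : ℂ × ℂ} (hx : x ∈ modelDom) (h : x.2 ≠ 0) :
    kahlerPotential (stepMap x) = kahlerPotential x - Real.log (‖x.2‖ ^ 2) := by
  have h1 : 0 < ‖thetaMap x‖ := norm_pos_iff.2 (thetaMap_ne_zero hx)
  have h2 : 0 < ‖x.2‖ := norm_pos_iff.2 h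
  unfold kahlerPotential logNormSq
  rw [norm_thetaMap_stepMap hx h, mul_pow, Real.log_mul (by simpa using h) (by positivity),
    norm_inv, inv_pow, Real.log_inv]
  ring

theorem hasDerivAt_rotMap (x : ℂ × ℂ) :
    HasDerivAt (fun s : ℝ => rotMap (Complex.exp (s * Complex.I)) x)
      (Complex.I • hyperField x) 0 := by
  have e1 : HasDerivAt (fun s : ℝ => Complex.exp (s * Complex.I)) Complex.I 0 := by
    have := ((Complex.ofRealCLM.hasDerivAt (x := 0)).mul_const Complex.I).cexp
    simpa using this
  have h1 := e1.mul_const x.1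
  have h2 := e1.star.mul_const x.2
  convert! h1.prodMk h2 using 1
  ext <;> simp

theorem hasDerivAt_comp_rotMap {G : Type*} [NormedAddCommGroup G] [NormedSpace ℝ G]
    {f : ℂ × ℂ → G} {x : ℂ × ℂ} (hf : DifferentiableAt ℝ f x) :
    HasDerivAt (fun s : ℝ => f (rotMap (Complex.exp (s * Complex.I)) x))
      (fderiv ℝ f x (Complex.I • hyperField x)) 0 := by
  have h1 : HasFDerivAt f (fderiv ℝ f x) (rotMap (Complex.exp ((0 : ℝ) * Complex.I)) x) := by
    have hx' : rotMap (Complex.exp ((0 : ℝ) * Complex.I)) x = x := by simp [rotMap]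
    rw [hx']
    exact hf.hasFDerivAt
  exact HasFDerivAt.comp_hasDerivAt (f := fun s : ℝ => rotMap (Complex.exp (s * Complex.I)) x) 0
    h1 (hasDerivAt_rotMap x)

/-- A function which is invariant under the circle action has derivative zero along its orbits. -/
theorem fderiv_I_smul_hyperField {G : Type*} [NormedAddCommGroup G] [NormedSpace ℝ G]
    {f : ℂ × ℂ → G} {x : ℂ × ℂ} (hf : DifferentiableAt ℝ f x)
    (h : ∀ c : ℂ, ‖c‖ = 1 → f (rotMap c x) = f x) :
    fderiv ℝ f x (Complex.I • hyperField x) = 0 := by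
  have h2 := hasDerivAt_comp_rotMap hf
  have h3 : (fun s : ℝ => f (rotMap (Complex.exp (s * Complex.I)) x)) = fun _ => f x :=
    funext fun s => h _ (Complex.norm_exp_ofReal_mul_I s)
  rw [h3] at h2
  exact h2.unique (hasDerivAt_const _ _)

theorem fderiv_kahlerPotential_I_smul {x : ℂ × ℂ} (hx : x ∈ modelDom) :
    fderiv ℝ kahlerPotential x (Complex.I • hyperField x) = 0 :=
  fderiv_I_smul_hyperField ((contDiffAt_kahlerPotential hx).differentiableAt (by simp))
    fun _ hc => kahlerPotential_rotMap hc hx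

/-- The moment map `t = ∑ₙ n |fₙ|² / ∑ₙ |fₙ|²` of the circle action `(c u, c̄ v)` for the
Kähler form, where `fₙ` are the theta monomials; it is half the derivative of the Kähler potential
along `(u, -v)`. It increases by `1` under each gluing step, so that it is a coordinate on the
universal covering of the circle direction of the fibres complementary to the circle action. -/
def moment (x : ℂ × ℂ) : ℝ := fderiv ℝ kahlerPotential x (hyperField x) / 2

theorem hasDerivAt_kahlerPotential {x : ℂ × ℂ} (hx : x ∈ modelDom) :
    HasDerivAt (fun s => kahlerPotential (hyperFlow s x)) (2 * moment x) 0 := by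
  have := hasDerivAt_comp_hyperFlow_zero
    ((contDiffAt_kahlerPotential hx).differentiableAt (by simp))
  convert! this using 1
  unfold moment
  ring

theorem contDiffAt_moment {x : ℂ × ℂ} (hx : x ∈ modelDom) : ContDiffAt ℝ ∞ moment x := by
  have h1 : ContDiffAt ℝ ∞ (fderiv ℝ kahlerPotential) x :=
    (contDiffAt_kahlerPotential hx).fderiv_right (m := ∞) (by simp)
  have h2 : ContDiffAt ℝ ∞ (fun x => hyperField x) x :=
    (hyperField.restrictScalars ℝ).contDiff.contDiffAt
  exact (h1.clm_apply h2).div_const 2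

theorem moment_rotMap {c : ℂ} (hc : ‖c‖ = 1) {x : ℂ × ℂ} (hx : x ∈ modelDom) :
    moment (rotMap c x) = moment x := by
  have h1 := hasDerivAt_kahlerPotential (rotMap_mem hc hx)
  simp only [hyperFlow_rotMap, kahlerPotential_rotMap hc (hyperFlow_mem hx)] at h1
  linarith [h1.unique (hasDerivAt_kahlerPotential hx)]

/-- The reflection `(v, u)` preserves the potential and reverses the flow. -/
theorem moment_swap {x : ℂ × ℂ} (hx : x ∈ modelDom) : moment x.swap = -moment x := by
  have h1 := hasDerivAt_kahlerPotential (swap_mem hx)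
  simp only [hyperFlow_swap, kahlerPotential_swap (hyperFlow_mem hx)] at h1
  have h2 := hasDerivAt_kahlerPotential hx
  rw [← neg_zero] at h2
  have h3 := h2.comp (0 : ℝ) (hasDerivAt_neg 0)
  have := h1.unique h3
  linarith

/-- The gluing changes the potential by `-log |v|²`, which grows at the rate `2` along the flow. -/
theorem moment_stepMap {x : ℂ × ℂ} (hx : x ∈ modelDom) (h : x.2 ≠ 0) :
    moment (stepMap x) = moment x + 1 := by
  have h1 := hasDerivAt_kahlerPotential (stepMap_mem hx h)
  have h2 : (fun s => kahlerPotential (hyperFlow s (stepMap x))) = fun s : ℝ =>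
      kahlerPotential (hyperFlow s x) + (2 * s - Real.log (‖x.2‖ ^ 2)) := by
    ext s
    have h0 : 0 < ‖x.2‖ := norm_pos_iff.2 h
    have h3 : (hyperFlow s x).2 ≠ 0 := mul_ne_zero (by simp) h
    rw [hyperFlow_stepMap, kahlerPotential_stepMap (hyperFlow_mem hx) h3]
    have : Real.log (‖(hyperFlow s x).2‖ ^ 2) = Real.log (‖x.2‖ ^ 2) - 2 * s := by
      simp only [hyperFlow, norm_mul, Complex.norm_real, Real.norm_eq_abs, Real.abs_exp]
      rw [mul_pow, Real.log_mul (by positivity) (by positivity), Real.log_pow, Real.log_exp]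
      push_cast
      ring
    rw [this]
    ring
  rw [h2] at h1
  have h4 := (hasDerivAt_kahlerPotential hx).add
    (((hasDerivAt_id (0 : ℝ)).const_mul 2).sub_const (Real.log (‖x.2‖ ^ 2)))
  have := h1.unique h4
  linarith

/-- The moment map is strictly increasing along the real flow: its derivative is half the value of
the Kähler form on `(u, -v)` and `i (u, -v)`. -/
theorem fderiv_moment_pos {x : ℂ × ℂ} (hx : x ∈ modelDom) (h0 : x ≠ 0) :
    0 < fderiv ℝ moment x (hyperField x) := by
  have h1 := fderiv_fderiv_apply_involution ((contDiffAt_kahlerPotential hx).of_le two_le_infty)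
    hyperField (fun y => by simp) (by
      filter_upwards [isOpen_modelDom.mem_nhds hx] with y hy
      exact fderiv_kahlerPotential_I_smul hy)
  have h2 : 0 < leviForm kahlerPotential x (hyperField x) (Complex.I • hyperField x) :=
    modelForm_pos hx (by
      intro h
      apply h0
      have := congrArg hyperField h
      simpa [Prod.ext_iff] using! this)
  have h3 : DifferentiableAt ℝ (fun y => fderiv ℝ kahlerPotential y (hyperField y)) x := by
    have := (contDiffAt_moment hx).differentiableAt (by simp)
    have h4 := this.const_mul 2
    refine h4.congr_of_eventuallyEq (Eventually.of_forall fun y => ?_)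
    simp only [moment]
    ring
  have h5 : HasFDerivAt moment ((2 : ℝ)⁻¹ • fderiv ℝ (fun y => fderiv ℝ kahlerPotential y
      (hyperField y)) x) x := by
    refine (h3.hasFDerivAt.const_mul (2 : ℝ)⁻¹).congr_of_eventuallyEq
      (Eventually.of_forall fun y => ?_)
    simp only [moment]
    ring
  have h6 := h5.fderiv
  rw [h6]
  refine mul_pos (by norm_num : (0 : ℝ) < 2⁻¹) ?_
  exact h2.trans_eq h1.symm

/-- `t` is a weighted average of the integers. -/
theorem hasSum_moment {x : ℂ × ℂ} (hx : x ∈ modelDom) :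
    HasSum (fun n : ℤ => n * ‖thetaMonomial n x‖ ^ 2) (moment x * ‖thetaMap x‖ ^ 2) := by
  let _ : InnerProductSpace ℝ EllTwo := InnerProductSpace.complexToReal
  have hd := ((contDiffAt_thetaMap hx).differentiableAt (by simp))
  have h1 : HasDerivAt (fun s => thetaMap (hyperFlow s x))
      (fderiv ℂ thetaMap x (hyperField x)) 0 := by
    have h : HasFDerivAt thetaMap ((fderiv ℂ thetaMap x).restrictScalars ℝ) (hyperFlow 0 x) := by
      rw [hyperFlow_zero]
      exact hd.hasFDerivAt.restrictScalars ℝ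
    have h' := hasDerivAt_hyperFlow x 0
    rw [hyperFlow_zero] at h'
    exact h.comp_hasDerivAt 0 h'
  have h2 := h1.norm_sq
  have h3 := hasDerivAt_kahlerPotential hx
  have hN : ‖thetaMap x‖ ^ 2 ≠ 0 := by
    have := one_le_norm_sq_thetaMap hx
    positivity
  have h4 := (h2.log (by simpa using hN)).unique h3
  simp only [hyperFlow_zero] at h4
  have h5 : (inner ℂ (thetaMap x) (fderiv ℂ thetaMap x (hyperField x))).re =
      moment x * ‖thetaMap x‖ ^ 2 := by
    rw [div_eq_iff hN] at h4
    have : (inner ℂ (thetaMap x) (fderiv ℂ thetaMap x (hyperField x))).re =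
      inner ℝ (thetaMap x) (fderiv ℂ thetaMap x (hyperField x)) := rfl
    rw [this]
    linarith
  rw [← h5]
  refine (Complex.hasSum_re (lp.hasSum_inner _ _)).congr_fun fun n => ?_
  have h6 : fderiv ℂ (thetaMonomial n) x (hyperField x) = n * thetaMonomial n x := by
    have a1 := ((hasFDerivAt_fst (𝕜 := ℂ) (p := x)).pow (triExp n)).mul
      ((hasFDerivAt_snd (𝕜 := ℂ) (p := x)).pow (triExp (n - 1)))
    have a2 : fderiv ℂ (thetaMonomial n) x = _ := a1.fderiv
    have a3 : (n : ℂ) = triExp n - triExp (n - 1) := by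
      have := triExp_eq n
      have h : (n : ℤ) = triExp n - triExp (n - 1) := by linarith
      exact_mod_cast congrArg (Int.cast : ℤ → ℂ) h
    have a4 : ∀ (k : ℕ) (z : ℂ), (k : ℂ) * z ^ (k - 1) * z = k * z ^ k := by
      intro k z
      cases k with
      | zero => simp
      | succ k => simp; ring
    rw [a2]
    simp only [add_apply, smul_apply, nsmul_eq_mul, smul_eq_mul,
      ContinuousLinearMap.coe_fst', ContinuousLinearMap.coe_snd', hyperField_apply]
    rw [a3]
    unfold thetaMonomial
    linear_combination (x.2 ^ triExp (n - 1)) * a4 (triExp n) x.1 -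
      (x.1 ^ triExp n) * a4 (triExp (n - 1)) x.2
  rw [fderiv_thetaMap_apply hx, h6, thetaMap_apply hx]
  simp [Complex.mul_conj, mul_assoc]
  left
  rw [← Complex.normSq_eq_norm_sq, Complex.normSq_apply]

/-! ### The sign and the special values of the moment map -/

theorem norm_thetaMonomial_neg_le {x : ℂ × ℂ} (h : ‖x.2‖ ≤ ‖x.1‖) {n : ℤ} (hn : 0 ≤ n) :
    ‖thetaMonomial (-n) x‖ ≤ ‖thetaMonomial n x‖ := by
  obtain ⟨k, rfl⟩ := Int.eq_ofNat_of_zero_le hn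
  rw [← thetaMonomial_swap, thetaMonomial_of_pos, thetaMonomial_of_pos]
  simp only [Prod.fst_swap, Prod.snd_swap, norm_mul, norm_pow, mul_comm ‖x.2‖ ‖x.1‖]
  gcongr

/-- For `|v| ≤ |u|` all terms of the series `∑ n (|fₙ|² - |f₋ₙ|²)` are nonnegative; the bound is the
contribution of `n = 1, -1`. -/
theorem norm_sq_sub_le_moment_mul {x : ℂ × ℂ} (hx : x ∈ modelDom) (h : ‖x.2‖ ≤ ‖x.1‖) :
    ‖x.1‖ ^ 2 - ‖x.2‖ ^ 2 ≤ moment x * ‖thetaMap x‖ ^ 2 := by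
  have h1 := hasSum_moment hx
  have h2 := h1.add ((Equiv.neg ℤ).hasSum_iff.2 h1)
  have h3 := sum_le_hasSum {1, -1} (fun n _ => ?_) h2
  · rw [Finset.sum_pair (by norm_num)] at h3
    simp at h3
    linarith
  · have e : ∀ n : ℤ, ((Equiv.neg ℤ) n : ℤ) = -n := fun n => rfl
    simp only [Function.comp_apply, e, Int.cast_neg]
    have : 0 ≤ (n : ℝ) * (‖thetaMonomial n x‖ ^ 2 - ‖thetaMonomial (-n) x‖ ^ 2) := by
      rcases le_total 0 n with hn | hn
      · refine mul_nonneg (by exact_mod_cast hn) (sub_nonneg.2 ?_)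
        exact pow_le_pow_left₀ (norm_nonneg _) (norm_thetaMonomial_neg_le h hn) 2
      · refine mul_nonneg_of_nonpos_of_nonpos (by exact_mod_cast hn) (sub_nonpos.2 ?_)
        have := norm_thetaMonomial_neg_le h (neg_nonneg.2 hn)
        rw [neg_neg] at this
        exact pow_le_pow_left₀ (norm_nonneg _) this 2
    linarith

theorem moment_nonneg {x : ℂ × ℂ} (hx : x ∈ modelDom) (h : ‖x.2‖ ≤ ‖x.1‖) : 0 ≤ moment x := by
  have h1 := norm_sq_sub_le_moment_mul hx h
  have h2 := one_le_norm_sq_thetaMap hx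
  have h3 : ‖x.2‖ ^ 2 ≤ ‖x.1‖ ^ 2 := by gcongr
  by_contra h4
  nlinarith

theorem moment_pos {x : ℂ × ℂ} (hx : x ∈ modelDom) (h : ‖x.2‖ < ‖x.1‖) : 0 < moment x := by
  have h1 := norm_sq_sub_le_moment_mul hx h.le
  have h2 := one_le_norm_sq_thetaMap hx
  have h3 : ‖x.2‖ ^ 2 < ‖x.1‖ ^ 2 := by gcongr
  by_contra h4
  nlinarith

theorem moment_nonpos {x : ℂ × ℂ} (hx : x ∈ modelDom) (h : ‖x.1‖ ≤ ‖x.2‖) : moment x ≤ 0 := by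
  have := moment_nonneg (swap_mem hx) h
  rw [moment_swap hx] at this
  linarith

theorem moment_neg {x : ℂ × ℂ} (hx : x ∈ modelDom) (h : ‖x.1‖ < ‖x.2‖) : moment x < 0 := by
  have := moment_pos (swap_mem hx) h
  rw [moment_swap hx] at this
  linarith

theorem moment_pos_iff {x : ℂ × ℂ} (hx : x ∈ modelDom) : 0 < moment x ↔ ‖x.2‖ < ‖x.1‖ :=
  ⟨fun h => not_le.1 fun h' => h.not_ge (moment_nonpos hx h'), moment_pos hx⟩

theorem moment_neg_iff {x : ℂ × ℂ} (hx : x ∈ modelDom) : moment x < 0 ↔ ‖x.1‖ < ‖x.2‖ :=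
  ⟨fun h => not_le.1 fun h' => h.not_ge (moment_nonneg hx h'), moment_neg hx⟩

theorem moment_zero : moment 0 = 0 :=
  le_antisymm (moment_nonpos zero_mem_modelDom (by simp))
    (moment_nonneg zero_mem_modelDom (by simp))

theorem mk_zero_mem (u : ℂ) : ((u, 0) : ℂ × ℂ) ∈ modelDom := by simp [modelDom]

theorem zero_mk_mem (v : ℂ) : ((0, v) : ℂ × ℂ) ∈ modelDom := by simp [modelDom]

theorem moment_mk_zero (u : ℂ) : moment (u, 0) = ‖u‖ ^ 2 / (1 + ‖u‖ ^ 2) := by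
  have h0 : ∀ n : ℤ, n ∉ ({0, 1} : Finset ℤ) → thetaMonomial n (u, 0) = 0 := by
    intro n hn
    simp only [Finset.mem_insert, Finset.mem_singleton, not_or] at hn
    have h1 : triExp (n - 1) ≠ 0 := by
      intro h
      have := two_mul_triExp (n - 1)
      rw [h] at this
      simp at this
      omega
    simp [thetaMonomial, h1]
  have h1 := (hasSum_norm_sq_thetaMonomial (mk_zero_mem u)).unique
    (hasSum_sum_of_ne_finset_zero fun n hn => by rw [h0 n hn]; simp)
  have h2 := (hasSum_moment (mk_zero_mem u)).unique
    (hasSum_sum_of_ne_finset_zero fun n hn => by rw [h0 n hn]; simp)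
  rw [Finset.sum_pair (by norm_num)] at h1 h2
  simp at h1 h2
  rw [h1] at h2
  rw [eq_div_iff (by positivity), h2]

theorem moment_zero_mk (v : ℂ) : moment (0, v) = -(‖v‖ ^ 2 / (1 + ‖v‖ ^ 2)) := by
  rw [← moment_mk_zero, ← moment_swap (mk_zero_mem v)]
  rfl

/-! ### The angle coordinate -/

/-- The factor `1 / √(1 - |uv|²)`. -/
def diskFactor (x : ℂ × ℂ) : ℝ := 1 / √(1 - ‖x.1 * x.2‖ ^ 2)

theorem one_sub_pos {x : ℂ × ℂ} (hx : x ∈ modelDom) : 0 < 1 - ‖x.1 * x.2‖ ^ 2 := by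
  have : ‖x.1 * x.2‖ < 1 := hx
  nlinarith [norm_nonneg (x.1 * x.2)]

theorem diskFactor_pos {x : ℂ × ℂ} (hx : x ∈ modelDom) : 0 < diskFactor x := by
  have := one_sub_pos hx
  unfold diskFactor
  positivity

theorem diskFactor_eq {x y : ℂ × ℂ} (h : x.1 * x.2 = y.1 * y.2) :
    diskFactor x = diskFactor y := by
  unfold diskFactor
  rw [h]

theorem contDiff_norm_sq_fst : ContDiff ℝ ∞ fun x : ℂ × ℂ => ‖x.1‖ ^ 2 :=
  (contDiff_norm_sq ℝ).comp (contDiff_fst (𝕜 := ℝ) (E := ℂ) (F := ℂ))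

theorem contDiff_norm_sq_snd : ContDiff ℝ ∞ fun x : ℂ × ℂ => ‖x.2‖ ^ 2 :=
  (contDiff_norm_sq ℝ).comp (contDiff_snd (𝕜 := ℝ) (E := ℂ) (F := ℂ))

theorem contDiffAt_diskFactor {x : ℂ × ℂ} (hx : x ∈ modelDom) : ContDiffAt ℝ ∞ diskFactor x := by
  have h : ContDiff ℝ ∞ fun x : ℂ × ℂ => 1 - ‖x.1 * x.2‖ ^ 2 := by
    simp only [norm_mul, mul_pow]
    exact contDiff_const.sub (contDiff_norm_sq_fst.mul contDiff_norm_sq_snd)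
  exact contDiffAt_const.div (h.contDiffAt.sqrt (one_sub_pos hx).ne')
    (Real.sqrt_pos.2 (one_sub_pos hx)).ne'

theorem norm_hyperFlow_fst (s : ℝ) (x : ℂ × ℂ) :
    ‖(hyperFlow s x).1‖ ^ 2 = Real.exp (2 * s) * ‖x.1‖ ^ 2 := by
  simp only [hyperFlow, norm_mul, Complex.norm_real, Real.norm_eq_abs, Real.abs_exp, mul_pow]
  rw [← Real.exp_nat_mul]
  simp

theorem norm_hyperFlow_snd (s : ℝ) (x : ℂ × ℂ) :
    ‖(hyperFlow s x).2‖ ^ 2 = Real.exp (-(2 * s)) * ‖x.2‖ ^ 2 := by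
  simp only [hyperFlow, norm_mul, Complex.norm_real, Real.norm_eq_abs, Real.abs_exp, mul_pow]
  rw [← Real.exp_nat_mul]
  simp

theorem hasDerivAt_norm_hyperFlow_fst (x : ℂ × ℂ) :
    HasDerivAt (fun s => ‖(hyperFlow s x).1‖ ^ 2) (2 * ‖x.1‖ ^ 2) 0 := by
  simp only [norm_hyperFlow_fst]
  have := (((hasDerivAt_id (0 : ℝ)).const_mul 2).exp).mul_const (‖x.1‖ ^ 2)
  simpa using this

theorem hasDerivAt_norm_hyperFlow_snd (x : ℂ × ℂ) :
    HasDerivAt (fun s => ‖(hyperFlow s x).2‖ ^ 2) (-(2 * ‖x.2‖ ^ 2)) 0 := by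
  simp only [norm_hyperFlow_snd]
  have := (((hasDerivAt_id (0 : ℝ)).const_mul 2).neg.exp).mul_const (‖x.2‖ ^ 2)
  simpa using this

/-- The argument of the arcsine in the normal form of the angle near the node. -/
def nodeSine (x : ℂ × ℂ) : ℝ := diskFactor x * (‖x.1‖ ^ 2 - ‖x.2‖ ^ 2) / 8

theorem contDiffAt_nodeSine {x : ℂ × ℂ} (hx : x ∈ modelDom) : ContDiffAt ℝ ∞ nodeSine x :=
  ((contDiffAt_diskFactor hx).mul
    (contDiff_norm_sq_fst.sub contDiff_norm_sq_snd).contDiffAt).div_const 8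

theorem diskFactor_lt {x : ℂ × ℂ} (h : ‖x.1‖ ^ 2 + ‖x.2‖ ^ 2 < 1) : diskFactor x < 6 / 5 := by
  have h1 : ‖x.1 * x.2‖ ^ 2 < 1 / 4 := by
    rw [norm_mul, mul_pow]
    nlinarith [sq_nonneg (‖x.1‖ ^ 2 - ‖x.2‖ ^ 2), sq_nonneg ‖x.1‖, sq_nonneg ‖x.2‖]
  have h2 : 5 / 6 < √(1 - ‖x.1 * x.2‖ ^ 2) := Real.lt_sqrt_of_sq_lt (by linarith)
  unfold diskFactor
  rw [div_lt_iff₀ (by linarith)]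
  linarith

theorem mem_of_add_lt {x : ℂ × ℂ} (h : ‖x.1‖ ^ 2 + ‖x.2‖ ^ 2 < 1) : x ∈ modelDom := by
  change ‖x.1 * x.2‖ < 1
  rw [norm_mul]
  nlinarith [sq_nonneg (‖x.1‖ - ‖x.2‖), sq_nonneg ‖x.1‖, sq_nonneg ‖x.2‖]

theorem abs_nodeSine_lt {x : ℂ × ℂ} (h : ‖x.1‖ ^ 2 + ‖x.2‖ ^ 2 < 1) : |nodeSine x| < 1 := by
  have h1 := diskFactor_lt h
  have h2 := diskFactor_pos (mem_of_add_lt h)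
  unfold nodeSine
  rw [abs_lt]
  constructor <;> nlinarith [sq_nonneg ‖x.1‖, sq_nonneg ‖x.2‖]

theorem two_mul_arcsin_le {y : ℝ} (h0 : 0 ≤ y) (h1 : y ≤ 1) : 2 * Real.arcsin y ≤ Real.pi * y := by
  have h := Real.mul_le_sin (Real.arcsin_nonneg.2 h0) (Real.arcsin_le_pi_div_two y)
  rw [Real.sin_arcsin (by linarith) h1] at h
  have hp := Real.pi_pos
  rw [div_mul_eq_mul_div, div_le_iff₀ hp] at h
  linarith

/-- A smooth function `θ`, monotone in the moment map along the flow `(e^s u, e^{-s} v)`, which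
equals `2 π t` away from the node and satisfies `8 sin (θ / 2) = (|u|² - |v|²) / √(1 - |uv|²)`
near it. -/
theorem exists_angle : ∃ θ : ℂ × ℂ → ℝ,
    (∀ x ∈ modelDom, ContDiffAt ℝ ∞ θ x) ∧
    (∀ x ∈ modelDom, x ≠ 0 → 0 < fderiv ℝ θ x (hyperField x)) ∧
    (∀ c : ℂ, ‖c‖ = 1 → ∀ x ∈ modelDom, θ (rotMap c x) = θ x) ∧
    (∀ x ∈ modelDom, θ x.swap = -θ x) ∧
    (∀ x ∈ modelDom, 0 < moment x → 0 < θ x ∧ θ x ≤ 2 * Real.pi * moment x) ∧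
    (∀ x ∈ modelDom, 1 / 6 ≤ |moment x| → θ x = 2 * Real.pi * moment x) ∧
    ∀ᶠ x in 𝓝 (0 : ℂ × ℂ), Real.sin (θ x / 2) = nodeSine x := by
  -- The angle `2 π t` is interpolated with the normal form `w = 2 arcsin` on the ball of squared
  -- radius `ε`. There `|t| < 1/6`, and the bound on the theta map ensures `w ≤ 2 π t` for
  -- `|v| ≤ |u|`.
  have hpi := Real.pi_pos
  obtain ⟨ε, hε, hε1, hF, ht⟩ : ∃ ε : ℝ, 0 < ε ∧ ε ≤ 1 ∧
      (∀ x : ℂ × ℂ, ‖x.1‖ ^ 2 + ‖x.2‖ ^ 2 < ε → ‖thetaMap x‖ ^ 2 < 3) ∧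
      ∀ x : ℂ × ℂ, ‖x.1‖ ^ 2 + ‖x.2‖ ^ 2 < ε → |moment x| < 1 / 6 := by
    have c1 : ContinuousAt (fun x => ‖thetaMap x‖ ^ 2) (0 : ℂ × ℂ) :=
      (contDiffAt_thetaMap zero_mem_modelDom).continuousAt.norm.pow 2
    have c2 : ContinuousAt (fun x => |moment x|) (0 : ℂ × ℂ) :=
      (contDiffAt_moment zero_mem_modelDom).continuousAt.abs
    have e1 : ‖thetaMap 0‖ ^ 2 = 1 := by
      refine (hasSum_norm_sq_thetaMonomial zero_mem_modelDom).unique ?_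
      have := hasSum_single (f := fun n : ℤ => ‖thetaMonomial n 0‖ ^ 2) 0 fun n hn => by
        have : triExp n ≠ 0 ∨ triExp (n - 1) ≠ 0 := by
          have := triExp_eq n
          omega
        simp [thetaMonomial, zero_pow_eq]
        tauto
      simpa using this
    have h1 := c1.eventually_lt (continuousAt_const (y := (3 : ℝ))) (by simp only [e1]; norm_num)
    have h2 := c2.eventually_lt (continuousAt_const (y := (1 / 6 : ℝ)))
      (by simp only [moment_zero]; norm_num)
    obtain ⟨δ, hδ, hb⟩ := Metric.eventually_nhds_iff.1 (h1.and h2)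
    have key : ∀ x : ℂ × ℂ, ‖x.1‖ ^ 2 + ‖x.2‖ ^ 2 < min (δ ^ 2) 1 → dist x 0 < δ := by
      intro x hx
      have hx := lt_of_lt_of_le hx (min_le_left _ _)
      rw [dist_zero_right, Prod.norm_def, max_lt_iff]
      constructor <;> refine lt_of_pow_lt_pow_left₀ 2 hδ.le ?_ <;>
        nlinarith [norm_nonneg x.1, norm_nonneg x.2]
    exact ⟨min (δ ^ 2) 1, by positivity, min_le_right _ _, fun x hx => (hb (key x hx)).1,
      fun x hx => (hb (key x hx)).2⟩
  let R : ℂ × ℂ → ℝ := fun x => ‖x.1‖ ^ 2 + ‖x.2‖ ^ 2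
  let χ : ℝ → ℝ := fun r => Real.smoothTransition (2 - 4 * r / ε)
  let w : ℂ × ℂ → ℝ := fun x => 2 * Real.arcsin (nodeSine x)
  let T : ℂ × ℂ → ℝ := fun x => 2 * Real.pi * moment x
  let θ : ℂ × ℂ → ℝ := fun x => T x + χ (R x) * (w x - T x)
  have hχ0 : ∀ r, ε / 2 ≤ r → χ r = 0 := by
    intro r hr
    refine Real.smoothTransition.zero_of_nonpos ?_
    have : 2 ≤ 4 * r / ε := by rw [le_div_iff₀ hε]; linarith
    linarith
  have hχ1 : ∀ r, r ≤ ε / 4 → χ r = 1 := by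
    intro r hr
    refine Real.smoothTransition.one_of_one_le ?_
    have : 4 * r / ε ≤ 1 := by rw [div_le_iff₀ hε]; linarith
    linarith
  have hχs : ContDiff ℝ ∞ χ :=
    Real.smoothTransition.contDiff.comp
      (contDiff_const.sub ((contDiff_const.mul contDiff_id).div_const ε))
  have hχm : ∀ r, deriv χ r ≤ 0 := by
    intro r
    have hanti : Antitone χ := fun a b hab => by
      refine Real.smoothTransition.monotone ?_
      gcongr
    exact hanti.deriv_nonpos
  have hRs : ContDiff ℝ ∞ R := contDiff_norm_sq_fst.add contDiff_norm_sq_snd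
  have hTs : ∀ x ∈ modelDom, ContDiffAt ℝ ∞ T x := fun x hx =>
    contDiffAt_const.mul (contDiffAt_moment hx)
  have hws : ∀ x, R x < ε → ContDiffAt ℝ ∞ w x := fun x hx => by
    have h1 : R x < 1 := hx.trans_le hε1
    have h2 := abs_lt.1 (abs_nodeSine_lt h1)
    exact contDiffAt_const.mul ((Real.contDiffAt_arcsin h2.1.ne' h2.2.ne).comp x
      (contDiffAt_nodeSine (mem_of_add_lt h1)))
  have hwT : ∀ x, R x < ε → ‖x.2‖ ≤ ‖x.1‖ → w x ≤ T x := fun x hx h => by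
    have h1 : R x < 1 := hx.trans_le hε1
    have hm := mem_of_add_lt h1
    have h3 : ‖x.2‖ ^ 2 ≤ ‖x.1‖ ^ 2 := by gcongr
    have h4 := diskFactor_pos hm
    have h5 := diskFactor_lt h1
    have h6 : 0 ≤ nodeSine x := by
      unfold nodeSine
      have := mul_nonneg h4.le (sub_nonneg.2 h3)
      linarith
    have h7 := two_mul_arcsin_le h6 (abs_lt.1 (abs_nodeSine_lt h1)).2.le
    have h8 := norm_sq_sub_le_moment_mul hm h
    have h9 := hF x hx
    have h10 := moment_nonneg hm h
    have h11 : nodeSine x ≤ 2 * moment x := by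
      unfold nodeSine
      nlinarith
    calc w x ≤ Real.pi * nodeSine x := h7
      _ ≤ Real.pi * (2 * moment x) := by gcongr
      _ = T x := by simp only [T]; ring
  have hw0 : ∀ x ∈ modelDom, ‖x.2‖ < ‖x.1‖ → 0 < w x := fun x hx h => by
    have h4 := diskFactor_pos hx
    have h3 : ‖x.2‖ ^ 2 < ‖x.1‖ ^ 2 := by gcongr
    have h6 : 0 < nodeSine x := by
      unfold nodeSine
      have := mul_pos h4 (sub_pos.2 h3)
      linarith
    have := Real.arcsin_pos.2 h6
    simp only [w]
    positivity
  have hws' : ∀ x : ℂ × ℂ, w x.swap = -w x := fun x => by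
    have e : nodeSine x.swap = -nodeSine x := by
      unfold nodeSine
      rw [diskFactor_eq (x := x.swap) (y := x) (mul_comm _ _)]
      simp only [Prod.fst_swap, Prod.snd_swap]
      ring
    simp only [w, e, Real.arcsin_neg]
    ring
  have hTs' : ∀ x ∈ modelDom, T x.swap = -T x := fun x hx => by
    simp only [T, moment_swap hx]
    ring
  have hRs' : ∀ x : ℂ × ℂ, R x.swap = R x := fun x => add_comm _ _
  have hθ0 : ∀ x, ε / 2 ≤ R x → θ x = T x := fun x hx => by
    simp only [θ, hχ0 _ hx]
    ring
  refine ⟨θ, ?_, ?_, ?_, ?_, ?_, ?_, ?_⟩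
  · intro x hx
    rcases lt_or_ge (R x) ε with h | h
    · exact (hTs x hx).add (((hχs.comp hRs).contDiffAt).mul ((hws x h).sub (hTs x hx)))
    · refine (hTs x hx).congr_of_eventuallyEq ?_
      have := (hRs.continuous.tendsto x).eventually
          (lt_mem_nhds (show ε / 2 < R x by linarith))
      filter_upwards [this] with y hy using hθ0 y (le_of_lt hy)
  · intro x hx h0
    have hT' : HasDerivAt (fun s => T (hyperFlow s x))
        (2 * Real.pi * fderiv ℝ moment x (hyperField x)) 0 :=
      (hasDerivAt_comp_hyperFlow_zero
        ((contDiffAt_moment hx).differentiableAt (by simp))).const_mul _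
    have hTp : 0 < 2 * Real.pi * fderiv ℝ moment x (hyperField x) :=
      mul_pos (by positivity) (fderiv_moment_pos hx h0)
    rcases lt_or_ge (R x) ε with h | h
    · have h1 : R x < 1 := h.trans_le hε1
      have h2 := abs_lt.1 (abs_nodeSine_lt h1)
      have hθs : ContDiffAt ℝ ∞ θ x :=
        (hTs x hx).add (((hχs.comp hRs).contDiffAt).mul ((hws x h).sub (hTs x hx)))
      have hR' : HasDerivAt (fun s => R (hyperFlow s x)) (2 * ‖x.1‖ ^ 2 + -(2 * ‖x.2‖ ^ 2)) 0 :=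
        (hasDerivAt_norm_hyperFlow_fst x).add (hasDerivAt_norm_hyperFlow_snd x)
      have hχ' : HasDerivAt (fun s => χ (R (hyperFlow s x)))
          (deriv χ (R x) * (2 * ‖x.1‖ ^ 2 + -(2 * ‖x.2‖ ^ 2))) 0 := by
        have : HasDerivAt χ (deriv χ (R x)) (R (hyperFlow 0 x)) := by
          rw [hyperFlow_zero]
          exact (hχs.differentiable (by simp) _).hasDerivAt
        exact this.comp 0 hR'
      have hn' : HasDerivAt (fun s => nodeSine (hyperFlow s x))
          (diskFactor x * (2 * ‖x.1‖ ^ 2 - -(2 * ‖x.2‖ ^ 2)) / 8) 0 := by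
        have : (fun s => nodeSine (hyperFlow s x)) = fun s => diskFactor x *
            (‖(hyperFlow s x).1‖ ^ 2 - ‖(hyperFlow s x).2‖ ^ 2) / 8 := by
          ext s
          unfold nodeSine
          rw [diskFactor_eq (hyperFlow_mul s x)]
        rw [this]
        exact (((hasDerivAt_norm_hyperFlow_fst x).sub
          (hasDerivAt_norm_hyperFlow_snd x)).const_mul _).div_const 8
      have hw' : HasDerivAt (fun s => w (hyperFlow s x)) (2 * (1 / √(1 - nodeSine x ^ 2) *
          (diskFactor x * (2 * ‖x.1‖ ^ 2 - -(2 * ‖x.2‖ ^ 2)) / 8))) 0 := by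
        have : HasDerivAt Real.arcsin (1 / √(1 - nodeSine x ^ 2)) (nodeSine (hyperFlow 0 x)) := by
          rw [hyperFlow_zero]
          exact Real.hasDerivAt_arcsin h2.1.ne' h2.2.ne
        exact (this.comp 0 hn').const_mul 2
      have hwp : 0 < 2 * (1 / √(1 - nodeSine x ^ 2) *
          (diskFactor x * (2 * ‖x.1‖ ^ 2 - -(2 * ‖x.2‖ ^ 2)) / 8)) := by
        have a1 : 0 < 1 - nodeSine x ^ 2 := by nlinarith
        have a2 := diskFactor_pos hx
        have a3 : 0 < 2 * ‖x.1‖ ^ 2 - -(2 * ‖x.2‖ ^ 2) := by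
          have : 0 < ‖x.1‖ ∨ 0 < ‖x.2‖ := by
            rw [norm_pos_iff, norm_pos_iff]
            by_contra hc
            push Not at hc
            exact h0 (Prod.ext hc.1 hc.2)
          rcases this with h | h <;> nlinarith [sq_nonneg ‖x.1‖, sq_nonneg ‖x.2‖]
        positivity
      have hθ' := hT'.add (hχ'.mul (hw'.sub hT'))
      have e := (hasDerivAt_comp_hyperFlow_zero (hθs.differentiableAt (by simp))).unique hθ'
      rw [e]
      simp only [hyperFlow_zero, Pi.sub_apply]
      have b1 : 0 ≤ χ (R x) := Real.smoothTransition.nonneg _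
      have b2 : χ (R x) ≤ 1 := Real.smoothTransition.le_one _
      -- The cutoff contributes with the right sign: along the flow, `R` has derivative
      -- `2 (|u|² - |v|²)`, whose sign is opposite to that of `w - T`, and `χ` is decreasing.
      have b3 : 0 ≤ deriv χ (R x) * (2 * ‖x.1‖ ^ 2 + -(2 * ‖x.2‖ ^ 2)) * (w x - T x) := by
        rw [mul_assoc]
        refine mul_nonneg_of_nonpos_of_nonpos (hχm _) ?_
        rcases le_total ‖x.2‖ ‖x.1‖ with h3 | h3
        · refine mul_nonpos_of_nonneg_of_nonpos ?_ (sub_nonpos.2 (hwT x h h3))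
          have : ‖x.2‖ ^ 2 ≤ ‖x.1‖ ^ 2 := by gcongr
          linarith
        · refine mul_nonpos_of_nonpos_of_nonneg ?_ ?_
          · have : ‖x.1‖ ^ 2 ≤ ‖x.2‖ ^ 2 := by gcongr
            linarith
          · have := hwT x.swap ((hRs' x).trans_lt h) h3
            rw [hws', hTs' x hx] at this
            linarith
      generalize 2 * Real.pi * fderiv ℝ moment x (hyperField x) = T' at *
      generalize 2 * (1 / √(1 - nodeSine x ^ 2) *
          (diskFactor x * (2 * ‖x.1‖ ^ 2 - -(2 * ‖x.2‖ ^ 2)) / 8)) = w' at *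
      have b4 : 0 < (1 - χ (R x)) * T' + χ (R x) * w' := by
        rcases eq_or_lt_of_le b1 with h4 | h4
        · rw [← h4]; linarith
        · have := mul_pos h4 hwp
          have := mul_nonneg (sub_nonneg.2 b2) hTp.le
          linarith
      linarith
    · have h3 : θ =ᶠ[𝓝 x] T := by
        have := (hRs.continuous.tendsto x).eventually
          (lt_mem_nhds (show ε / 2 < R x by linarith))
        filter_upwards [this] with y hy using hθ0 y (le_of_lt hy)
      rw [h3.fderiv_eq]
      have := (hasDerivAt_comp_hyperFlow_zero ((hTs x hx).differentiableAt (by simp))).unique hT'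
      rw [this]
      exact hTp
  · intro c hc x hx
    have e1 : R (rotMap c x) = R x := by simp [R, rotMap, hc]
    have e2 : w (rotMap c x) = w x := by
      simp only [w, nodeSine]
      rw [diskFactor_eq (rotMap_mul hc x)]
      simp [rotMap, hc]
    simp only [θ, T, e1, e2, moment_rotMap hc hx]
  · intro x hx
    simp only [θ, hws', hTs' x hx, hRs']
    ring
  · intro x hx h
    have h1 := (moment_pos_iff hx).1 h
    have hT0 : 0 < T x := mul_pos (by positivity) h
    rcases lt_or_ge (R x) ε with h2 | h2
    · have b1 : 0 ≤ χ (R x) := Real.smoothTransition.nonneg _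
      have b2 : χ (R x) ≤ 1 := Real.smoothTransition.le_one _
      have b3 := hwT x h2 h1.le
      have b4 := hw0 x hx h1
      refine ⟨?_, ?_⟩
      · have b5 := mul_nonneg (sub_nonneg.2 b2) (sub_nonneg.2 b3)
        have : θ x = w x + (1 - χ (R x)) * (T x - w x) := by simp only [θ]; ring
        linarith
      · have b5 := mul_nonneg b1 (sub_nonneg.2 b3)
        have : θ x = T x - χ (R x) * (T x - w x) := by simp only [θ]; ring
        change θ x ≤ T x
        linarith
    · rw [hθ0 x (by linarith)]
      exact ⟨hT0, le_rfl⟩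
  · intro x hx h
    refine hθ0 x ?_
    by_contra hc
    exact (ht x (by simp only [R] at hc; linarith)).not_ge h
  · have h0 : R 0 < ε / 4 := by
      have : R 0 = 0 := by simp [R]
      rw [this]
      positivity
    have h1 := (hRs.continuous.tendsto 0).eventually (gt_mem_nhds h0)
    filter_upwards [h1] with x hx
    have h2 : R x < 1 := by linarith
    have h3 := abs_lt.1 (abs_nodeSine_lt h2)
    have : θ x / 2 = Real.arcsin (nodeSine x) := by
      simp only [θ, hχ1 _ hx.le, w]
      ring
    rw [this, Real.sin_arcsin h3.1.le h3.2.le]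

open scoped ComplexConjugate

/-- The angle coordinate of the local model, a deformation of `2 π t`. -/
def angle : ℂ × ℂ → ℝ := exists_angle.choose

theorem contDiffAt_angle {x : ℂ × ℂ} (hx : x ∈ modelDom) : ContDiffAt ℝ ∞ angle x :=
  exists_angle.choose_spec.1 x hx

theorem fderiv_angle_pos {x : ℂ × ℂ} (hx : x ∈ modelDom) (h : x ≠ 0) :
    0 < fderiv ℝ angle x (hyperField x) :=
  exists_angle.choose_spec.2.1 x hx h

theorem angle_rotMap {c : ℂ} (hc : ‖c‖ = 1) {x : ℂ × ℂ} (hx : x ∈ modelDom) :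
    angle (rotMap c x) = angle x :=
  exists_angle.choose_spec.2.2.1 c hc x hx

theorem angle_swap {x : ℂ × ℂ} (hx : x ∈ modelDom) : angle x.swap = -angle x :=
  exists_angle.choose_spec.2.2.2.1 x hx

theorem angle_pos {x : ℂ × ℂ} (hx : x ∈ modelDom) (h : 0 < moment x) :
    0 < angle x ∧ angle x ≤ 2 * Real.pi * moment x :=
  exists_angle.choose_spec.2.2.2.2.1 x hx h

theorem angle_neg {x : ℂ × ℂ} (hx : x ∈ modelDom) (h : moment x < 0) :
    angle x < 0 ∧ 2 * Real.pi * moment x ≤ angle x := by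
  have h1 := angle_pos (swap_mem hx) (by rw [moment_swap hx]; linarith)
  rw [angle_swap hx, moment_swap hx] at h1
  constructor <;> linarith

theorem angle_of_le {x : ℂ × ℂ} (hx : x ∈ modelDom) (h : 1 / 6 ≤ |moment x|) :
    angle x = 2 * Real.pi * moment x :=
  exists_angle.choose_spec.2.2.2.2.2.1 x hx h

theorem eventually_sin_angle :
    ∀ᶠ x in 𝓝 (0 : ℂ × ℂ), Real.sin (angle x / 2) = nodeSine x :=
  exists_angle.choose_spec.2.2.2.2.2.2

theorem angle_eq_zero {x : ℂ × ℂ} (hx : x ∈ modelDom) (h : moment x = 0) : angle x = 0 := by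
  have hn : ‖x.1‖ = ‖x.2‖ :=
    le_antisymm (not_lt.1 fun h' => (moment_pos hx h').ne' h)
      (not_lt.1 fun h' => (moment_neg hx h').ne h)
  -- The reflection of `x` is a rotation of `x`, and it changes the sign of the angle.
  by_cases h0 : x.1 = 0
  · have h1 : x.2 = 0 := by rw [h0, norm_zero] at hn; exact norm_eq_zero.1 hn.symm
    have h2 := angle_swap hx
    have : x.swap = x := by ext <;> simp [h0, h1]
    rw [this] at h2
    linarith
  · have hc : ‖x.2 / x.1‖ = 1 := by rw [norm_div, hn, div_self]; simpa [← hn] using h0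
    have h2 := angle_rotMap hc hx
    have h3 : rotMap (x.2 / x.1) x = x.swap := by
      have h4 := rotMap_mul hc x
      have e1 : (rotMap (x.2 / x.1) x).1 = x.2 := by simp [rotMap, h0]
      refine Prod.ext e1 ?_
      have h5 : x.2 ≠ 0 := by rw [← norm_pos_iff, ← hn]; exact norm_pos_iff.2 h0
      rw [e1, mul_comm x.1] at h4
      exact mul_left_cancel₀ h5 h4
    rw [h3, angle_swap hx] at h2
    linarith

/-! ### The torus coordinate of the local model -/

/-- The coordinate `uv / √(1 - |uv|²)` identifying the disk with the plane. -/
def diskCoord (x : ℂ × ℂ) : ℂ := diskFactor x * (x.1 * x.2)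

theorem norm_sq_diskCoord (x : ℂ × ℂ) :
    ‖diskCoord x‖ ^ 2 = diskFactor x ^ 2 * (‖x.1‖ ^ 2 * ‖x.2‖ ^ 2) := by
  simp [diskCoord, mul_pow]

theorem diskCoord_eq {x y : ℂ × ℂ} (h : x.1 * x.2 = y.1 * y.2) : diskCoord x = diskCoord y := by
  unfold diskCoord
  rw [diskFactor_eq h, h]

/-- The positive solution `r` of `2 (r - 1 / r) = b`. -/
def posRoot (b : ℝ) : ℝ := (b + √(b ^ 2 + 16)) / 4

theorem posRoot_pos (b : ℝ) : 0 < posRoot b := by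
  have : |b| < √(b ^ 2 + 16) := Real.lt_sqrt_of_sq_lt (by rw [sq_abs]; linarith)
  unfold posRoot
  linarith [neg_abs_le b]

theorem posRoot_sq (b : ℝ) : posRoot b ^ 2 = 1 + posRoot b * b / 2 := by
  have := Real.sq_sqrt (show 0 ≤ b ^ 2 + 16 by positivity)
  unfold posRoot
  linear_combination this / 16

theorem contDiff_posRoot : ContDiff ℝ ∞ posRoot := by
  have h : ContDiff ℝ ∞ fun b : ℝ => b ^ 2 + 16 := by fun_prop
  exact (contDiff_id.add (h.sqrt fun b => by positivity)).div_const 4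

/-- The modulus of the function `ω` with `Z = -ω²`. -/
def radius (x : ℂ × ℂ) : ℝ := posRoot (diskCoord x).im

theorem radius_pos (x : ℂ × ℂ) : 0 < radius x := posRoot_pos _

theorem radius_sq (x : ℂ × ℂ) : radius x ^ 2 = 1 + radius x * (diskCoord x).im / 2 :=
  posRoot_sq _

theorem radius_eq {x y : ℂ × ℂ} (h : x.1 * x.2 = y.1 * y.2) : radius x = radius y := by
  unfold radius
  rw [diskCoord_eq h]

/-- A square root `ω = r e^{iθ/2}` of `-Z`. -/
def omega (x : ℂ × ℂ) : ℂ := radius x * Complex.exp ((angle x / 2 : ℝ) * Complex.I)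

/-- The function `Z = -r² e^{iθ}` on the local model. -/
def zCoord (x : ℂ × ℂ) : ℂ := -(radius x ^ 2 * Complex.exp (angle x * Complex.I))

/-- The function `s = sin (θ / 2)`. -/
def sine (x : ℂ × ℂ) : ℝ := Real.sin (angle x / 2)

theorem zCoord_eq (x : ℂ × ℂ) : zCoord x = -omega x ^ 2 := by
  unfold zCoord omega
  rw [mul_pow, ← Complex.exp_nat_mul]
  push_cast
  congr 3
  ring

theorem norm_omega (x : ℂ × ℂ) : ‖omega x‖ = radius x := by
  unfold omega
  rw [norm_mul, Complex.norm_exp_ofReal_mul_I, Complex.norm_real, Real.norm_eq_abs,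
    abs_of_pos (radius_pos x), mul_one]

theorem norm_zCoord (x : ℂ × ℂ) : ‖zCoord x‖ = radius x ^ 2 := by
  rw [zCoord_eq, norm_neg, norm_pow, norm_omega]

theorem zCoord_ne_zero (x : ℂ × ℂ) : zCoord x ≠ 0 := by
  rw [← norm_pos_iff, norm_zCoord]
  exact pow_pos (radius_pos x) 2

theorem omega_im (x : ℂ × ℂ) : (omega x).im = radius x * sine x := by
  unfold omega sine
  rw [Complex.re_ofReal_mul |> fun _ => Complex.im_ofReal_mul, Complex.exp_ofReal_mul_I_im]

/-- The identity behind `X Y = 1 + Z`. -/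
theorem one_sub_omega_mul (x : ℂ × ℂ) :
    (1 - omega x) * (1 + conj (omega x)) =
      -Complex.I * radius x * (2 * sine x - Complex.I * (diskCoord x).im / 2) := by
  have h1 : omega x * conj (omega x) = ((radius x ^ 2 : ℝ) : ℂ) := by
    rw [Complex.mul_conj, Complex.normSq_eq_norm_sq, norm_omega]
  have h2 : omega x - conj (omega x) = 2 * (radius x * sine x : ℝ) * Complex.I := by
    rw [Complex.sub_conj, omega_im]
    push_cast
    ring
  rw [radius_sq] at h1
  push_cast at h1 h2
  linear_combination -h1 - h2 - (radius x * (diskCoord x).im / 2 : ℂ) * Complex.I_sq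

theorem norm_one_add_zCoord_sq (x : ℂ × ℂ) :
    ‖1 + zCoord x‖ ^ 2 = radius x ^ 2 * ((diskCoord x).im ^ 2 + 16 * sine x ^ 2) / 4 := by
  have h1 : ‖1 + zCoord x‖ = ‖(1 - omega x) * (1 + conj (omega x))‖ := by
    rw [zCoord_eq, norm_mul]
    have : ‖1 + conj (omega x)‖ = ‖1 + omega x‖ := by
      rw [← Complex.norm_conj (1 + omega x)]
      simp
    rw [this, ← norm_mul]
    congr 1
    ring
  rw [h1, one_sub_omega_mul, norm_mul, norm_mul, norm_neg, Complex.norm_I, Complex.norm_real,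
    mul_pow, one_mul, Real.norm_eq_abs, sq_abs, ← Complex.normSq_eq_norm_sq (2 * _ - _),
    Complex.normSq_apply]
  simp
  ring

theorem contDiffAt_ofReal {f : ℂ × ℂ → ℝ} {x : ℂ × ℂ} (h : ContDiffAt ℝ ∞ f x) :
    ContDiffAt ℝ ∞ (fun x => (f x : ℂ)) x :=
  Complex.ofRealCLM.contDiff.contDiffAt.comp x h

theorem contDiffAt_conj {f : ℂ × ℂ → ℂ} {x : ℂ × ℂ} (h : ContDiffAt ℝ ∞ f x) :
    ContDiffAt ℝ ∞ (fun x => conj (f x)) x :=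
  Complex.conjCLE.contDiff.contDiffAt.comp x h

theorem contDiffAt_fst_real (x : ℂ × ℂ) : ContDiffAt ℝ ∞ (fun x : ℂ × ℂ => x.1) x :=
  contDiff_fst.contDiffAt

theorem contDiffAt_snd_real (x : ℂ × ℂ) : ContDiffAt ℝ ∞ (fun x : ℂ × ℂ => x.2) x :=
  contDiff_snd.contDiffAt

theorem contDiffAt_diskCoord {x : ℂ × ℂ} (hx : x ∈ modelDom) : ContDiffAt ℝ ∞ diskCoord x :=
  (contDiffAt_ofReal (contDiffAt_diskFactor hx)).mul
    ((contDiffAt_fst_real x).mul (contDiffAt_snd_real x))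

theorem contDiffAt_diskCoord_re {x : ℂ × ℂ} (hx : x ∈ modelDom) :
    ContDiffAt ℝ ∞ (fun x => (diskCoord x).re) x :=
  Complex.reCLM.contDiff.contDiffAt.comp x (contDiffAt_diskCoord hx)

theorem contDiffAt_diskCoord_im {x : ℂ × ℂ} (hx : x ∈ modelDom) :
    ContDiffAt ℝ ∞ (fun x => (diskCoord x).im) x :=
  Complex.imCLM.contDiff.contDiffAt.comp x (contDiffAt_diskCoord hx)

theorem contDiffAt_radius {x : ℂ × ℂ} (hx : x ∈ modelDom) : ContDiffAt ℝ ∞ radius x :=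
  contDiff_posRoot.contDiffAt.comp x (contDiffAt_diskCoord_im hx)

theorem contDiffAt_sine {x : ℂ × ℂ} (hx : x ∈ modelDom) : ContDiffAt ℝ ∞ sine x :=
  Real.contDiff_sin.contDiffAt.comp x ((contDiffAt_angle hx).div_const 2)

theorem contDiffAt_omega {x : ℂ × ℂ} (hx : x ∈ modelDom) : ContDiffAt ℝ ∞ omega x :=
  (contDiffAt_ofReal (contDiffAt_radius hx)).mul
    (((contDiffAt_ofReal ((contDiffAt_angle hx).div_const 2)).mul contDiffAt_const).cexp)

theorem contDiffAt_zCoord {x : ℂ × ℂ} (hx : x ∈ modelDom) : ContDiffAt ℝ ∞ zCoord x := by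
  refine ((contDiffAt_omega hx).pow 2).neg.congr_of_eventuallyEq (Eventually.of_forall fun y => ?_)
  exact zCoord_eq y

/-! ### The window of a fundamental domain -/

/-- The part `-1/2 < t < 5/6` of the local model; it contains the fundamental domain
`-1/4 ≤ t < 3/4` of the gluing. -/
def window : Set (ℂ × ℂ) := {x | x ∈ modelDom ∧ -1 / 2 < moment x ∧ moment x < 5 / 6}

theorem eventually_mem_window {x : ℂ × ℂ} (hx : x ∈ window) : ∀ᶠ y in 𝓝 x, y ∈ window := by
  have hc := (contDiffAt_moment hx.1).continuousAt
  filter_upwards [isOpen_modelDom.mem_nhds hx.1, hc.eventually (lt_mem_nhds hx.2.1),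
    hc.eventually (gt_mem_nhds hx.2.2)] with y h1 h2 h3 using ⟨h1, h2, h3⟩

theorem rotMap_mem_window {c : ℂ} (hc : ‖c‖ = 1) {x : ℂ × ℂ} (hx : x ∈ window) :
    rotMap c x ∈ window :=
  ⟨rotMap_mem hc hx.1, by rw [moment_rotMap hc hx.1]; exact hx.2⟩

theorem sine_pos {x : ℂ × ℂ} (hx : x ∈ window) (h : 0 < moment x) : 0 < sine x := by
  obtain ⟨h1, h2⟩ := angle_pos hx.1 h
  have := Real.pi_pos
  refine Real.sin_pos_of_pos_of_lt_pi (by linarith) ?_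
  nlinarith [hx.2.2]

theorem sine_neg {x : ℂ × ℂ} (hx : x ∈ window) (h : moment x < 0) : sine x < 0 := by
  obtain ⟨h1, h2⟩ := angle_neg hx.1 h
  have := Real.pi_pos
  refine Real.sin_neg_of_neg_of_neg_pi_lt (by linarith) ?_
  nlinarith [hx.2.1]

theorem sine_eq_zero {x : ℂ × ℂ} (hx : x ∈ window) : sine x = 0 ↔ moment x = 0 := by
  refine ⟨fun h => ?_, fun h => ?_⟩
  · rcases lt_trichotomy (moment x) 0 with h1 | h1 | h1
    · exact absurd h (sine_neg hx h1).ne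
    · exact h1
    · exact absurd h (sine_pos hx h1).ne'
  · simp [sine, angle_eq_zero hx.1 h]

theorem diskCoord_eq_zero {x : ℂ × ℂ} (hx : x ∈ modelDom) : diskCoord x = 0 ↔ x.1 * x.2 = 0 := by
  simp [diskCoord, (diskFactor_pos hx).ne']

theorem eq_zero_of_diskCoord {x : ℂ × ℂ} (hx : x ∈ window) (h : diskCoord x = 0)
    (hs : sine x = 0) : x = 0 := by
  have h1 := (sine_eq_zero hx).1 hs
  have hn : ‖x.1‖ = ‖x.2‖ :=
    le_antisymm (not_lt.1 fun h' => (moment_pos hx.1 h').ne' h1)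
      (not_lt.1 fun h' => (moment_neg hx.1 h').ne h1)
  rcases mul_eq_zero.1 ((diskCoord_eq_zero hx.1).1 h) with h2 | h2
  · rw [h2, norm_zero] at hn
    exact Prod.ext h2 (norm_eq_zero.1 hn.symm)
  · rw [h2, norm_zero] at hn
    exact Prod.ext (norm_eq_zero.1 hn) h2

/-- The function `N = √(|q_m|² + 16 s²)`, where `q_m` is `diskCoord`; it equals
`(|u'|² + |v'|²) / 2` for the rescaled coordinates. -/
def halfSum (x : ℂ × ℂ) : ℝ := √(‖diskCoord x‖ ^ 2 + 16 * sine x ^ 2)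

theorem halfSum_sq (x : ℂ × ℂ) :
    halfSum x ^ 2 = ‖diskCoord x‖ ^ 2 + 16 * sine x ^ 2 := Real.sq_sqrt (by positivity)

theorem halfSum_nonneg (x : ℂ × ℂ) : 0 ≤ halfSum x := Real.sqrt_nonneg _

theorem abs_four_sine_le (x : ℂ × ℂ) : |4 * sine x| ≤ halfSum x := by
  refine Real.le_sqrt_of_sq_le ?_
  rw [sq_abs]
  nlinarith [sq_nonneg ‖diskCoord x‖]

theorem norm_sq_eq_re_im (z : ℂ) : ‖z‖ ^ 2 = z.re ^ 2 + z.im ^ 2 := by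
  rw [← Complex.normSq_eq_norm_sq, Complex.normSq_apply]
  ring

theorem halfSum_pos {x : ℂ × ℂ} (hx : x ∈ window) (h : x ≠ 0) : 0 < halfSum x := by
  refine Real.sqrt_pos.2 ?_
  by_contra hc
  have h1 : ‖diskCoord x‖ ^ 2 = 0 := by nlinarith [sq_nonneg ‖diskCoord x‖, sq_nonneg (sine x)]
  have h2 : sine x ^ 2 = 0 := by nlinarith [sq_nonneg ‖diskCoord x‖, sq_nonneg (sine x)]
  exact h (eq_zero_of_diskCoord hx (by simpa using h1) (by simpa using h2))

theorem contDiffAt_halfSum {x : ℂ × ℂ} (hx : x ∈ window) (h : x ≠ 0) :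
    ContDiffAt ℝ ∞ halfSum x := by
  have h1 : ContDiffAt ℝ ∞ (fun x => ‖diskCoord x‖ ^ 2 + 16 * sine x ^ 2) x :=
    ((contDiffAt_diskCoord hx.1).norm_sq ℝ).add
      (contDiffAt_const.mul ((contDiffAt_sine hx.1).pow 2))
  exact h1.sqrt (Real.sqrt_pos.1 (halfSum_pos hx h)).ne'

theorem sine_pos_iff {x : ℂ × ℂ} (hx : x ∈ window) : 0 < sine x ↔ 0 < moment x := by
  refine ⟨fun h => ?_, sine_pos hx⟩
  by_contra hc
  rcases (not_lt.1 hc).lt_or_eq with h1 | h1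
  · exact (sine_neg hx h1).not_gt h
  · exact h.ne' ((sine_eq_zero hx).2 h1)

/-! ### The rescaled coordinates -/

theorem scale_num_pos {x : ℂ × ℂ} (hx : x ∈ window) (h : x ≠ 0) :
    0 < halfSum x + 4 * sine x + diskFactor x * ‖x.2‖ ^ 2 := by
  have h1 := neg_le_of_abs_le (abs_four_sine_le x)
  have h2 := diskFactor_pos hx.1
  by_cases h3 : x.2 = 0
  · -- On the axis `v = 0` the sine is positive.
    have h4 : x.1 ≠ 0 := fun h4 => h (Prod.ext h4 h3)
    have h5 : 0 < sine x := sine_pos hx (moment_pos hx.1 (by simpa [h3] using h4))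
    have := halfSum_nonneg x
    simp [h3]
    linarith
  · have : 0 < ‖x.2‖ := norm_pos_iff.2 h3
    have : 0 < diskFactor x * ‖x.2‖ ^ 2 := by positivity
    linarith

theorem scale_den_pos {x : ℂ × ℂ} (hx : x ∈ window) (h : x ≠ 0) :
    0 < halfSum x - 4 * sine x + diskFactor x * ‖x.1‖ ^ 2 := by
  have h1 := le_of_abs_le (abs_four_sine_le x)
  have h2 := diskFactor_pos hx.1
  by_cases h3 : x.1 = 0
  · have h4 : x.2 ≠ 0 := fun h4 => h (Prod.ext h3 h4)
    have h5 : sine x < 0 := sine_neg hx (moment_neg hx.1 (by simpa [h3] using h4))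
    have := halfSum_nonneg x
    simp [h3]
    linarith
  · have : 0 < ‖x.1‖ := norm_pos_iff.2 h3
    have : 0 < diskFactor x * ‖x.1‖ ^ 2 := by positivity
    linarith

/-- The factor `λ` by which the coordinates `(u, v)` are rescaled to `(λ u, v / λ)` in order that
`|u'|² - |v'|² = 8 s`; it is `1` near the node. -/
def scale (x : ℂ × ℂ) : ℝ :=
  √((halfSum x + 4 * sine x + diskFactor x * ‖x.2‖ ^ 2) /
    (halfSum x - 4 * sine x + diskFactor x * ‖x.1‖ ^ 2))

theorem scale_pos {x : ℂ × ℂ} (hx : x ∈ window) (h : x ≠ 0) : 0 < scale x :=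
  Real.sqrt_pos.2 (div_pos (scale_num_pos hx h) (scale_den_pos hx h))

theorem contDiffAt_scale {x : ℂ × ℂ} (hx : x ∈ window) (h : x ≠ 0) : ContDiffAt ℝ ∞ scale x := by
  have h1 := contDiffAt_halfSum hx h
  have h2 : ContDiffAt ℝ ∞ (fun x => 4 * sine x) x := contDiffAt_const.mul (contDiffAt_sine hx.1)
  have h3 := contDiffAt_diskFactor hx.1
  refine ContDiffAt.sqrt (((h1.add h2).add (h3.mul contDiff_norm_sq_snd.contDiffAt)).div
    ((h1.sub h2).add (h3.mul contDiff_norm_sq_fst.contDiffAt)) (scale_den_pos hx h).ne') ?_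
  exact (div_pos (scale_num_pos hx h) (scale_den_pos hx h)).ne'

/-- The rescaled coordinate `u'`. -/
def uScaled (x : ℂ × ℂ) : ℂ := (√(diskFactor x) * scale x : ℝ) * x.1

/-- The rescaled coordinate `v'`. -/
def vScaled (x : ℂ × ℂ) : ℂ := (√(diskFactor x) / scale x : ℝ) * x.2

theorem uScaled_zero : uScaled 0 = 0 := by simp [uScaled]

theorem vScaled_zero : vScaled 0 = 0 := by simp [vScaled]

theorem uScaled_mul_vScaled {x : ℂ × ℂ} (hx : x ∈ window) :
    uScaled x * vScaled x = diskCoord x := by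
  by_cases h : x = 0
  · subst h; simp [uScaled_zero, diskCoord]
  have h1 := (scale_pos hx h).ne'
  have h2 := Real.mul_self_sqrt (diskFactor_pos hx.1).le
  unfold uScaled vScaled diskCoord
  rw [mul_mul_mul_comm, ← Complex.ofReal_mul, ← h2]
  congr 2
  rw [h2]
  field_simp
  rw [Real.sq_sqrt (diskFactor_pos hx.1).le]

theorem halfSum_zero : halfSum 0 = 0 := by
  have : angle 0 = 0 := angle_eq_zero zero_mem_modelDom moment_zero
  simp [halfSum, diskCoord, sine, this]

theorem sine_zero : sine 0 = 0 := by
  simp [sine, angle_eq_zero zero_mem_modelDom moment_zero]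

theorem norm_sq_uScaled {x : ℂ × ℂ} (hx : x ∈ window) :
    ‖uScaled x‖ ^ 2 = halfSum x + 4 * sine x := by
  by_cases h : x = 0
  · subst h; simp [uScaled_zero, halfSum_zero, sine_zero]
  have h1 := scale_den_pos hx h
  have h2 : scale x ^ 2 = _ := Real.sq_sqrt (div_pos (scale_num_pos hx h) h1).le
  have h3 := Real.sq_sqrt (diskFactor_pos hx.1).le
  unfold uScaled
  rw [norm_mul, mul_pow, Complex.norm_real, Real.norm_eq_abs, sq_abs, mul_pow, h2, h3,
    mul_div_assoc', div_mul_eq_mul_div, div_eq_iff h1.ne']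
  have h4 := halfSum_sq x
  rw [norm_sq_diskCoord] at h4
  linear_combination -h4

theorem norm_sq_vScaled {x : ℂ × ℂ} (hx : x ∈ window) :
    ‖vScaled x‖ ^ 2 = halfSum x - 4 * sine x := by
  by_cases h : x = 0
  · subst h; simp [vScaled_zero, halfSum_zero, sine_zero]
  have h0 := scale_num_pos hx h
  have h1 := scale_den_pos hx h
  have h2 : scale x ^ 2 = _ := Real.sq_sqrt (div_pos h0 h1).le
  have h3 := Real.sq_sqrt (diskFactor_pos hx.1).le
  unfold vScaled
  rw [norm_mul, mul_pow, Complex.norm_real, Real.norm_eq_abs, sq_abs, div_pow, h2, h3,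
    div_div_eq_mul_div, div_mul_eq_mul_div, div_eq_iff h0.ne']
  have h4 := halfSum_sq x
  rw [norm_sq_diskCoord] at h4
  linear_combination -h4

theorem scaled_rotMap {c : ℂ} (hc : ‖c‖ = 1) {x : ℂ × ℂ} (hx : x ∈ modelDom) :
    uScaled (rotMap c x) = c * uScaled x ∧ vScaled (rotMap c x) = conj c * vScaled x := by
  have e1 := rotMap_mul hc x
  have e2 : scale (rotMap c x) = scale x := by
    unfold scale halfSum sine
    rw [diskCoord_eq e1, diskFactor_eq e1, angle_rotMap hc hx]
    simp [rotMap, hc]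
  unfold uScaled vScaled
  rw [e2, diskFactor_eq e1]
  simp only [rotMap]
  constructor
  · ring
  · rw [Complex.star_def]; ring

/-- Near the node the coordinates are rescaled by the square root of `diskFactor` only. -/
theorem eventually_scaled_eq : ∀ᶠ x in 𝓝 (0 : ℂ × ℂ),
    uScaled x = √(diskFactor x) * x.1 ∧ vScaled x = √(diskFactor x) * x.2 := by
  filter_upwards [eventually_sin_angle, isOpen_modelDom.mem_nhds zero_mem_modelDom] with x hs hx
  by_cases h : x = 0
  · subst h; simp [uScaled_zero, vScaled_zero]
  have hk := diskFactor_pos hx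
  have h1 : sine x = diskFactor x * (‖x.1‖ ^ 2 - ‖x.2‖ ^ 2) / 8 := hs
  have h2 : halfSum x = diskFactor x * (‖x.1‖ ^ 2 + ‖x.2‖ ^ 2) / 2 := by
    unfold halfSum
    rw [norm_sq_diskCoord, h1, Real.sqrt_eq_iff_mul_self_eq (by positivity) (by positivity)]
    ring
  have h3 : scale x = 1 := by
    unfold scale
    rw [h1, h2, Real.sqrt_eq_one]
    have : 0 < ‖x.1‖ ^ 2 + ‖x.2‖ ^ 2 := by
      have : 0 < ‖x.1‖ ∨ 0 < ‖x.2‖ := by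
        rw [norm_pos_iff, norm_pos_iff]
        by_contra hc
        push Not at hc
        exact h (Prod.ext hc.1 hc.2)
      rcases this with h | h <;> positivity
    rw [div_eq_one_iff_eq]
    · ring
    · have := mul_pos hk this
      nlinarith
  simp [uScaled, vScaled, h3]

theorem contDiffAt_sqrt_diskFactor {x : ℂ × ℂ} (hx : x ∈ modelDom) :
    ContDiffAt ℝ ∞ (fun x => √(diskFactor x)) x :=
  (contDiffAt_diskFactor hx).sqrt (diskFactor_pos hx).ne'

theorem contDiffAt_uScaled {x : ℂ × ℂ} (hx : x ∈ window) : ContDiffAt ℝ ∞ uScaled x := by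
  by_cases h : x = 0
  · subst h
    refine ContDiffAt.congr_of_eventuallyEq ?_ (eventually_scaled_eq.mono fun x hx => hx.1)
    exact (contDiffAt_ofReal (contDiffAt_sqrt_diskFactor hx.1)).mul (contDiffAt_fst_real 0)
  · exact (contDiffAt_ofReal ((contDiffAt_sqrt_diskFactor hx.1).mul (contDiffAt_scale hx h))).mul
      (contDiffAt_fst_real x)

theorem contDiffAt_vScaled {x : ℂ × ℂ} (hx : x ∈ window) : ContDiffAt ℝ ∞ vScaled x := by
  by_cases h : x = 0
  · subst h
    refine ContDiffAt.congr_of_eventuallyEq ?_ (eventually_scaled_eq.mono fun x hx => hx.2)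
    exact (contDiffAt_ofReal (contDiffAt_sqrt_diskFactor hx.1)).mul (contDiffAt_snd_real 0)
  · exact (contDiffAt_ofReal ((contDiffAt_sqrt_diskFactor hx.1).div (contDiffAt_scale hx h)
      (scale_pos hx h).ne')).mul (contDiffAt_snd_real x)

/-! ### The functions `X` and `Y` near `t = 0` -/

theorem abs_angle_lt {x : ℂ × ℂ} (hx : x ∈ window) (h : moment x < 1 / 2) :
    |angle x| < Real.pi := by
  have hp := Real.pi_pos
  rw [abs_lt]
  rcases lt_trichotomy (moment x) 0 with h1 | h1 | h1
  · obtain ⟨h2, h3⟩ := angle_neg hx.1 h1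
    constructor <;> nlinarith [hx.2.1]
  · rw [angle_eq_zero hx.1 h1]
    constructor <;> linarith
  · obtain ⟨h2, h3⟩ := angle_pos hx.1 h1
    constructor <;> nlinarith

theorem one_add_omega_ne_zero {x : ℂ × ℂ} (hx : x ∈ window) (h : moment x < 1 / 2) :
    1 + omega x ≠ 0 := by
  have h1 := abs_lt.1 (abs_angle_lt hx h)
  have h2 : 0 < Real.cos (angle x / 2) :=
    Real.cos_pos_of_mem_Ioo ⟨by linarith, by linarith⟩
  have h3 : (omega x).re = radius x * Real.cos (angle x / 2) := by
    unfold omega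
    rw [Complex.re_ofReal_mul, Complex.exp_ofReal_mul_I_re]
  intro h4
  have h5 := congrArg Complex.re h4
  simp only [Complex.add_re, Complex.one_re, Complex.zero_re, h3] at h5
  have := mul_pos (radius_pos x) h2
  linarith

theorem one_add_conj_omega_ne_zero {x : ℂ × ℂ} (hx : x ∈ window) (h : moment x < 1 / 2) :
    1 + conj (omega x) ≠ 0 := by
  have := (map_ne_zero (starRingEnd ℂ)).2 (one_add_omega_ne_zero hx h)
  simpa using this

/-- The function `X` for small `t`. It has weight `1` for the circle action, and modulus as required
since `|u'|² + |v'|² = 2 N` and `u' v'` is `diskCoord`. -/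
def xNear (x : ℂ × ℂ) : ℂ := (√(radius x) / 2 : ℝ) * (uScaled x + conj (vScaled x))

/-- The function `Y` for small `t`; the factor of modulus one makes `X Y` equal to `1 + Z`. -/
def yNear (x : ℂ × ℂ) : ℂ :=
  (√(radius x) / 2 : ℝ) * (-Complex.I * ((1 + omega x) / (1 + conj (omega x))) *
    (conj (uScaled x) - vScaled x))

theorem xNear_mul_yNear {x : ℂ × ℂ} (hx : x ∈ window) (h : moment x < 1 / 2) :
    xNear x * yNear x = zCoord x + 1 := by
  have h0 := one_add_conj_omega_ne_zero hx h
  have h1 : uScaled x * conj (uScaled x) = ((halfSum x + 4 * sine x : ℝ) : ℂ) := by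
    rw [Complex.mul_conj, Complex.normSq_eq_norm_sq, norm_sq_uScaled hx]
  have h2 : vScaled x * conj (vScaled x) = ((halfSum x - 4 * sine x : ℝ) : ℂ) := by
    rw [Complex.mul_conj, Complex.normSq_eq_norm_sq, norm_sq_vScaled hx]
  have h3 := uScaled_mul_vScaled hx
  have h4 : uScaled x * vScaled x - conj (uScaled x) * conj (vScaled x) =
      2 * (diskCoord x).im * Complex.I := by
    rw [h3, ← map_mul, h3, Complex.sub_conj]
    push_cast
    ring
  have h5 : ((√(radius x) / 2 : ℝ) : ℂ) * ((√(radius x) / 2 : ℝ) : ℂ) = radius x / 4 := by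
    rw [← Complex.ofReal_mul, show √(radius x) / 2 * (√(radius x) / 2) = radius x / 4 by
      rw [div_mul_div_comm, Real.mul_self_sqrt (radius_pos x).le]; norm_num]
    push_cast
    rfl
  have h6 := one_sub_omega_mul x
  have h7 : (uScaled x + conj (vScaled x)) * (conj (uScaled x) - vScaled x) =
      8 * sine x - 2 * (diskCoord x).im * Complex.I := by
    push_cast at h1 h2
    linear_combination h1 - h2 - h4
  have h8 : (1 - omega x) = radius x / 4 * (-Complex.I * (1 / (1 + conj (omega x))) *
      (8 * sine x - 2 * (diskCoord x).im * Complex.I)) := by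
    field_simp
    linear_combination 4 * h6
  calc xNear x * yNear x = ((√(radius x) / 2 : ℝ) : ℂ) * ((√(radius x) / 2 : ℝ) : ℂ) *
        (-Complex.I * ((1 + omega x) / (1 + conj (omega x))) *
        ((uScaled x + conj (vScaled x)) * (conj (uScaled x) - vScaled x))) := by
        unfold xNear yNear
        ring
    _ = (1 + omega x) * (radius x / 4 * (-Complex.I * (1 / (1 + conj (omega x))) *
      (8 * sine x - 2 * (diskCoord x).im * Complex.I))) := by
        rw [h5, h7]
        ring
    _ = zCoord x + 1 := by
        rw [← h8, zCoord_eq]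
        ring

theorem sqrt_radius_sq (x : ℂ × ℂ) : (√(radius x) / 2) ^ 2 = radius x / 4 := by
  rw [div_pow, Real.sq_sqrt (radius_pos x).le]
  norm_num

theorem norm_sq_xNear {x : ℂ × ℂ} (hx : x ∈ window) :
    ‖xNear x‖ ^ 2 = radius x * (halfSum x + (diskCoord x).re) / 2 := by
  unfold xNear
  rw [norm_mul, mul_pow, Complex.norm_real, Real.norm_eq_abs, sq_abs, sqrt_radius_sq,
    ← Complex.normSq_eq_norm_sq, Complex.normSq_add, Complex.conj_conj, uScaled_mul_vScaled hx,
    Complex.normSq_conj, Complex.normSq_eq_norm_sq, Complex.normSq_eq_norm_sq,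
    norm_sq_uScaled hx, norm_sq_vScaled hx]
  ring

theorem norm_sq_yNear {x : ℂ × ℂ} (hx : x ∈ window) (h : moment x < 1 / 2) :
    ‖yNear x‖ ^ 2 = radius x * (halfSum x - (diskCoord x).re) / 2 := by
  have h1 : ‖(1 + omega x) / (1 + conj (omega x))‖ = 1 := by
    have : 1 + conj (omega x) = conj (1 + omega x) := by simp
    rw [this, norm_div, Complex.norm_conj, div_self]
    exact norm_ne_zero_iff.2 (one_add_omega_ne_zero hx h)
  have h2 : (conj (uScaled x) * conj (vScaled x)).re = (diskCoord x).re := by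
    rw [← map_mul, Complex.conj_re, uScaled_mul_vScaled hx]
  unfold yNear
  rw [norm_mul, mul_pow, Complex.norm_real, Real.norm_eq_abs, sq_abs, sqrt_radius_sq,
    norm_mul, norm_mul, norm_neg, Complex.norm_I, h1, one_mul, one_mul,
    ← Complex.normSq_eq_norm_sq, Complex.normSq_sub, h2,
    Complex.normSq_conj, Complex.normSq_eq_norm_sq, Complex.normSq_eq_norm_sq,
    norm_sq_uScaled hx, norm_sq_vScaled hx]
  ring

/-! ### The functions `X` and `Y` for positive `t` -/

/-- The complex number of modulus one in the direction of `z`. -/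
def unitPart (z : ℂ) : ℂ := z / ‖z‖

theorem norm_mul_unitPart (z : ℂ) : ‖z‖ * unitPart z = z := by
  by_cases h : z = 0
  · simp [h]
  · have : (‖z‖ : ℂ) ≠ 0 := by simpa using h
    unfold unitPart
    field_simp

theorem norm_unitPart {z : ℂ} (h : z ≠ 0) : ‖unitPart z‖ = 1 := by
  unfold unitPart
  rw [norm_div, Complex.norm_real, norm_norm, div_self (norm_ne_zero_iff.2 h)]

theorem unitPart_real_mul {a : ℝ} (ha : 0 < a) (z : ℂ) : unitPart (a * z) = unitPart z := by
  unfold unitPart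
  rw [norm_mul, Complex.norm_real, Real.norm_eq_abs, abs_of_pos ha]
  push_cast
  rw [mul_div_mul_left _ _ (by exact_mod_cast ha.ne')]

theorem unitPart_mul {c : ℂ} (hc : ‖c‖ = 1) (z : ℂ) : unitPart (c * z) = c * unitPart z := by
  unfold unitPart
  rw [norm_mul, hc, one_mul, mul_div_assoc]

theorem contDiffAt_complex_div {f g : ℂ × ℂ → ℂ} {x : ℂ × ℂ} (hf : ContDiffAt ℝ ∞ f x)
    (hg : ContDiffAt ℝ ∞ g x) (h : g x ≠ 0) : ContDiffAt ℝ ∞ (fun x => f x / g x) x := by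
  simp only [div_eq_mul_inv]
  exact hf.mul (hg.inv h)

theorem contDiffAt_unitPart {f : ℂ × ℂ → ℂ} {x : ℂ × ℂ} (hf : ContDiffAt ℝ ∞ f x)
    (h : f x ≠ 0) : ContDiffAt ℝ ∞ (fun x => unitPart (f x)) x :=
  contDiffAt_complex_div hf (contDiffAt_ofReal (hf.norm ℝ h)) (by simpa using h)

/-- A smooth function of `t` decreasing from `1` to `-1` between `1/3` and `1/2`. -/
def signCutoff (t : ℝ) : ℝ := 1 - 2 * Real.smoothTransition (6 * t - 2)

theorem signCutoff_of_le {t : ℝ} (h : t ≤ 1 / 3) : signCutoff t = 1 := by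
  unfold signCutoff
  rw [Real.smoothTransition.zero_of_nonpos (by linarith)]
  norm_num

theorem signCutoff_of_ge {t : ℝ} (h : 1 / 2 ≤ t) : signCutoff t = -1 := by
  unfold signCutoff
  rw [Real.smoothTransition.one_of_one_le (by linarith)]
  norm_num

theorem contDiff_signCutoff : ContDiff ℝ ∞ signCutoff :=
  contDiff_const.sub (contDiff_const.mul (Real.smoothTransition.contDiff.comp
    ((contDiff_const.mul contDiff_id).sub contDiff_const)))

/-- Up to a positive factor, the quotient of `X` by `u` for positive `t`. It is
`1 + conj v' / u'` for small `t` and `1 + u' v' / |v'|²`, for the coordinates of the preceding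
copy of the local model, for `t` close to `1`. -/
def phaseFactor (x : ℂ × ℂ) : ℂ :=
  ((halfSum x + 4 * sine x + (diskCoord x).re : ℝ) : ℂ) -
    (signCutoff (moment x) * (diskCoord x).im : ℝ) * Complex.I

/-- The function `X` for positive `t`. -/
def xFar (x : ℂ × ℂ) : ℂ :=
  (√(radius x * (halfSum x + (diskCoord x).re) / 2) : ℝ) * unitPart (x.1 * phaseFactor x)

theorem halfSum_add_re_pos {x : ℂ × ℂ} (hx : x ∈ window) (h : 0 < moment x) :
    0 < halfSum x + (diskCoord x).re := by
  have h1 := sine_pos hx h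
  have h2 := halfSum_sq x
  rw [norm_sq_eq_re_im] at h2
  have h3 := halfSum_nonneg x
  by_contra hc
  nlinarith [sq_nonneg (diskCoord x).im, sq_pos_of_pos h1]

theorem phaseFactor_ne_zero {x : ℂ × ℂ} (hx : x ∈ window) (h : 0 < moment x) :
    phaseFactor x ≠ 0 := by
  intro h1
  have h2 := congrArg Complex.re h1
  have h3 := sine_pos hx h
  have h4 := halfSum_add_re_pos hx h
  simp [phaseFactor] at h2
  linarith

theorem fst_ne_zero {x : ℂ × ℂ} (hx : x ∈ modelDom) (h : 0 < moment x) : x.1 ≠ 0 := by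
  intro h1
  have := (moment_pos_iff hx).1 h
  rw [h1, norm_zero] at this
  exact this.not_ge (norm_nonneg _)

theorem snd_ne_zero {x : ℂ × ℂ} (hx : x ∈ modelDom) (h : moment x < 0) : x.2 ≠ 0 := by
  intro h1
  have := (moment_neg_iff hx).1 h
  rw [h1, norm_zero] at this
  exact this.not_ge (norm_nonneg _)

theorem norm_sq_xFar {x : ℂ × ℂ} (hx : x ∈ window) (h : 0 < moment x) :
    ‖xFar x‖ ^ 2 = radius x * (halfSum x + (diskCoord x).re) / 2 := by
  have h1 := mul_pos (radius_pos x) (halfSum_add_re_pos hx h)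
  unfold xFar
  rw [norm_mul, norm_unitPart (mul_ne_zero (fst_ne_zero hx.1 h) (phaseFactor_ne_zero hx h)),
    mul_one, Complex.norm_real, Real.norm_eq_abs, sq_abs, Real.sq_sqrt (by linarith)]

theorem xFar_ne_zero {x : ℂ × ℂ} (hx : x ∈ window) (h : 0 < moment x) : xFar x ≠ 0 := by
  have h1 := mul_pos (radius_pos x) (halfSum_add_re_pos hx h)
  have h2 := norm_sq_xFar hx h
  intro h3
  rw [h3, norm_zero] at h2
  linarith

/-- `X` is determined by its modulus and its direction. -/
theorem xNear_eq {x : ℂ × ℂ} (hx : x ∈ window) {a : ℝ} (ha : 0 < a) {z : ℂ}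
    (h : uScaled x + conj (vScaled x) = a * z) :
    xNear x = (√(radius x * (halfSum x + (diskCoord x).re) / 2) : ℝ) * unitPart z := by
  have h1 : unitPart (xNear x) = unitPart z := by
    have := Real.sqrt_pos.2 (radius_pos x)
    unfold xNear
    rw [unitPart_real_mul (by linarith), h, unitPart_real_mul ha]
  rw [← norm_sq_xNear hx, Real.sqrt_sq (norm_nonneg _), ← h1, norm_mul_unitPart]

theorem uScaled_ne_zero {x : ℂ × ℂ} (hx : x ∈ window) (h : x.1 ≠ 0) : uScaled x ≠ 0 := by
  have h0 : x ≠ 0 := fun h' => h (by rw [h']; rfl)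
  have h1 := mul_pos (Real.sqrt_pos.2 (diskFactor_pos hx.1)) (scale_pos hx h0)
  exact mul_ne_zero (by exact_mod_cast h1.ne') h

theorem xNear_eq_xFar {x : ℂ × ℂ} (hx : x ∈ window) (h : 0 < moment x) (h' : moment x ≤ 1 / 3) :
    xNear x = xFar x := by
  have hu := fst_ne_zero hx.1 h
  have h0 : x ≠ 0 := fun h' => hu (by rw [h']; rfl)
  have hU := uScaled_ne_zero hx hu
  have h1 := mul_pos (Real.sqrt_pos.2 (diskFactor_pos hx.1)) (scale_pos hx h0)
  have hn : 0 < ‖uScaled x‖ ^ 2 := by positivity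
  refine xNear_eq hx (div_pos h1 hn) ?_
  have h2 : uScaled x * conj (uScaled x) = ((halfSum x + 4 * sine x : ℝ) : ℂ) := by
    rw [Complex.mul_conj, Complex.normSq_eq_norm_sq, norm_sq_uScaled hx]
  have h3 : conj (uScaled x) * conj (vScaled x) =
      (diskCoord x).re - (diskCoord x).im * Complex.I := by
    rw [← map_mul, uScaled_mul_vScaled hx]
    apply Complex.ext <;> simp
  have h4 : conj (uScaled x) ≠ 0 := by simpa using hU
  have h5 : ((‖uScaled x‖ ^ 2 : ℝ) : ℂ) = uScaled x * conj (uScaled x) := by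
    rw [Complex.mul_conj, Complex.normSq_eq_norm_sq]
  have h6 : (uScaled x + conj (vScaled x)) * conj (uScaled x) = phaseFactor x := by
    unfold phaseFactor
    rw [signCutoff_of_le h']
    push_cast at h2 ⊢
    linear_combination h2 + h3
  rw [← h6, Complex.ofReal_div, h5, div_mul_eq_mul_div, eq_div_iff (mul_ne_zero hU h4)]
  have h7 : uScaled x = (√(diskFactor x) * scale x : ℝ) * x.1 := rfl
  linear_combination (uScaled x + conj (vScaled x)) * conj (uScaled x) * h7

/-! ### The functions `X` and `Y` -/

/-- The function `X` on the window. -/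
def xCoord (x : ℂ × ℂ) : ℂ := if moment x < 1 / 4 then xNear x else xFar x

/-- The function `Y` on the window. -/
def yCoord (x : ℂ × ℂ) : ℂ := if moment x < 1 / 4 then yNear x else (zCoord x + 1) / xFar x

theorem coord_eq_near {x : ℂ × ℂ} (hx : x ∈ window) (h : moment x < 1 / 3) :
    xCoord x = xNear x ∧ yCoord x = yNear x := by
  unfold xCoord yCoord
  split_ifs with h1
  · exact ⟨rfl, rfl⟩
  · have h2 : 0 < moment x := by linarith
    have h3 := xNear_eq_xFar hx h2 h.le
    refine ⟨h3.symm, ?_⟩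
    rw [div_eq_iff (xFar_ne_zero hx h2), ← h3, mul_comm, xNear_mul_yNear hx (by linarith)]

theorem coord_eq_far {x : ℂ × ℂ} (hx : x ∈ window) (h : 0 < moment x) :
    xCoord x = xFar x ∧ yCoord x = (zCoord x + 1) / xFar x := by
  unfold xCoord yCoord
  split_ifs with h1
  · have h3 := xNear_eq_xFar hx h (by linarith)
    refine ⟨h3, ?_⟩
    rw [eq_div_iff (xFar_ne_zero hx h), ← h3, mul_comm, xNear_mul_yNear hx (by linarith)]
  · exact ⟨rfl, rfl⟩

theorem xCoord_mul_yCoord {x : ℂ × ℂ} (hx : x ∈ window) :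
    xCoord x * yCoord x = zCoord x + 1 := by
  rcases lt_or_ge (moment x) (1 / 3) with h | h
  · rw [(coord_eq_near hx h).1, (coord_eq_near hx h).2, xNear_mul_yNear hx (by linarith)]
  · have h2 : 0 < moment x := by linarith
    rw [(coord_eq_far hx h2).1, (coord_eq_far hx h2).2, mul_div_cancel₀ _ (xFar_ne_zero hx h2)]

theorem norm_sq_sub_coord {x : ℂ × ℂ} (hx : x ∈ window) :
    ‖xCoord x‖ ^ 2 - ‖yCoord x‖ ^ 2 = radius x * (diskCoord x).re := by
  rcases lt_or_ge (moment x) (1 / 3) with h | h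
  · rw [(coord_eq_near hx h).1, (coord_eq_near hx h).2, norm_sq_xNear hx,
      norm_sq_yNear hx (by linarith)]
    ring
  · have h2 : 0 < moment x := by linarith
    have h3 := halfSum_add_re_pos hx h2
    have h4 := radius_pos x
    have h5 := halfSum_sq x
    rw [norm_sq_eq_re_im] at h5
    rw [(coord_eq_far hx h2).1, (coord_eq_far hx h2).2, norm_div, div_pow, norm_sq_xFar hx h2,
      add_comm (zCoord x), norm_one_add_zCoord_sq]
    field_simp
    linear_combination 4 * h5

theorem contDiffAt_near {x : ℂ × ℂ} (hx : x ∈ window) (h : moment x < 1 / 2) :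
    ContDiffAt ℝ ∞ xNear x ∧ ContDiffAt ℝ ∞ yNear x := by
  have h1 : ContDiffAt ℝ ∞ (fun x => ((√(radius x) / 2 : ℝ) : ℂ)) x :=
    contDiffAt_ofReal (((contDiffAt_radius hx.1).sqrt (radius_pos x).ne').div_const 2)
  have hu := contDiffAt_uScaled hx
  have hv := contDiffAt_vScaled hx
  have ho := contDiffAt_omega hx.1
  exact ⟨h1.mul (hu.add (contDiffAt_conj hv)), h1.mul ((contDiffAt_const.mul
    (contDiffAt_complex_div (contDiffAt_const.add ho) (contDiffAt_const.add (contDiffAt_conj ho))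
      (one_add_conj_omega_ne_zero hx h))).mul ((contDiffAt_conj hu).sub hv))⟩

theorem contDiffAt_xFar {x : ℂ × ℂ} (hx : x ∈ window) (h : 0 < moment x) :
    ContDiffAt ℝ ∞ xFar x := by
  have hu := fst_ne_zero hx.1 h
  have h0 : x ≠ 0 := fun h' => hu (by rw [h']; rfl)
  have hN := contDiffAt_halfSum hx h0
  have hre := contDiffAt_diskCoord_re hx.1
  have him := contDiffAt_diskCoord_im hx.1
  have h1 := mul_pos (radius_pos x) (halfSum_add_re_pos hx h)
  have hσ : ContDiffAt ℝ ∞ (fun x => signCutoff (moment x)) x :=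
    contDiff_signCutoff.contDiffAt.comp x (contDiffAt_moment hx.1)
  have hG : ContDiffAt ℝ ∞ phaseFactor x :=
    (contDiffAt_ofReal ((hN.add (contDiffAt_const.mul (contDiffAt_sine hx.1))).add hre)).sub
      ((contDiffAt_ofReal (hσ.mul him)).mul contDiffAt_const)
  refine (contDiffAt_ofReal (ContDiffAt.sqrt (((contDiffAt_radius hx.1).mul
    (hN.add hre)).div_const 2) (by linarith))).mul
    (contDiffAt_unitPart ((contDiffAt_fst_real x).mul hG) ?_)
  exact mul_ne_zero hu (phaseFactor_ne_zero hx h)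

theorem contDiffAt_coord {x : ℂ × ℂ} (hx : x ∈ window) :
    ContDiffAt ℝ ∞ xCoord x ∧ ContDiffAt ℝ ∞ yCoord x := by
  have hc := (contDiffAt_moment hx.1).continuousAt
  have hw := eventually_mem_window hx
  rcases lt_or_ge (moment x) (1 / 3) with h | h
  · have h1 := hw.and (hc.eventually (gt_mem_nhds h))
    obtain ⟨a, b⟩ := contDiffAt_near hx (by linarith)
    exact ⟨a.congr_of_eventuallyEq (h1.mono fun y hy => (coord_eq_near hy.1 hy.2).1),
      b.congr_of_eventuallyEq (h1.mono fun y hy => (coord_eq_near hy.1 hy.2).2)⟩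
  · have h2 : 0 < moment x := by linarith
    have h1 := hw.and (hc.eventually (lt_mem_nhds h2))
    have a := contDiffAt_xFar hx h2
    exact ⟨a.congr_of_eventuallyEq (h1.mono fun y hy => (coord_eq_far hy.1 hy.2).1),
      (contDiffAt_complex_div ((contDiffAt_zCoord hx.1).add contDiffAt_const) a
        (xFar_ne_zero hx h2)).congr_of_eventuallyEq
        (h1.mono fun y hy => (coord_eq_far hy.1 hy.2).2)⟩

theorem zCoord_rotMap {c : ℂ} (hc : ‖c‖ = 1) {x : ℂ × ℂ} (hx : x ∈ modelDom) :
    zCoord (rotMap c x) = zCoord x := by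
  unfold zCoord
  rw [radius_eq (rotMap_mul hc x), angle_rotMap hc hx]

theorem omega_rotMap {c : ℂ} (hc : ‖c‖ = 1) {x : ℂ × ℂ} (hx : x ∈ modelDom) :
    omega (rotMap c x) = omega x := by
  unfold omega
  rw [radius_eq (rotMap_mul hc x), angle_rotMap hc hx]

theorem coord_rotMap {c : ℂ} (hc : ‖c‖ = 1) {x : ℂ × ℂ} (hx : x ∈ window) :
    xCoord (rotMap c x) = c * xCoord x ∧ yCoord (rotMap c x) = conj c * yCoord x := by
  have hm := moment_rotMap hc hx.1
  have hw := rotMap_mem_window hc hx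
  have e1 := rotMap_mul hc x
  have hr := radius_eq e1
  have hcc : conj c * c = 1 := by
    rw [mul_comm, Complex.mul_conj, Complex.normSq_eq_norm_sq, hc]
    simp
  rcases lt_or_ge (moment x) (1 / 3) with h | h
  · rw [(coord_eq_near hx h).1, (coord_eq_near hx h).2, (coord_eq_near hw (hm ▸ h)).1,
      (coord_eq_near hw (hm ▸ h)).2]
    unfold xNear yNear
    rw [hr, (scaled_rotMap hc hx.1).1, (scaled_rotMap hc hx.1).2, omega_rotMap hc hx.1]
    simp only [map_mul, Complex.conj_conj]
    constructor <;> ring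
  · have h2 : 0 < moment x := by linarith
    have h3 : xFar (rotMap c x) = c * xFar x := by
      unfold xFar phaseFactor halfSum sine
      rw [hr, diskCoord_eq e1, angle_rotMap hc hx.1, hm, ← mul_left_comm, ← unitPart_mul hc]
      simp only [rotMap, mul_assoc]
    rw [(coord_eq_far hx h2).1, (coord_eq_far hx h2).2, (coord_eq_far hw (hm.symm ▸ h2)).1,
      (coord_eq_far hw (hm.symm ▸ h2)).2, h3, zCoord_rotMap hc hx.1]
    refine ⟨rfl, ?_⟩
    have : c ≠ 0 := right_ne_zero_of_mul_eq_one hcc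
    rw [← eq_inv_of_mul_eq_one_left hcc |>.symm]
    field_simp

/-! ### Compatibility with the gluing -/

theorem stepMap_mul {x : ℂ × ℂ} (h : x.2 ≠ 0) : (stepMap x).1 * (stepMap x).2 = x.1 * x.2 := by
  simp only [stepMap]
  field_simp

/-- Away from the node the angle is `2 π t`, and `t` increases by `1`. -/
theorem angle_stepMap {x : ℂ × ℂ} (hx : x ∈ modelDom) (h : moment x ≤ -1 / 6)
    (h' : -5 / 6 ≤ moment x) : angle (stepMap x) = angle x + 2 * Real.pi := by
  have h0 := snd_ne_zero hx (by linarith)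
  have hm := moment_stepMap hx h0
  rw [angle_of_le hx (by rw [le_abs]; right; linarith), angle_of_le (stepMap_mem hx h0)
    (by rw [hm, le_abs]; left; linarith), hm]
  ring

theorem stepMap_mem_window {x : ℂ × ℂ} (hx : x ∈ window) (h : moment x < -1 / 6) :
    stepMap x ∈ window := by
  have h0 := snd_ne_zero hx.1 (by linarith)
  refine ⟨stepMap_mem hx.1 h0, ?_⟩
  rw [moment_stepMap hx.1 h0]
  constructor <;> linarith [hx.2.1]

theorem zCoord_stepMap {x : ℂ × ℂ} (hx : x ∈ window) (h : moment x < -1 / 6) :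
    zCoord (stepMap x) = zCoord x := by
  have h0 := snd_ne_zero hx.1 (by linarith)
  unfold zCoord
  rw [radius_eq (stepMap_mul h0), angle_stepMap hx.1 h.le (by linarith [hx.2.1])]
  congr 2
  push_cast
  rw [add_mul, Complex.exp_add, Complex.exp_two_pi_mul_I, mul_one]

/-- On the image of the step `t > 1/2`, so that `signCutoff` is `-1` there and `phaseFactor` is
`(u' + v̄') v'` at the preimage. As the step takes `u` to `v⁻¹`, the phases of `X` agree. The
moduli agree since the step changes the sign of `s`, and `Y` is determined by `X` and `Z`. -/
theorem coord_stepMap {x : ℂ × ℂ} (hx : x ∈ window) (h : moment x < -1 / 6) :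
    xCoord (stepMap x) = xCoord x ∧ yCoord (stepMap x) = yCoord x := by
  have h0 := snd_ne_zero hx.1 (by linarith)
  have hx0 : x ≠ 0 := fun h' => h0 (by rw [h']; rfl)
  have hw := stepMap_mem_window hx h
  have hm := moment_stepMap hx.1 h0
  have hm2 : 1 / 2 < moment (stepMap x) := by rw [hm]; linarith [hx.2.1]
  have hm0 : 0 < moment (stepMap x) := by linarith
  have e1 := stepMap_mul h0
  have es : sine (stepMap x) = -sine x := by
    unfold sine
    rw [angle_stepMap hx.1 h.le (by linarith [hx.2.1]), add_div,
      mul_div_cancel_left₀ _ two_ne_zero, Real.sin_add_pi]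
  have eN : halfSum (stepMap x) = halfSum x := by
    unfold halfSum
    rw [diskCoord_eq e1, es, neg_sq]
  have key : xNear x = xFar (stepMap x) := by
    unfold xFar
    rw [radius_eq e1, eN, diskCoord_eq e1]
    have h1 := div_pos (Real.sqrt_pos.2 (diskFactor_pos hx.1)) (scale_pos hx hx0)
    refine xNear_eq hx (inv_pos.2 h1) ?_
    have h2 : vScaled x * conj (vScaled x) = ((halfSum x - 4 * sine x : ℝ) : ℂ) := by
      rw [Complex.mul_conj, Complex.normSq_eq_norm_sq, norm_sq_vScaled hx]
    have h3 : (uScaled x + conj (vScaled x)) * vScaled x = phaseFactor (stepMap x) := by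
      unfold phaseFactor
      rw [signCutoff_of_ge hm2.le, eN, es, diskCoord_eq e1]
      have h4 : uScaled x * vScaled x = (diskCoord x).re + (diskCoord x).im * Complex.I := by
        rw [uScaled_mul_vScaled hx, Complex.re_add_im]
      push_cast at h2 ⊢
      linear_combination h2 + h4
    have h5 : ((√(diskFactor x) / scale x : ℝ) : ℂ) ≠ 0 := by exact_mod_cast h1.ne'
    rw [← h3]
    simp only [stepMap]
    conv_rhs => enter [2, 2, 2]; rw [vScaled]
    rw [Complex.ofReal_inv]
    field_simp
  have hX : xCoord (stepMap x) = xCoord x := by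
    rw [(coord_eq_far hw hm0).1, (coord_eq_near hx (by linarith)).1, key]
  refine ⟨hX, ?_⟩
  have h1 := xCoord_mul_yCoord hw
  have h2 := xCoord_mul_yCoord hx
  rw [zCoord_stepMap hx h, ← h2, ← hX] at h1
  refine mul_left_cancel₀ ?_ h1
  rw [(coord_eq_far hw hm0).1]
  exact xFar_ne_zero hw hm0

/-! ### The map of the base -/

/-- The diffeomorphism `(r α, log r) ↦ q` of the plane to the disk, where
`q / √(1 - |q|²) = α + 2 i (r - 1 / r)`. -/
def baseMap (p : ℝ × ℝ) : ℂ :=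
  let z : ℂ := ((p.1 * Real.exp (-p.2) : ℝ) : ℂ) +
    ((2 * (Real.exp p.2 - Real.exp (-p.2)) : ℝ) : ℂ) * Complex.I
  z / (√(1 + ‖z‖ ^ 2) : ℝ)

/-- The inverse of `baseMap`. -/
def baseInv (q : ℂ) : ℝ × ℝ :=
  (radius (q, 1) * (diskCoord (q, 1)).re, Real.log (radius (q, 1)))

theorem norm_baseMap_lt (p : ℝ × ℝ) : ‖baseMap p‖ < 1 := by
  unfold baseMap
  simp only
  set z : ℂ := ((p.1 * Real.exp (-p.2) : ℝ) : ℂ) +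
    ((2 * (Real.exp p.2 - Real.exp (-p.2)) : ℝ) : ℂ) * Complex.I
  have h : ‖z‖ < √(1 + ‖z‖ ^ 2) := Real.lt_sqrt_of_sq_lt (by linarith)
  have h0 : 0 < √(1 + ‖z‖ ^ 2) := (norm_nonneg z).trans_lt h
  rw [norm_div, Complex.norm_real, Real.norm_eq_abs, abs_of_pos h0, div_lt_one h0]
  exact h

theorem two_mul_radius_sub_inv (x : ℂ × ℂ) :
    2 * (radius x - (radius x)⁻¹) = (diskCoord x).im := by
  have h := radius_pos x
  have h2 := radius_sq x
  field_simp
  linear_combination 2 * h2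

theorem diskFactor_sq {x : ℂ × ℂ} (hx : x ∈ modelDom) :
    1 + ‖diskCoord x‖ ^ 2 = diskFactor x ^ 2 := by
  have h := one_sub_pos hx
  have h1 : diskFactor x ^ 2 = 1 / (1 - ‖x.1 * x.2‖ ^ 2) := by
    unfold diskFactor
    rw [div_pow, Real.sq_sqrt h.le, one_pow]
  rw [norm_sq_diskCoord, ← mul_pow, ← norm_mul, h1]
  field_simp
  ring

/-- The base map in terms of the coordinates of the local model. -/
theorem baseMap_radius {x : ℂ × ℂ} (hx : x ∈ modelDom) :
    baseMap (radius x * (diskCoord x).re, Real.log (radius x)) = x.1 * x.2 := by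
  have h := radius_pos x
  have h1 : ((radius x * (diskCoord x).re * Real.exp (-Real.log (radius x)) : ℝ) : ℂ) +
      ((2 * (Real.exp (Real.log (radius x)) - Real.exp (-Real.log (radius x))) : ℝ) : ℂ) *
        Complex.I = diskCoord x := by
    rw [Real.exp_neg, Real.exp_log h, two_mul_radius_sub_inv,
      show radius x * (diskCoord x).re * (radius x)⁻¹ = (diskCoord x).re by field_simp,
      Complex.re_add_im]
  have hk := diskFactor_pos hx
  unfold baseMap
  simp only
  rw [h1, diskFactor_sq hx, Real.sqrt_sq hk.le]
  unfold diskCoord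
  rw [mul_div_cancel_left₀]
  exact_mod_cast hk.ne'

theorem mk_one_mem {q : ℂ} (hq : ‖q‖ < 1) : ((q, 1) : ℂ × ℂ) ∈ modelDom := by
  simpa [modelDom] using hq

theorem baseMap_baseInv {q : ℂ} (hq : ‖q‖ < 1) : baseMap (baseInv q) = q := by
  have := baseMap_radius (mk_one_mem hq)
  simpa [baseInv] using this

theorem posRoot_unique {b r : ℝ} (hr : 0 < r) (h : 2 * (r - r⁻¹) = b) : posRoot b = r := by
  have h1 := posRoot_pos b
  have h2 := posRoot_sq b
  subst h
  field_simp at h2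
  have : (posRoot (2 * (r - r⁻¹)) - r) * (r * posRoot (2 * (r - r⁻¹)) + 1) = 0 := by
    field_simp
    linear_combination h2
  rcases mul_eq_zero.1 this with h3 | h3
  · linarith
  · have := mul_pos hr h1
    linarith

theorem baseInv_baseMap (p : ℝ × ℝ) : baseInv (baseMap p) = p := by
  have hm := mk_one_mem (norm_baseMap_lt p)
  set z : ℂ := ((p.1 * Real.exp (-p.2) : ℝ) : ℂ) +
    ((2 * (Real.exp p.2 - Real.exp (-p.2)) : ℝ) : ℂ) * Complex.I with hz
  have h0 : 0 < 1 + ‖z‖ ^ 2 := by positivity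
  have h1 := Real.sqrt_pos.2 h0
  have h3 : diskCoord (baseMap p, 1) = z := by
    have e : baseMap p = z / (√(1 + ‖z‖ ^ 2) : ℝ) := rfl
    have e2 : diskFactor (baseMap p, 1) = √(1 + ‖z‖ ^ 2) := by
      unfold diskFactor
      rw [mul_one, e, norm_div, Complex.norm_real, Real.norm_eq_abs, abs_of_pos h1, div_pow,
        Real.sq_sqrt h0.le, show 1 - ‖z‖ ^ 2 / (1 + ‖z‖ ^ 2) = (1 + ‖z‖ ^ 2)⁻¹ by field_simp; ring,
        Real.sqrt_inv, one_div, inv_inv]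
    unfold diskCoord
    rw [e2, e, mul_one, mul_div_cancel₀]
    exact_mod_cast h1.ne'
  have hre : z.re = p.1 * Real.exp (-p.2) := by
    rw [hz]; simp [-Complex.ofReal_exp, -Complex.ofReal_neg]
  have him : z.im = 2 * (Real.exp p.2 - Real.exp (-p.2)) := by
    rw [hz]; simp [-Complex.ofReal_exp, -Complex.ofReal_neg]
  have hr : radius (baseMap p, 1) = Real.exp p.2 := by
    unfold radius
    rw [h3]
    exact posRoot_unique (Real.exp_pos _) (by rw [him, Real.exp_neg])
  unfold baseInv
  rw [hr, h3, hre, Real.log_exp, Real.exp_neg]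
  ext
  · simp
    field_simp
  · rfl

theorem contDiff_baseMap : ContDiff ℝ ∞ baseMap := by
  have h1 : ContDiff ℝ ∞ fun p : ℝ × ℝ => p.1 * Real.exp (-p.2) := by fun_prop
  have h2 : ContDiff ℝ ∞ fun p : ℝ × ℝ => 2 * (Real.exp p.2 - Real.exp (-p.2)) := by fun_prop
  have hz : ContDiff ℝ ∞ fun p : ℝ × ℝ => ((p.1 * Real.exp (-p.2) : ℝ) : ℂ) +
      ((2 * (Real.exp p.2 - Real.exp (-p.2)) : ℝ) : ℂ) * Complex.I :=
    (Complex.ofRealCLM.contDiff.comp h1).add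
      ((Complex.ofRealCLM.contDiff.comp h2).mul contDiff_const)
  have hs := ContDiff.sqrt (contDiff_const (c := (1 : ℝ)).add (hz.norm_sq ℝ))
    fun p => by positivity
  have hi := (Complex.ofRealCLM.contDiff.comp hs).inv fun p => by
    have : 0 < √(1 + ‖((p.1 * Real.exp (-p.2) : ℝ) : ℂ) +
      ((2 * (Real.exp p.2 - Real.exp (-p.2)) : ℝ) : ℂ) * Complex.I‖ ^ 2) :=
      Real.sqrt_pos.2 (by positivity)
    exact Complex.ofReal_ne_zero.2 this.ne'
  exact hz.mul hi

theorem contDiffAt_baseInv {q : ℂ} (hq : ‖q‖ < 1) : ContDiffAt ℝ ∞ baseInv q := by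
  have hm := mk_one_mem hq
  have hi : ContDiffAt ℝ ∞ (fun q : ℂ => ((q, 1) : ℂ × ℂ)) q :=
    contDiffAt_id.prodMk contDiffAt_const
  have h1 : ContDiffAt ℝ ∞ (fun x => radius x * (diskCoord x).re) ((q, 1) : ℂ × ℂ) :=
    (contDiffAt_radius hm).mul (contDiffAt_diskCoord_re hm)
  have h2 : ContDiffAt ℝ ∞ (fun x => Real.log (radius x)) ((q, 1) : ℂ × ℂ) :=
    (contDiffAt_radius hm).log (radius_pos _).ne'
  exact (h1.comp q hi).prodMk (h2.comp q hi)

/-! ### The local model is immersed by `(X, Y, Z)` -/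

section Calculus

variable {E F G : Type*} [NormedAddCommGroup E] [NormedSpace ℝ E] [NormedAddCommGroup F]
  [NormedSpace ℝ F] [NormedAddCommGroup G] [NormedSpace ℝ G]

theorem fderiv_apply_eq_zero_of_comp {f : E → F} {g : E → G} {h : F → G} {x ξ : E}
    (hf : DifferentiableAt ℝ f x) (hh : DifferentiableAt ℝ h (f x)) (e : g =ᶠ[𝓝 x] h ∘ f)
    (h0 : fderiv ℝ f x ξ = 0) : fderiv ℝ g x ξ = 0 := by
  rw [e.fderiv_eq, fderiv_comp x hh hf, ContinuousLinearMap.comp_apply, h0, map_zero]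

theorem fderiv_apply_prodMk_eq_zero {f : E → F} {g : E → G} {x ξ : E}
    (hf : DifferentiableAt ℝ f x) (hg : DifferentiableAt ℝ g x) (h : fderiv ℝ f x ξ = 0)
    (h' : fderiv ℝ g x ξ = 0) : fderiv ℝ (fun x => (f x, g x)) x ξ = 0 := by
  rw [(hf.hasFDerivAt.prodMk hg.hasFDerivAt).fderiv]
  exact Prod.ext h h'

/-- The derivative of a product at a zero of one factor. -/
theorem fderiv_apply_eq_zero_of_mul {a g : E → ℂ} {x ξ : E} (ha : DifferentiableAt ℝ a x)
    (hg : DifferentiableAt ℝ g x) (h0 : a x ≠ 0) (h1 : g x = 0)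
    (h : fderiv ℝ (fun x => a x * g x) x ξ = 0) : fderiv ℝ g x ξ = 0 := by
  have e := (ha.hasFDerivAt.mul hg.hasFDerivAt).fderiv
  change fderiv ℝ (fun x => a x * g x) x = _ at e
  rw [e, h1, zero_smul, add_zero] at h
  exact (smul_eq_zero.1 h).resolve_left h0

theorem map_complex_smul {V : Type*} [NormedAddCommGroup V] [NormedSpace ℂ V] (L : V →L[ℝ] G)
    (c : ℂ) (v : V) : L (c • v) = c.re • L v + c.im • L (Complex.I • v) := by
  conv_lhs => rw [← Complex.re_add_im c, add_smul, mul_smul, Complex.coe_smul, Complex.coe_smul,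
    map_add, map_smul, map_smul]

end Calculus

/-- The value of `uv` in terms of `(X, Y, Z)`. -/
theorem baseMap_coord {x : ℂ × ℂ} (hx : x ∈ window) :
    baseMap (‖xCoord x‖ ^ 2 - ‖yCoord x‖ ^ 2, Real.log (‖zCoord x‖ ^ 2) / 4) = x.1 * x.2 := by
  rw [norm_sq_sub_coord hx, norm_zCoord, ← pow_mul, Real.log_pow, ← baseMap_radius hx.1]
  congr 2
  push_cast
  ring

/-- By `baseMap_coord` the function `uv` is locally a differentiable function of `(X, Y, Z)`. -/
theorem fderiv_mul_eq_zero {x ξ : ℂ × ℂ} (hx : x ∈ window) (h1 : fderiv ℝ xCoord x ξ = 0)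
    (h2 : fderiv ℝ yCoord x ξ = 0) (h3 : fderiv ℝ zCoord x ξ = 0) :
    fderiv ℝ (fun x : ℂ × ℂ => x.1 * x.2) x ξ = 0 := by
  have d1 := (contDiffAt_coord hx).1.differentiableAt (by simp)
  have d2 := (contDiffAt_coord hx).2.differentiableAt (by simp)
  have d3 := (contDiffAt_zCoord hx.1).differentiableAt (by simp)
  refine fderiv_apply_eq_zero_of_comp (f := fun x => (xCoord x, yCoord x, zCoord x))
    (h := fun p => baseMap (‖p.1‖ ^ 2 - ‖p.2.1‖ ^ 2, Real.log (‖p.2.2‖ ^ 2) / 4))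
    (d1.prodMk (d2.prodMk d3)) ?_ ?_
    (fderiv_apply_prodMk_eq_zero d1 (d2.prodMk d3) h1 (fderiv_apply_prodMk_eq_zero d2 d3 h2 h3))
  · refine DifferentiableAt.comp (g := baseMap)
      (f := fun p : ℂ × ℂ × ℂ => (‖p.1‖ ^ 2 - ‖p.2.1‖ ^ 2, Real.log (‖p.2.2‖ ^ 2) / 4)) _
      (contDiff_baseMap.differentiable (by simp) _) ?_
    have hz : ‖zCoord x‖ ^ 2 ≠ 0 := pow_ne_zero 2 (norm_ne_zero_iff.2 (zCoord_ne_zero x))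
    have a1 : DifferentiableAt ℝ (fun p : ℂ × ℂ × ℂ => p.1) (xCoord x, yCoord x, zCoord x) :=
      differentiableAt_fst
    have a2 : DifferentiableAt ℝ (fun p : ℂ × ℂ × ℂ => p.2) (xCoord x, yCoord x, zCoord x) :=
      differentiableAt_snd
    have a3 : DifferentiableAt ℝ (fun p : ℂ × ℂ × ℂ => Real.log (‖p.2.2‖ ^ 2) / 4)
        (xCoord x, yCoord x, zCoord x) := by
      simp only [div_eq_mul_inv]
      exact ((a2.snd.norm_sq ℝ).log hz).mul_const _
    exact ((a1.norm_sq ℝ).sub (a2.fst.norm_sq ℝ)).prodMk a3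
  · filter_upwards [eventually_mem_window hx] with y hy using (baseMap_coord hy).symm

/-- Locally the angle is a smooth function of `Z`, by a branch of the logarithm. -/
theorem fderiv_angle_eq_zero {x ξ : ℂ × ℂ} (hx : x ∈ modelDom) (h3 : fderiv ℝ zCoord x ξ = 0) :
    fderiv ℝ angle x ξ = 0 := by
  have d3 := (contDiffAt_zCoord hx).differentiableAt (by simp)
  have hz := zCoord_ne_zero x
  refine fderiv_apply_eq_zero_of_comp (f := zCoord)
    (h := fun z => angle x + (Complex.log (z / zCoord x)).im) d3 ?_ ?_ h3
  · have e1 : DifferentiableAt ℂ (fun z => Complex.log (z / zCoord x)) (zCoord x) :=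
      (differentiableAt_id.div_const _).clog (by simp [hz])
    exact (Complex.imCLM.differentiableAt.comp _ (e1.restrictScalars ℝ)).const_add _
  · have hc := (contDiffAt_angle hx).continuousAt
    filter_upwards [hc.eventually (lt_mem_nhds (show angle x - Real.pi < angle x by
      linarith [Real.pi_pos])), hc.eventually (gt_mem_nhds (show angle x < angle x + Real.pi by
      linarith [Real.pi_pos]))] with y h1 h2
    have hr : (radius y / radius x) ^ 2 > 0 := pow_pos (div_pos (radius_pos y) (radius_pos x)) 2
    have e : zCoord y / zCoord x = Complex.exp (Real.log ((radius y / radius x) ^ 2) +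
        (angle y - angle x : ℝ) * Complex.I) := by
      have := (radius_pos x).ne'
      rw [Complex.exp_add, ← Complex.ofReal_exp, Real.exp_log hr, zCoord, zCoord, neg_div_neg_eq,
        mul_div_mul_comm, ← Complex.exp_sub]
      push_cast
      rw [div_pow, sub_mul]
    have him : (((Real.log ((radius y / radius x) ^ 2) : ℝ) : ℂ) +
        (angle y - angle x : ℝ) * Complex.I).im = angle y - angle x := by
      simp
    simp only [Function.comp_apply]
    rw [e, Complex.log_exp (by rw [him]; linarith) (by rw [him]; linarith), him]
    ring

theorem diskFactor_zero : diskFactor 0 = 1 := by simp [diskFactor]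

theorem omega_zero : omega 0 = 1 := by
  have h1 : angle 0 = 0 := angle_eq_zero zero_mem_modelDom moment_zero
  have h2 : radius 0 = 1 := posRoot_unique one_pos (by simp [diskCoord])
  simp [omega, h1, h2]

theorem zero_mem_window : (0 : ℂ × ℂ) ∈ window :=
  ⟨zero_mem_modelDom, by rw [moment_zero]; norm_num, by rw [moment_zero]; norm_num⟩

/-- At the node, where `u'` and `v'` vanish, the derivatives of `X` and `Y` are nonzero multiples of
those of `u' + v̄'` and `ū' - v'`, which determine those of `u'` and `v'`. -/
theorem eq_zero_of_fderiv_coord_zero {ξ : ℂ × ℂ} (h1 : fderiv ℝ xCoord 0 ξ = 0)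
    (h2 : fderiv ℝ yCoord 0 ξ = 0) : ξ = 0 := by
  have hx := zero_mem_window
  have hc := (contDiffAt_moment hx.1).continuousAt
  have hn := (eventually_mem_window hx).and
    (hc.eventually (gt_mem_nhds (show moment 0 < 1 / 3 by rw [moment_zero]; norm_num)))
  have eX : xCoord =ᶠ[𝓝 0] xNear := hn.mono fun y hy => (coord_eq_near hy.1 hy.2).1
  have eY : yCoord =ᶠ[𝓝 0] yNear := hn.mono fun y hy => (coord_eq_near hy.1 hy.2).2
  rw [eX.fderiv_eq] at h1
  rw [eY.fderiv_eq] at h2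
  have hr := radius_pos 0
  have hsr : ((√(radius 0) / 2 : ℝ) : ℂ) ≠ 0 := by
    have := Real.sqrt_pos.2 hr
    exact_mod_cast (div_pos this two_pos).ne'
  have da : ContDiffAt ℝ ∞ (fun x => ((√(radius x) / 2 : ℝ) : ℂ)) 0 :=
    contDiffAt_ofReal (((contDiffAt_radius hx.1).sqrt hr.ne').div_const 2)
  have du := contDiffAt_uScaled hx
  have dv := contDiffAt_vScaled hx
  have dm := du.add (contDiffAt_conj dv)
  have dn := (contDiffAt_conj du).sub dv
  have ho := contDiffAt_omega hx.1
  have hm0 : moment 0 < 1 / 2 := by rw [moment_zero]; norm_num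
  have db : ContDiffAt ℝ ∞ (fun x => -Complex.I * ((1 + omega x) / (1 + conj (omega x)))) 0 :=
    contDiffAt_const.mul (contDiffAt_complex_div (contDiffAt_const.add ho)
      (contDiffAt_const.add (contDiffAt_conj ho)) (one_add_conj_omega_ne_zero hx hm0))
  have hb0 : -Complex.I * ((1 + omega 0) / (1 + conj (omega 0))) ≠ 0 := by
    simp [omega_zero]
  have k1 := fderiv_apply_eq_zero_of_mul (da.differentiableAt (by simp))
    (dm.differentiableAt (by simp)) hsr (by simp [uScaled_zero, vScaled_zero]) h1
  have k2' := fderiv_apply_eq_zero_of_mul (da.differentiableAt (by simp))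
    ((db.mul dn).differentiableAt (by simp)) hsr (by simp [uScaled_zero, vScaled_zero]) h2
  have k2 := fderiv_apply_eq_zero_of_mul (db.differentiableAt (by simp))
    (dn.differentiableAt (by simp)) hb0 (by simp [uScaled_zero, vScaled_zero]) k2'
  have ku : fderiv ℝ uScaled 0 ξ = 0 ∧ fderiv ℝ vScaled 0 ξ = 0 := by
    have fu := (du.differentiableAt (by simp)).hasFDerivAt
    have fv := (dv.differentiableAt (by simp)).hasFDerivAt
    have cu := Complex.conjCLE.toContinuousLinearMap.hasFDerivAt.comp (0 : ℂ × ℂ) fu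
    have cv := Complex.conjCLE.toContinuousLinearMap.hasFDerivAt.comp (0 : ℂ × ℂ) fv
    have l1 : fderiv ℝ uScaled 0 ξ + conj (fderiv ℝ vScaled 0 ξ) = 0 := by
      rw [← k1]
      exact congrArg (fun L => L ξ) (fu.add cv).fderiv.symm
    have l2 : conj (fderiv ℝ uScaled 0 ξ) - fderiv ℝ vScaled 0 ξ = 0 := by
      rw [← k2]
      exact congrArg (fun L => L ξ) (cu.sub fv).fderiv.symm
    have l3 := congrArg conj l2
    simp only [map_sub, Complex.conj_conj, map_zero] at l3
    have l4 : fderiv ℝ uScaled 0 ξ = 0 := by linear_combination (l1 + l3) / 2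
    refine ⟨l4, ?_⟩
    rw [l4] at l2
    simpa using l2
  have hk0 : ((√(diskFactor 0) : ℝ) : ℂ) ≠ 0 := by simp [diskFactor_zero]
  have dk := (contDiffAt_ofReal (contDiffAt_sqrt_diskFactor hx.1)).differentiableAt (by simp)
  have e1 : uScaled =ᶠ[𝓝 0] _ := eventually_scaled_eq.mono fun x hx => hx.1
  have e2 : vScaled =ᶠ[𝓝 0] _ := eventually_scaled_eq.mono fun x hx => hx.2
  rw [e1.fderiv_eq, e2.fderiv_eq] at ku
  have j1 := fderiv_apply_eq_zero_of_mul dk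
    ((contDiffAt_fst_real 0).differentiableAt (by simp)) hk0 rfl ku.1
  have j2 := fderiv_apply_eq_zero_of_mul dk
    ((contDiffAt_snd_real 0).differentiableAt (by simp)) hk0 rfl ku.2
  have i1 : fderiv ℝ (fun x : ℂ × ℂ => x.1) 0 = ContinuousLinearMap.fst ℝ ℂ ℂ :=
    hasFDerivAt_fst.fderiv
  have i2 : fderiv ℝ (fun x : ℂ × ℂ => x.2) 0 = ContinuousLinearMap.snd ℝ ℂ ℂ :=
    hasFDerivAt_snd.fderiv
  rw [i1] at j1
  rw [i2] at j2
  exact Prod.ext j1 j2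

/-- The functions `X` and `Y` vanish together only at the node, the fixed point of the circle
action. -/
theorem eq_zero_of_coord_eq_zero {x : ℂ × ℂ} (hx : x ∈ window) (h1 : xCoord x = 0)
    (h2 : yCoord x = 0) : x = 0 := by
  have e1 := xCoord_mul_yCoord hx
  have e2 := norm_sq_sub_coord hx
  have e3 := norm_one_add_zCoord_sq x
  have hr := radius_pos x
  rw [h1, zero_mul] at e1
  rw [h1, h2] at e2
  rw [add_comm, ← e1, norm_zero] at e3
  have e4 : (diskCoord x).im ^ 2 + 16 * sine x ^ 2 = 0 := by
    have : 0 < radius x ^ 2 := by positivity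
    by_contra hc
    have : 0 < (diskCoord x).im ^ 2 + 16 * sine x ^ 2 := lt_of_le_of_ne (by positivity) (Ne.symm hc)
    have := mul_pos ‹0 < radius x ^ 2› this
    linarith
  refine eq_zero_of_diskCoord hx (Complex.ext ?_ ?_) ?_
  · simp only [sub_self] at e2
    exact (mul_eq_zero.1 e2.symm).resolve_left hr.ne'
  · exact pow_eq_zero_iff two_ne_zero |>.1
      (by nlinarith [sq_nonneg (sine x), sq_nonneg (diskCoord x).im])
  · exact pow_eq_zero_iff two_ne_zero |>.1
      (by nlinarith [sq_nonneg (sine x), sq_nonneg (diskCoord x).im])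

/-- The map `(X, Y, Z)` is an immersion. A vector in the kernel of its derivative is tangent to the
fibre of `uv` and to the level set of the angle, hence to the orbit of the circle action, on which
`X` and `Y` have weights `1` and `-1`. -/
theorem eq_zero_of_fderiv_coord {x ξ : ℂ × ℂ} (hx : x ∈ window) (h1 : fderiv ℝ xCoord x ξ = 0)
    (h2 : fderiv ℝ yCoord x ξ = 0) (h3 : fderiv ℝ zCoord x ξ = 0) : ξ = 0 := by
  by_cases h0 : x = 0
  · subst h0
    exact eq_zero_of_fderiv_coord_zero h1 h2
  have hm := fderiv_mul_eq_zero hx h1 h2 h3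
  have ha := fderiv_angle_eq_zero hx.1 h3
  have hm' : x.1 * ξ.2 + x.2 * ξ.1 = 0 := by
    have f1 : HasFDerivAt (fun x : ℂ × ℂ => x.1) (ContinuousLinearMap.fst ℝ ℂ ℂ) x :=
      hasFDerivAt_fst
    have f2 : HasFDerivAt (fun x : ℂ × ℂ => x.2) (ContinuousLinearMap.snd ℝ ℂ ℂ) x :=
      hasFDerivAt_snd
    have e := (f1.mul f2).fderiv
    change fderiv ℝ (fun x : ℂ × ℂ => x.1 * x.2) x = _ at e
    rw [e] at hm
    exact hm
  obtain ⟨c, hc⟩ : ∃ c : ℂ, ξ = c • hyperField x := by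
    by_cases hu : x.1 = 0
    · have hv : x.2 ≠ 0 := fun hv => h0 (Prod.ext hu hv)
      have : ξ.1 = 0 := by
        rw [hu, zero_mul, zero_add] at hm'
        exact (mul_eq_zero.1 hm').resolve_left hv
      refine ⟨-(ξ.2 / x.2), Prod.ext ?_ ?_⟩
      · simp [this, hu]
      · simp [hv]
    · refine ⟨ξ.1 / x.1, Prod.ext ?_ ?_⟩
      · simp [hu]
      · simp
        field_simp
        linear_combination hm'
  have dX := (contDiffAt_coord hx).1.differentiableAt (by simp)
  have dY := (contDiffAt_coord hx).2.differentiableAt (by simp)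
  have dA := (contDiffAt_angle hx.1).differentiableAt (by simp)
  have hre : c.re = 0 := by
    have k := map_complex_smul (fderiv ℝ angle x) c (hyperField x)
    rw [← hc, ha, fderiv_I_smul_hyperField dA fun c hc => angle_rotMap hc hx.1] at k
    have := fderiv_angle_pos hx.1 h0
    simp at k
    rcases k with k | k
    · exact k
    · exact absurd k this.ne'
  have e1 : HasDerivAt (fun s : ℝ => Complex.exp (s * Complex.I)) Complex.I 0 := by
    have := ((Complex.ofRealCLM.hasDerivAt (x := 0)).mul_const Complex.I).cexp
    simpa using this
  have wX : fderiv ℝ xCoord x (Complex.I • hyperField x) = Complex.I * xCoord x := by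
    have k := hasDerivAt_comp_rotMap dX
    have : (fun s : ℝ => xCoord (rotMap (Complex.exp (s * Complex.I)) x)) =
        fun s : ℝ => Complex.exp (s * Complex.I) * xCoord x :=
      funext fun s => (coord_rotMap (Complex.norm_exp_ofReal_mul_I s) hx).1
    rw [this] at k
    exact k.unique (e1.mul_const _)
  have wY : fderiv ℝ yCoord x (Complex.I • hyperField x) = conj Complex.I * yCoord x := by
    have k := hasDerivAt_comp_rotMap dY
    have : (fun s : ℝ => yCoord (rotMap (Complex.exp (s * Complex.I)) x)) =
        fun s : ℝ => conj (Complex.exp (s * Complex.I)) * yCoord x :=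
      funext fun s => (coord_rotMap (Complex.norm_exp_ofReal_mul_I s) hx).2
    rw [this] at k
    exact k.unique (e1.star.mul_const _)
  have kX := map_complex_smul (fderiv ℝ xCoord x) c (hyperField x)
  have kY := map_complex_smul (fderiv ℝ yCoord x) c (hyperField x)
  rw [← hc, h1, hre, wX, zero_smul, zero_add] at kX
  rw [← hc, h2, hre, wY, zero_smul, zero_add] at kY
  by_cases him : c.im = 0
  · rw [hc, show c = 0 from Complex.ext hre him, zero_smul]
  · simp [him] at kX kY
    exact absurd (eq_zero_of_coord_eq_zero hx kX kY) h0

/-! ### Representatives in the window -/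

theorem StepRel_one_eq {x y : ℂ × ℂ} (h : TateFibration.StepRel 1 x y) (h0 : x.2 ≠ 0) :
    y = stepMap x := by
  obtain ⟨h1, ⟨h2, h3⟩ | ⟨h2, ⟨h3, -⟩ | ⟨-, h3, h4, h5⟩ | ⟨h3, -⟩⟩⟩ := h
  · rw [zpow_one] at h3
    have hx : x.1 ≠ 0 := left_ne_zero_of_mul h2
    have e1 : y.1 = x.2⁻¹ := by
      field_simp
      apply mul_left_cancel₀ hx
      linear_combination h3
    refine Prod.ext e1 ?_
    rw [e1] at h1
    simp only [stepMap]
    field_simp at h1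
    linear_combination -h1
  · simp at h3
  · refine Prod.ext ?_ ?_
    · exact eq_inv_of_mul_eq_one_left h5
    · simp [stepMap, h3, h4]
  · norm_num at h3

namespace TateFibration

variable {d : ℕ}

/-- Two representatives of a point differ by a number of gluing steps which is the difference of
their moments. -/
theorem exists_stepRel_moment {i j : ZMod d} {x y : ℂ × ℂ} (hx : x ∈ modelDom) (hy : y ∈ modelDom)
    (h : param i x = param j y) :
    ∃ k : ℤ, j = i + k ∧ StepRel k x y ∧ moment y = moment x + k := by
  have key : ∀ a b, Relation.EqvGen (TateStep d) a b → ∃ k : ℤ, b.1 = a.1 + k ∧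
      (Quot.mk (TateStep d) a = Quot.mk _ b ∧ StepRel k a.2.1 b.2.1) ∧
      moment b.2.1 = moment a.2.1 + k := by
    intro a b h
    induction h with
    | rel a b h =>
      have h0 := h
      obtain ⟨h1, h2, h3⟩ := h
      refine ⟨1, by simpa using h1, ⟨Quot.sound h0, ?_⟩, ?_⟩
      · refine ⟨by rw [h3]; field_simp, ?_⟩
        by_cases h0 : a.2.1.1 = 0
        · right
          simp [h0, h3, h2]
        · left
          refine ⟨mul_ne_zero h0 h2, ?_⟩
          rw [h3]
          simp only [zpow_one]
          field_simp
      · rw [h3]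
        simpa using! moment_stepMap a.2.2 h2
    | refl a =>
      refine ⟨0, by simp, ⟨rfl, rfl, ?_⟩, by simp⟩
      by_cases h : a.2.1.1 * a.2.1.2 = 0
      · exact Or.inr ⟨h, Or.inl ⟨rfl, rfl⟩⟩
      · exact Or.inl ⟨h, by simp⟩
    | symm a b _ ih =>
      obtain ⟨k, h1, ⟨h2, h3⟩, h4⟩ := ih
      refine ⟨-k, by rw [h1]; simp, ⟨h2.symm, h3.symm⟩, by rw [h4]; simp⟩
    | trans a b c _ _ ih ih' =>
      obtain ⟨k, h1, ⟨h2, h3⟩, h4⟩ := ih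
      obtain ⟨l, k1, ⟨k2, k3⟩, k4⟩ := ih'
      refine ⟨k + l, by rw [k1, h1]; push_cast; ring, ⟨h2.trans k2, h3.trans k3⟩, ?_⟩
      rw [k4, h4]
      push_cast
      ring
  rw [param_of_mem _ hx, param_of_mem _ hy] at h
  obtain ⟨k, h1, ⟨-, h2⟩, h3⟩ := key _ _ (Quot.eqvGen_exact h)
  exact ⟨k, h1, h2, h3⟩

/-- Two representatives in the window of the same point are equal or related by one gluing step. -/
theorem window_cases {i j : ZMod d} {x y : ℂ × ℂ} (hx : x ∈ window) (hy : y ∈ window)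
    (h : param i x = param j y) :
    (j = i ∧ y = x) ∨ (j = i + 1 ∧ y = stepMap x ∧ moment x < -1 / 6) ∨
      (i = j + 1 ∧ x = stepMap y ∧ moment y < -1 / 6) := by
  obtain ⟨k, h1, h2, h3⟩ := exists_stepRel_moment hx.1 hy.1 h
  obtain ⟨hx1, a1, a2⟩ := hx
  obtain ⟨hy1, b1, b2⟩ := hy
  have hk1 : (-2 : ℝ) < k := by linarith
  have hk2 : (k : ℝ) < 2 := by linarith
  have hk1 : -2 < k := by exact_mod_cast hk1
  have hk2 : k < 2 := by exact_mod_cast hk2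
  obtain rfl | rfl | rfl : k = -1 ∨ k = 0 ∨ k = 1 := by omega
  · right; right
    push_cast at h1 h3
    have ht : moment y < -1 / 6 := by linarith
    refine ⟨by rw [h1]; ring, StepRel_one_eq (by simpa using h2.symm) ?_, ht⟩
    exact snd_ne_zero hy1 (by linarith)
  · left
    exact ⟨by simpa using h1, h2.eq_of_zero.symm⟩
  · right; left
    push_cast at h1 h3
    have ht : moment x < -1 / 6 := by linarith
    exact ⟨h1, StepRel_one_eq h2 (snd_ne_zero hx1 (by linarith)), ht⟩

/-- Every point is represented in the fundamental domain, since the gluing step increases `t` by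
`1`. -/
theorem exists_fundamental (y : TateFibration d) :
    ∃ i, ∃ x ∈ modelDom, param i x = y ∧ -1 / 4 ≤ moment x ∧ moment x < 3 / 4 := by
  have key : ∀ n : ℕ, ∀ (i : ZMod d) (x : ℂ × ℂ), x ∈ modelDom → -1 / 4 - (n : ℝ) ≤ moment x →
      moment x < 3 / 4 + n → ∃ j, ∃ z ∈ modelDom, param j z = param i x ∧ -1 / 4 ≤ moment z ∧
        moment z < 3 / 4 := by
    intro n
    induction n with
    | zero =>
      intro i x hx h1 h2
      simp at h1 h2
      exact ⟨i, x, hx, rfl, h1, h2⟩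
    | succ n ih =>
      intro i x hx h1 h2
      push_cast at h1 h2
      rcases lt_or_ge (moment x) (-1 / 4) with h | h
      · have h0 := snd_ne_zero hx (by linarith)
        have hm := moment_stepMap hx h0
        have hn : (0 : ℝ) ≤ n := Nat.cast_nonneg n
        obtain ⟨j, z, hz, e, hh⟩ := ih (i + 1) (stepMap x) (stepMap_mem hx h0)
          (by rw [hm]; linarith) (by rw [hm]; linarith)
        exact ⟨j, z, hz, e.trans (param_step i hx h0), hh⟩
      · rcases lt_or_ge (moment x) (3 / 4) with h' | h'
        · exact ⟨i, x, hx, rfl, h, h'⟩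
        · have h0 := fst_ne_zero hx (by linarith)
          have hd := mem_of_step_symm hx h0
          have e : stepMap (x.1 ^ 2 * x.2, x.1⁻¹) = x := by
            refine Prod.ext ?_ ?_
            · simp [stepMap]
            · simp [stepMap]
              field_simp
          have hm := moment_stepMap hd (inv_ne_zero h0)
          rw [e] at hm
          have hp := param_step (i - 1) hd (inv_ne_zero h0)
          have e' : param i x = param (i - 1) (x.1 ^ 2 * x.2, x.1⁻¹) := by
            rw [← hp, sub_add_cancel]
            exact congrArg _ e.symm
          have hn : (0 : ℝ) ≤ n := Nat.cast_nonneg n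
          obtain ⟨j, z, hz, e2, hh⟩ := ih (i - 1) _ hd (by linarith) (by linarith)
          exact ⟨j, z, hz, e2.trans e'.symm, hh⟩
  obtain ⟨i, x, hx, rfl⟩ := exists_param y
  obtain ⟨n, hn⟩ := exists_nat_gt |moment x|
  obtain ⟨h1, h2⟩ := abs_lt.1 hn
  exact key n i x hx (by linarith) (by linarith)

/-- A representative of a point of `Y_d` in the fundamental domain `-1/4 ≤ t < 3/4`. -/
def fundamentalRep (y : TateFibration d) : ZMod d × (ℂ × ℂ) :=
  ((exists_fundamental y).choose, (exists_fundamental y).choose_spec.choose)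

theorem fundamentalRep_spec (y : TateFibration d) : (fundamentalRep y).2 ∈ modelDom ∧
    param (fundamentalRep y).1 (fundamentalRep y).2 = y ∧ -1 / 4 ≤ moment (fundamentalRep y).2 ∧
    moment (fundamentalRep y).2 < 3 / 4 :=
  (exists_fundamental y).choose_spec.choose_spec

/-- A function on `Y_d` defined by its values on the window. The value is taken at the chosen
representative; it is the value at any representative in the window if `f` is compatible with the
gluing (`ofWindow_param`). -/
def ofWindow {α : Type*} (f : ZMod d → ℂ × ℂ → α) (y : TateFibration d) : α :=
  f (fundamentalRep y).1 (fundamentalRep y).2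

theorem fundamental_mem_window {x : ℂ × ℂ} (hx : x ∈ modelDom) (h1 : -1 / 4 ≤ moment x)
    (h2 : moment x < 3 / 4) : x ∈ window :=
  ⟨hx, by linarith, by linarith⟩

theorem ofWindow_param {α : Type*} {f : ZMod d → ℂ × ℂ → α}
    (hf : ∀ i, ∀ x ∈ window, moment x < -1 / 6 → f (i + 1) (stepMap x) = f i x)
    (i : ZMod d) {x : ℂ × ℂ} (hx : x ∈ window) : ofWindow f (param i x) = f i x := by
  obtain ⟨h1, h2, h3, h4⟩ := fundamentalRep_spec (param i x)
  have hw := fundamental_mem_window h1 h3 h4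
  unfold ofWindow
  rcases window_cases hx hw h2.symm with ⟨e1, e2⟩ | ⟨e1, e2, e3⟩ | ⟨e1, e2, e3⟩
  · rw [e1, e2]
  · rw [e1, e2, hf i x hx e3]
  · rw [← hf _ _ hw e3, ← e1, ← e2]

/-! ### The functions `X`, `Y` and `L` on `Y_d` -/

/-- The function `X` on `Y_d`. -/
def xFun : TateFibration d → ℂ := ofWindow fun _ => xCoord

/-- The function `Y` on `Y_d`. -/
def yFun : TateFibration d → ℂ := ofWindow fun _ => yCoord

theorem xFun_param (i : ZMod d) {x : ℂ × ℂ} (hx : x ∈ window) : xFun (param i x) = xCoord x :=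
  ofWindow_param (fun _ _ hx h => (coord_stepMap hx h).1) i hx

theorem yFun_param (i : ZMod d) {x : ℂ × ℂ} (hx : x ∈ window) : yFun (param i x) = yCoord x :=
  ofWindow_param (fun _ _ hx h => (coord_stepMap hx h).2) i hx

theorem exists_window (y : TateFibration d) : ∃ i, ∃ x ∈ window, param i x = y := by
  obtain ⟨i, x, hx, h, h1, h2⟩ := exists_fundamental y
  exact ⟨i, x, fundamental_mem_window hx h1 h2, h⟩

theorem proj_param (i : ZMod d) {x : ℂ × ℂ} (hx : x ∈ modelDom) : proj (param i x) = x.1 * x.2 := by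
  rw [param_of_mem i hx]
  rfl

theorem xFun_vadd (k : ZMod d) (y : TateFibration d) : xFun (k +ᵥ y) = xFun y := by
  obtain ⟨i, x, hx, rfl⟩ := exists_window y
  rw [vadd_param, xFun_param _ hx, xFun_param _ hx]

theorem yFun_vadd (k : ZMod d) (y : TateFibration d) : yFun (k +ᵥ y) = yFun y := by
  obtain ⟨i, x, hx, rfl⟩ := exists_window y
  rw [vadd_param, yFun_param _ hx, yFun_param _ hx]

theorem natCast_ne_zero [NeZero d] : (d : ℂ) ≠ 0 := by exact_mod_cast NeZero.ne d

variable [NeZero d]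

/-- A branch of the `d`-th root of `Z = r² e^{i(θ + π)}` on the `i`-th copy of the local model. The
root of unity depending on `i` makes up for the increase of `θ` by `2 π` under the gluing. -/
def rootCoord (i : ZMod d) (x : ℂ × ℂ) : ℂ :=
  Complex.exp ((2 * Real.log (radius x) : ℝ) / d + (angle x + Real.pi : ℝ) / d * Complex.I) *
    ZMod.toCircle (-i)

theorem rootCoord_stepMap (i : ZMod d) {x : ℂ × ℂ} (hx : x ∈ window) (h : moment x < -1 / 6) :
    rootCoord (i + 1) (stepMap x) = rootCoord i x := by
  have h0 := snd_ne_zero hx.1 (by linarith)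
  have h1 : ZMod.toCircle (-(i + 1)) = ZMod.toCircle (-i) * ZMod.toCircle (-1 : ZMod d) := by
    rw [← AddChar.map_add_eq_mul]
    congr 1
    ring
  have h2 : (ZMod.toCircle (-1 : ZMod d) : ℂ) = Complex.exp (-(2 * Real.pi / d * Complex.I)) := by
    have := ZMod.toCircle_intCast (N := d) (-1)
    push_cast at this
    rw [this]
    congr 1
    ring
  unfold rootCoord
  have h3 : Complex.exp ((2 * Real.log (radius x) : ℝ) / d +
      (angle x + 2 * Real.pi + Real.pi : ℝ) / d * Complex.I) *
      Complex.exp (-(2 * Real.pi / d * Complex.I)) =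
      Complex.exp ((2 * Real.log (radius x) : ℝ) / d +
        (angle x + Real.pi : ℝ) / d * Complex.I) := by
    rw [← Complex.exp_add]
    congr 1
    push_cast
    ring
  rw [radius_eq (stepMap_mul h0), angle_stepMap hx.1 h.le (by linarith [hx.2.1]), h1,
    Circle.coe_mul, h2, ← h3]
  ring

/-- The function `L` on `Y_d`, a `d`-th root of `Z`. -/
def lFun : TateFibration d → ℂ := ofWindow rootCoord

theorem lFun_param (i : ZMod d) {x : ℂ × ℂ} (hx : x ∈ window) :
    lFun (param i x) = rootCoord i x :=
  ofWindow_param (fun i _ hx h => rootCoord_stepMap i hx h) i hx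

theorem rootCoord_ne_zero (i : ZMod d) (x : ℂ × ℂ) : rootCoord i x ≠ 0 :=
  mul_ne_zero (Complex.exp_ne_zero _) (Circle.coe_ne_zero _)

theorem toCircle_pow (i : ZMod d) : (ZMod.toCircle i : ℂ) ^ d = 1 := by
  have : ZMod.toCircle i ^ d = 1 := by
    rw [← AddChar.map_nsmul_eq_pow]
    simp
  exact_mod_cast congrArg (Subtype.val : Circle → ℂ) this

theorem rootCoord_pow (i : ZMod d) (x : ℂ × ℂ) : rootCoord i x ^ d = zCoord x := by
  unfold rootCoord zCoord
  rw [mul_pow, toCircle_pow, mul_one, ← Complex.exp_nat_mul, mul_add, ← mul_assoc,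
    mul_div_cancel₀ _ natCast_ne_zero, mul_div_cancel₀ _ natCast_ne_zero, Complex.exp_add,
    Complex.ofReal_add, add_mul, Complex.exp_add, Complex.exp_pi_mul_I]
  have : Complex.exp ((2 * Real.log (radius x) : ℝ) : ℂ) = radius x ^ 2 := by
    rw [← Complex.ofReal_exp, ← Complex.ofReal_pow]
    congr 1
    rw [two_mul, Real.exp_add, Real.exp_log (radius_pos x)]
    ring
  rw [this]
  ring

theorem norm_rootCoord (i : ZMod d) (x : ℂ × ℂ) :
    Real.log ‖rootCoord i x‖ = 2 * Real.log (radius x) / d := by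
  unfold rootCoord
  rw [norm_mul, Circle.norm_coe, mul_one, Complex.norm_exp, Real.log_exp]
  have : (((2 * Real.log (radius x) : ℝ) / d + (angle x + Real.pi : ℝ) / d * Complex.I : ℂ)) =
    ((2 * Real.log (radius x) / d : ℝ) : ℂ) + ((angle x + Real.pi) / d : ℝ) * Complex.I := by
    push_cast
    ring
  rw [this]
  simp [-Complex.ofReal_div, -Complex.ofReal_add, -Complex.ofReal_mul]

theorem contDiffAt_rootCoord (i : ZMod d) {x : ℂ × ℂ} (hx : x ∈ modelDom) :
    ContDiffAt ℝ ∞ (rootCoord i) x := by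
  have h1 := contDiffAt_ofReal
    (contDiffAt_const (c := (2 : ℝ)) |>.mul ((contDiffAt_radius hx).log (radius_pos x).ne'))
  have h2 := contDiffAt_ofReal ((contDiffAt_angle hx).add (contDiffAt_const (c := Real.pi)))
  unfold rootCoord
  simp only [div_eq_mul_inv]
  exact (((h1.mul contDiffAt_const).add ((h2.mul contDiffAt_const).mul contDiffAt_const)).cexp).mul
    contDiffAt_const

theorem lFun_vadd (k : ZMod d) (y : TateFibration d) :
    lFun (k +ᵥ y) = ZMod.toCircle (-k) * lFun y := by
  obtain ⟨i, x, hx, rfl⟩ := exists_window y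
  rw [vadd_param, lFun_param _ hx, lFun_param _ hx]
  unfold rootCoord
  rw [neg_add, AddChar.map_add_eq_mul, Circle.coe_mul]
  ring

theorem lFun_ne_zero (y : TateFibration d) : lFun y ≠ 0 := by
  obtain ⟨i, x, hx, rfl⟩ := exists_window y
  rw [lFun_param _ hx]
  exact rootCoord_ne_zero i x

theorem xFun_mul_yFun (y : TateFibration d) : xFun y * yFun y = lFun y ^ d + 1 := by
  obtain ⟨i, x, hx, rfl⟩ := exists_window y
  rw [xFun_param _ hx, yFun_param _ hx, lFun_param _ hx, rootCoord_pow, xCoord_mul_yCoord hx]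

/-- The projection to the disk in terms of `X`, `Y` and `L`. -/
theorem baseInv_proj (y : TateFibration d) :
    baseInv (proj y) = (‖xFun y‖ ^ 2 - ‖yFun y‖ ^ 2, d * Real.log ‖lFun y‖ / 2) := by
  obtain ⟨i, x, hx, rfl⟩ := exists_window y
  have hd : (d : ℝ) ≠ 0 := by exact_mod_cast NeZero.ne d
  rw [xFun_param _ hx, yFun_param _ hx, lFun_param _ hx, norm_rootCoord, proj_param i hx.1,
    ← baseMap_radius hx.1, baseInv_baseMap, norm_sq_sub_coord hx]
  congr 1
  field_simp

end TateFibration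

/-! ### Points of the local model with given `uv` and angle -/

theorem hyperFlow_ne_zero {x : ℂ × ℂ} (h : x ≠ 0) (s : ℝ) : hyperFlow s x ≠ 0 := by
  intro h1
  apply h
  have h2 : hyperFlow (-s) (hyperFlow s x) = x := by
    rw [← hyperFlow_add, neg_add_cancel, hyperFlow_zero]
  rw [← h2, h1]
  simp [hyperFlow]

theorem strictMono_angle_hyperFlow {x : ℂ × ℂ} (hx : x ∈ modelDom) (h : x ≠ 0) :
    StrictMono fun s => angle (hyperFlow s x) := by
  refine strictMono_of_deriv_pos fun s => ?_
  have hm := hyperFlow_mem (s := s) hx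
  rw [(hasDerivAt_comp_hyperFlow ((contDiffAt_angle hm).differentiableAt (by simp))).deriv]
  exact fderiv_angle_pos hm (hyperFlow_ne_zero h s)

/-- A diagonal matrix of determinant one is the product of a rotation and an element of the real
flow. -/
theorem hyperFlow_rotMap_unitPart {c : ℂ} (hc : c ≠ 0) (x : ℂ × ℂ) :
    hyperFlow (Real.log ‖c‖) (rotMap (unitPart c) x) = (c * x.1, c⁻¹ * x.2) := by
  have h0 : 0 < ‖c‖ := norm_pos_iff.2 hc
  have h0' : (‖c‖ : ℂ) ≠ 0 := by exact_mod_cast h0.ne'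
  have h1 : (‖c‖ : ℂ) * unitPart c = c := norm_mul_unitPart c
  have h2 : c⁻¹ = (‖c‖ : ℂ)⁻¹ * star (unitPart c) := by
    have : unitPart c * star (unitPart c) = 1 := by
      rw [Complex.star_def, Complex.mul_conj, Complex.normSq_eq_norm_sq, norm_unitPart hc]
      simp
    rw [eq_inv_of_mul_eq_one_right this, ← mul_inv, h1]
  simp only [hyperFlow, rotMap, Real.exp_neg, Real.exp_log h0]
  ext
  · simp only
    rw [← mul_assoc, h1]
  · simp only
    rw [h2]
    push_cast
    ring

/-- The product `uv` and the angle determine a point up to rotation. -/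
theorem exists_rotMap_eq {x y : ℂ × ℂ} (hx : x ∈ window) (hy : y ∈ window)
    (hm : x.1 * x.2 = y.1 * y.2) (ha : angle x = angle y) : ∃ c, ‖c‖ = 1 ∧ rotMap c x = y := by
  have hs : sine x = sine y := by unfold sine; rw [ha]
  suffices h : x ≠ 0 → ∃ c : ℂ, c ≠ 0 ∧ y = (c * x.1, c⁻¹ * x.2) by
    by_cases h0 : x = 0
    · refine ⟨1, by simp, ?_⟩
      have h1 : diskCoord y = 0 := by
        rw [diskCoord_eq_zero hy.1, ← hm, h0]
        simp
      rw [eq_zero_of_diskCoord hy h1 (by rw [← hs, h0, sine_zero]), h0]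
      simp [rotMap]
    obtain ⟨c, hc, rfl⟩ := h h0
    rw [← hyperFlow_rotMap_unitPart hc] at ha ⊢
    have hu := norm_unitPart hc
    refine ⟨unitPart c, hu, ?_⟩
    have h1 : hyperFlow 0 (rotMap (unitPart c) x) ≠ 0 := by
      rw [hyperFlow_rotMap]
      intro h1
      have e1 := congrArg Prod.fst h1
      have e2 := congrArg Prod.snd h1
      have hu0 : unitPart c ≠ 0 := norm_ne_zero_iff.1 (by rw [hu]; exact one_ne_zero)
      simp [rotMap, hu0] at e1 e2
      exact h0 (Prod.ext e1 e2)
    rw [hyperFlow_zero] at h1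
    have h2 := (strictMono_angle_hyperFlow (rotMap_mem hu hx.1) h1).injective
      (a₁ := 0) (a₂ := Real.log ‖c‖) (by
        simp only [hyperFlow_zero]
        rw [← ha, angle_rotMap hu hx.1])
    rw [← h2, hyperFlow_zero]
  intro h0
  by_cases hq : x.1 * x.2 = 0
  · -- On the two axes the sign of the angle tells which coordinate is nonzero.
    rcases lt_trichotomy (moment x) 0 with h1 | h1 | h1
    · have h2 : moment y < 0 := by
        by_contra hc
        have := sine_neg hx h1
        rcases (not_lt.1 hc).lt_or_eq with h3 | h3
        · have := sine_pos hy h3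
          linarith
        · rw [hs, (sine_eq_zero hy).2 h3.symm] at this
          exact this.false
      have e1 := snd_ne_zero hx.1 h1
      have e2 := snd_ne_zero hy.1 h2
      have e3 : x.1 = 0 := (mul_eq_zero.1 hq).resolve_right e1
      have e4 : y.1 = 0 := (mul_eq_zero.1 (hm ▸ hq)).resolve_right e2
      refine ⟨x.2 / y.2, div_ne_zero e1 e2, Prod.ext ?_ ?_⟩
      · simp [e3, e4]
      · simp [e1]
    · have : diskCoord x = 0 := (diskCoord_eq_zero hx.1).2 hq
      exact absurd (eq_zero_of_diskCoord hx this ((sine_eq_zero hx).2 h1)) h0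
    · have h2 : 0 < moment y := (sine_pos_iff hy).1 (hs ▸ sine_pos hx h1)
      have e1 := fst_ne_zero hx.1 h1
      have e2 := fst_ne_zero hy.1 h2
      have e3 : x.2 = 0 := (mul_eq_zero.1 hq).resolve_left e1
      have e4 : y.2 = 0 := (mul_eq_zero.1 (hm ▸ hq)).resolve_left e2
      refine ⟨y.1 / x.1, div_ne_zero e2 e1, Prod.ext ?_ ?_⟩
      · simp [e1]
      · simp [e3, e4]
  · have e1 := left_ne_zero_of_mul hq
    have e2 : y.1 ≠ 0 := left_ne_zero_of_mul (hm ▸ hq)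
    refine ⟨y.1 / x.1, div_ne_zero e2 e1, Prod.ext ?_ ?_⟩
    · simp [e1]
    · simp
      field_simp
      linear_combination -hm

theorem continuous_angle_comp {γ : ℝ → ℂ × ℂ} (hγ : Continuous γ) (h : ∀ s, γ s ∈ modelDom) :
    Continuous fun s => angle (γ s) :=
  continuous_iff_continuousAt.2 fun s =>
    ContinuousAt.comp (contDiffAt_angle (h s)).continuousAt hγ.continuousAt

theorem continuous_hyperFlow (x : ℂ × ℂ) : Continuous fun s => hyperFlow s x := by
  unfold hyperFlow
  fun_prop

/-- The moment map at a point which the gluing step reflects. -/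
theorem moment_mk_one {q : ℂ} (hq : ‖q‖ < 1) : moment (q, 1) = -1 / 2 := by
  have hm := mk_one_mem hq
  have h1 := moment_stepMap hm one_ne_zero
  have h2 := moment_swap hm
  have h3 : stepMap (q, 1) = (q, 1).swap := by simp [stepMap]
  rw [h3, h2] at h1
  linarith

/-- For given `q` the angle takes all values in `[-π/2, 3π/2)`, by the intermediate value theorem
along the flow, or along the axes if `q = 0`. -/
theorem exists_mul_eq_angle_eq {q : ℂ} (hq : ‖q‖ < 1) {θ : ℝ} (h1 : -Real.pi / 2 ≤ θ)
    (h2 : θ < 3 * Real.pi / 2) : ∃ x ∈ modelDom, x.1 * x.2 = q ∧ angle x = θ := by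
  have hp := Real.pi_pos
  by_cases h0 : q = 0
  · subst h0
    rcases le_total 0 θ with h | h
    · have hc := continuous_angle_comp (γ := fun a : ℝ => ((a : ℂ), (0 : ℂ))) (by fun_prop)
        fun s => mk_zero_mem _
      have e0 : angle (((0 : ℝ) : ℂ), 0) = 0 := angle_eq_zero (mk_zero_mem _)
        (by rw [moment_mk_zero]; simp)
      have e2 : angle (((2 : ℝ) : ℂ), 0) = 8 * Real.pi / 5 := by
        have : moment (((2 : ℝ) : ℂ), 0) = 4 / 5 := by
          rw [moment_mk_zero, Complex.norm_real]
          norm_num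
        rw [angle_of_le (mk_zero_mem _) (by rw [this, le_abs]; norm_num), this]
        ring
      obtain ⟨a, -, ha⟩ := intermediate_value_Icc (zero_le_two (α := ℝ)) hc.continuousOn
        (show θ ∈ Icc _ _ from ⟨by rw [e0]; exact h, by rw [e2]; linarith⟩)
      exact ⟨_, mk_zero_mem _, by simp, ha⟩
    · have hc := continuous_angle_comp (γ := fun a : ℝ => ((0 : ℂ), (a : ℂ))) (by fun_prop)
        fun s => zero_mk_mem _
      have e0 : angle (0, ((0 : ℝ) : ℂ)) = 0 := angle_eq_zero (zero_mk_mem _)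
        (by rw [moment_zero_mk]; simp)
      have e1 : angle (0, ((1 : ℝ) : ℂ)) = -Real.pi := by
        have : moment (0, ((1 : ℝ) : ℂ)) = -1 / 2 := by
          rw [moment_zero_mk, Complex.norm_real]
          norm_num
        rw [angle_of_le (zero_mk_mem _) (by rw [this, le_abs]; norm_num), this]
        ring
      obtain ⟨a, -, ha⟩ := intermediate_value_Icc' (zero_le_one (α := ℝ)) hc.continuousOn
        (show θ ∈ Icc _ _ from ⟨by rw [e1]; linarith, by rw [e0]; exact h⟩)
      exact ⟨_, zero_mk_mem _, by simp, ha⟩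
  · -- Two gluing steps move `(q, 1)`, where `θ = -π`, along the flow to a point where `θ = 3π`.
    have hm := mk_one_mem hq
    have hm1 := stepMap_mem hm one_ne_zero
    have e1 : stepMap (q, 1) = (1, q) := by simp [stepMap]
    have hq1 : (stepMap (q, 1)).2 ≠ 0 := by rw [e1]; exact h0
    have hm2 := stepMap_mem hm1 hq1
    have t0 := moment_mk_one hq
    have t2 : moment (stepMap (stepMap (q, 1))) = 3 / 2 := by
      rw [moment_stepMap hm1 hq1, moment_stepMap hm one_ne_zero, t0]
      norm_num
    have a0 : angle (q, 1) = -Real.pi := by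
      rw [angle_of_le hm (by rw [t0, le_abs]; norm_num), t0]
      ring
    have a2 : angle (stepMap (stepMap (q, 1))) = 3 * Real.pi := by
      rw [angle_of_le hm2 (by rw [t2, le_abs]; norm_num), t2]
      ring
    have hc0 : (q ^ 2)⁻¹ ≠ 0 := inv_ne_zero (pow_ne_zero 2 h0)
    have e2 : stepMap (stepMap (q, 1)) = ((q ^ 2)⁻¹ * q, (q ^ 2)⁻¹⁻¹ * 1) := by
      rw [e1]
      ext
      · simp [stepMap]
        field_simp
      · simp [stepMap]
    have e3 := hyperFlow_rotMap_unitPart hc0 (q, 1)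
    rw [← e2] at e3
    have hu := norm_unitPart hc0
    have hs : 0 ≤ Real.log ‖(q ^ 2)⁻¹‖ := by
      refine Real.log_nonneg ?_
      rw [norm_inv, norm_pow]
      exact (one_le_inv₀ (pow_pos (norm_pos_iff.2 h0) 2)).2 (pow_le_one₀ (norm_nonneg q) hq.le)
    have hmr := rotMap_mem hu hm
    obtain ⟨s, -, ha⟩ := intermediate_value_Icc hs
      (continuous_angle_comp (continuous_hyperFlow (rotMap (unitPart (q ^ 2)⁻¹) (q, 1)))
        fun s => hyperFlow_mem hmr).continuousOn
      (show θ ∈ Icc _ _ from ⟨by rw [hyperFlow_zero, angle_rotMap hu hm, a0]; linarith,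
        by rw [e3, a2]; linarith⟩)
    exact ⟨_, hyperFlow_mem hmr, by rw [hyperFlow_mul, rotMap_mul hu]; simp, ha⟩

theorem angle_mem_of_moment {x : ℂ × ℂ} (hx : x ∈ modelDom) (h1 : -1 / 4 ≤ moment x)
    (h2 : moment x < 3 / 4) : -Real.pi / 2 ≤ angle x ∧ angle x < 3 * Real.pi / 2 := by
  have hp := Real.pi_pos
  rcases lt_trichotomy (moment x) 0 with h | h | h
  · obtain ⟨a, b⟩ := angle_neg hx h
    constructor <;> nlinarith
  · rw [angle_eq_zero hx h]
    constructor <;> linarith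
  · obtain ⟨a, b⟩ := angle_pos hx h
    constructor <;> nlinarith

theorem moment_mem_of_angle {x : ℂ × ℂ} (hx : x ∈ modelDom) (h1 : -Real.pi / 2 ≤ angle x)
    (h2 : angle x < 3 * Real.pi / 2) : -1 / 4 ≤ moment x ∧ moment x < 3 / 4 := by
  have hp := Real.pi_pos
  constructor
  · by_contra hc
    rw [angle_of_le hx (by rw [le_abs]; right; linarith)] at h1
    nlinarith
  · by_contra hc
    rw [angle_of_le hx (by rw [le_abs]; left; linarith)] at h2
    nlinarith

/-- The angle is determined by its exponential on the fundamental domain. -/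
theorem eq_of_exp_eq {a b : ℝ} (ha : -Real.pi / 2 ≤ a ∧ a < 3 * Real.pi / 2)
    (hb : -Real.pi / 2 ≤ b ∧ b < 3 * Real.pi / 2)
    (h : Complex.exp (a * Complex.I) = Complex.exp (b * Complex.I)) : a = b := by
  obtain ⟨n, hn⟩ := Complex.exp_eq_exp_iff_exists_int.1 h
  have h1 : a = b + n * (2 * Real.pi) := by
    have : (a : ℂ) = b + n * (2 * Real.pi) := by
      apply mul_right_cancel₀ Complex.I_ne_zero
      rw [hn]
      ring
    exact_mod_cast this
  have hp := Real.pi_pos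
  have h2 : (n : ℝ) < 1 := by
    by_contra hc
    nlinarith [ha.2, hb.1]
  have h3 : (-1 : ℝ) < n := by
    by_contra hc
    nlinarith [ha.1, hb.2]
  have h4 : n < 1 := by exact_mod_cast h2
  have h5 : -1 < n := by exact_mod_cast h3
  obtain rfl : n = 0 := by omega
  simpa using h1

theorem rotMap_one (x : ℂ × ℂ) : rotMap 1 x = x := by simp [rotMap]

namespace TateFibration

variable {d : ℕ} [NeZero d]

/-- The functions `X`, `Y` and `L` separate the points of `Y_d`. -/
theorem eq_of_functions_eq {y z : TateFibration d} (hX : xFun y = xFun z) (hY : yFun y = yFun z)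
    (hL : lFun y = lFun z) : y = z := by
  obtain ⟨i, x, hx, rfl, hx1, hx2⟩ := exists_fundamental y
  obtain ⟨j, x', hx', rfl, hx1', hx2'⟩ := exists_fundamental z
  have hw := fundamental_mem_window hx hx1 hx2
  have hw' := fundamental_mem_window hx' hx1' hx2'
  rw [xFun_param _ hw, xFun_param _ hw'] at hX
  rw [yFun_param _ hw, yFun_param _ hw'] at hY
  rw [lFun_param _ hw, lFun_param _ hw'] at hL
  have hZ : zCoord x = zCoord x' := by rw [← rootCoord_pow i x, hL, rootCoord_pow]
  have hq : x.1 * x.2 = x'.1 * x'.2 := by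
    rw [← baseMap_coord hw, ← baseMap_coord hw', hX, hY, hZ]
  have hr := radius_eq hq
  have hr0 : (radius x' : ℂ) ≠ 0 := by exact_mod_cast (radius_pos x').ne'
  have ha : angle x = angle x' := by
    refine eq_of_exp_eq (angle_mem_of_moment hx hx1 hx2) (angle_mem_of_moment hx' hx1' hx2') ?_
    unfold zCoord at hZ
    rw [hr] at hZ
    exact mul_left_cancel₀ (pow_ne_zero 2 hr0) (neg_injective hZ)
  have hij : i = j := by
    unfold rootCoord at hL
    rw [hr, ha] at hL
    have h1 := mul_left_cancel₀ (Complex.exp_ne_zero _) hL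
    have h2 := ZMod.injective_toCircle (Subtype.val_injective h1)
    exact neg_injective h2
  -- The points agree up to a rotation `c`, and `c = 1` unless `X` and `Y` vanish, which happens
  -- only at the node, where rotations are trivial.
  obtain ⟨c, hc, rfl⟩ := exists_rotMap_eq hw hw' hq ha
  rw [(coord_rotMap hc hw).1] at hX
  rw [(coord_rotMap hc hw).2] at hY
  subst hij
  congr 1
  by_cases h1 : c = 1
  · rw [h1, rotMap_one]
  · have h2 : xCoord x = 0 := by
      by_contra h3
      exact h1 (mul_right_cancel₀ h3 (by rw [one_mul]; exact hX.symm))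
    have h3 : yCoord x = 0 := by
      by_contra h3
      have := mul_right_cancel₀ h3 (show conj c * yCoord x = 1 * yCoord x by
        rw [one_mul]; exact hY.symm)
      exact h1 (by simpa using congrArg conj this)
    rw [eq_zero_of_coord_eq_zero hw h2 h3]
    simp only [rotMap, Prod.fst_zero, Prod.snd_zero, mul_zero]
    rfl

theorem eq_of_sq_sub_sq_eq {a b A B : ℝ} (ha : 0 ≤ a) (hA : 0 ≤ A)
    (h1 : a ^ 2 - b ^ 2 = A ^ 2 - B ^ 2) (h2 : a * b = A * B) : a = A := by
  have h3 : (a ^ 2 + b ^ 2) ^ 2 = (A ^ 2 + B ^ 2) ^ 2 := by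
    have : (a * b) ^ 2 = (A * B) ^ 2 := by rw [h2]
    linear_combination (a ^ 2 - b ^ 2 + A ^ 2 - B ^ 2) * h1 + 4 * this
  have h4 := (pow_left_inj₀ (by positivity) (by positivity) two_ne_zero).1 h3
  exact (pow_left_inj₀ ha hA two_ne_zero).1 (by linarith)

/-- Pairs with the same moduli and the same product differ by the circle action of weights
`(1, -1)`. -/
theorem exists_rotation {a b a' b' : ℂ} (h1 : ‖a‖ = ‖a'‖) (h2 : ‖b‖ = ‖b'‖)
    (h3 : a * b = a' * b') : ∃ c : ℂ, ‖c‖ = 1 ∧ c * a = a' ∧ conj c * b = b' := by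
  have key : ∀ {a b a' b' : ℂ}, ‖a‖ = ‖a'‖ → a * b = a' * b' → a ≠ 0 →
      ∃ c : ℂ, ‖c‖ = 1 ∧ c * a = a' ∧ conj c * b = b' := by
    intro a b a' b' h1 h3 ha
    have hc : ‖a' / a‖ = 1 := by rw [norm_div, h1, div_self]; rw [← h1]; simpa using ha
    have hcc : conj (a' / a) * (a' / a) = 1 := by
      rw [mul_comm, Complex.mul_conj, Complex.normSq_eq_norm_sq, hc]
      simp
    have ha' : a' ≠ 0 := by rw [← norm_ne_zero_iff, ← h1]; simpa using ha
    refine ⟨a' / a, hc, by field_simp, ?_⟩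
    rw [eq_inv_of_mul_eq_one_left hcc]
    field_simp
    exact h3
  by_cases ha : a = 0
  · have ha' : a' = 0 := by rw [ha, norm_zero] at h1; exact norm_eq_zero.1 h1.symm
    by_cases hb : b = 0
    · have hb' : b' = 0 := by rw [hb, norm_zero] at h2; exact norm_eq_zero.1 h2.symm
      exact ⟨1, by simp, by simp [ha, ha'], by simp [hb, hb']⟩
    · obtain ⟨c, hc, e1, e2⟩ := key (b := a) (b' := a') h2
        (by rw [mul_comm b, mul_comm b', h3]) hb
      exact ⟨conj c, by rwa [Complex.norm_conj], e2, by rwa [Complex.conj_conj]⟩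
  · exact key h1 h3 ha

/-- The functions `X`, `Y` and `L` map `Y_d` onto the surface `X Y = L ^ d + 1`, `L ≠ 0`. -/
theorem exists_functions_eq {a b l : ℂ} (hl : l ≠ 0) (h : a * b = l ^ d + 1) :
    ∃ y : TateFibration d, xFun y = a ∧ yFun y = b ∧ lFun y = l := by
  have hp := Real.pi_pos
  have hZ : l ^ d ≠ 0 := pow_ne_zero d hl
  have hZn : 0 < ‖l ^ d‖ := norm_pos_iff.2 hZ
  obtain ⟨θ, hθ1, hθ2, hθ⟩ : ∃ θ : ℝ, -Real.pi / 2 ≤ θ ∧ θ < 3 * Real.pi / 2 ∧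
      l ^ d = -(‖l ^ d‖ * Complex.exp (θ * Complex.I)) := by
    have e := Complex.norm_mul_exp_arg_mul_I (-l ^ d)
    rw [norm_neg] at e
    have h1 := Complex.neg_pi_lt_arg (-l ^ d)
    have h2 := Complex.arg_le_pi (-l ^ d)
    rcases lt_or_ge (Complex.arg (-l ^ d)) (-Real.pi / 2) with h3 | h3
    · refine ⟨Complex.arg (-l ^ d) + 2 * Real.pi, by linarith, by linarith, ?_⟩
      push_cast
      rw [add_mul, Complex.exp_add, Complex.exp_two_pi_mul_I, mul_one, e, neg_neg]
    · exact ⟨Complex.arg (-l ^ d), h3, by linarith, by rw [e, neg_neg]⟩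
  -- The point `x` has the given value of `q` and angle, hence of `Z`; then `|X|` and `|Y|` are
  -- determined by `X Y` and `|X|² - |Y|²`, and a rotation adjusts the phases of `X` and `Y`.
  set p : ℝ × ℝ := (‖a‖ ^ 2 - ‖b‖ ^ 2, Real.log ‖l ^ d‖ / 2) with hpdef
  obtain ⟨x, hx, hq, ha⟩ := exists_mul_eq_angle_eq (norm_baseMap_lt p) hθ1 hθ2
  obtain ⟨ht1, ht2⟩ := moment_mem_of_angle hx (ha ▸ hθ1) (ha ▸ hθ2)
  have hw := fundamental_mem_window hx ht1 ht2
  have e1 : (radius x * (diskCoord x).re, Real.log (radius x)) = p := by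
    rw [← baseInv_baseMap (radius x * _, _), baseMap_radius hx, hq, baseInv_baseMap]
  have e2 : radius x * (diskCoord x).re = ‖a‖ ^ 2 - ‖b‖ ^ 2 := congrArg Prod.fst e1
  have e3 : Real.log (radius x) = Real.log ‖l ^ d‖ / 2 := congrArg Prod.snd e1
  have e4 : radius x ^ 2 = ‖l ^ d‖ := by
    refine Real.log_injOn_pos (pow_pos (radius_pos x) 2) hZn ?_
    rw [Real.log_pow, e3]
    push_cast
    ring
  have e5 : zCoord x = l ^ d := by
    rw [hθ, ← e4, ← ha]
    unfold zCoord
    push_cast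
    rfl
  have e6 := xCoord_mul_yCoord hw
  rw [e5, ← h] at e6
  have e7 := norm_sq_sub_coord hw
  rw [e2] at e7
  have e8 : ‖xCoord x‖ * ‖yCoord x‖ = ‖a‖ * ‖b‖ := by rw [← norm_mul, e6, norm_mul]
  have e9 : ‖xCoord x‖ = ‖a‖ := eq_of_sq_sub_sq_eq (norm_nonneg _) (norm_nonneg _) e7 e8
  have e10 : ‖yCoord x‖ = ‖b‖ := eq_of_sq_sub_sq_eq (norm_nonneg _) (norm_nonneg _)
    (by linarith : ‖yCoord x‖ ^ 2 - ‖xCoord x‖ ^ 2 = ‖b‖ ^ 2 - ‖a‖ ^ 2)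
    (by rw [mul_comm, e8, mul_comm])
  obtain ⟨c, hc, e11, e12⟩ := exists_rotation e9 e10 e6
  have hw' := rotMap_mem_window hc hw
  -- The copy of the local model is chosen so that the `d`-th root of `Z` is `l`.
  have hR := rootCoord_ne_zero (0 : ZMod d) (rotMap c x)
  have hlR : (l / rootCoord (0 : ZMod d) (rotMap c x)) ^ d = 1 := by
    rw [div_pow, rootCoord_pow, zCoord_rotMap hc hx, e5, div_self hZ]
  obtain ⟨k, hk⟩ := exists_toCircle_eq (d := d)
    (l := Units.mk0 (l / rootCoord (0 : ZMod d) (rotMap c x)) (div_ne_zero hl hR))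
    (Units.ext (by push_cast; exact hlR))
  have hk' : (ZMod.toCircle k : ℂ) = l / rootCoord (0 : ZMod d) (rotMap c x) :=
    congrArg Units.val hk
  refine ⟨param (-k) (rotMap c x), ?_, ?_, ?_⟩
  · rw [xFun_param _ hw', (coord_rotMap hc hw).1, e11]
  · rw [yFun_param _ hw', (coord_rotMap hc hw).2, e12]
  · have : rootCoord (-k) (rotMap c x) =
        rootCoord (0 : ZMod d) (rotMap c x) * ZMod.toCircle k := by
      unfold rootCoord
      simp
    rw [lFun_param _ hw', this, hk', mul_div_cancel₀ _ hR]

end TateFibration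

/-! ### Vectors indexed by `Fin n` and `Fin (m - n)` -/

/-- The concatenation of a vector of length `n` and a vector of length `m - n`. -/
def joinVec {α : Type*} {m n : ℕ} (a : Fin n → α) (b : Fin (m - n) → α) (k : Fin m) : α :=
  if h : (k : ℕ) < n then a ⟨k, h⟩ else b ⟨k - n, by omega⟩

/-- The index of the `l`-th entry of the second part of a concatenated vector. -/
def tailIndex {m n : ℕ} (l : Fin (m - n)) : Fin m := ⟨n + l, by omega⟩

section

variable {α : Type*} {m n : ℕ}

theorem joinVec_castLE (hmn : n ≤ m) (a : Fin n → α) (b : Fin (m - n) → α) (j : Fin n) :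
    joinVec a b (Fin.castLE hmn j) = a j := by
  simp [joinVec]

theorem joinVec_tailIndex (a : Fin n → α) (b : Fin (m - n) → α) (l : Fin (m - n)) :
    joinVec a b (tailIndex l) = b l := by
  simp [joinVec, tailIndex]

theorem forall_index_iff (hmn : n ≤ m) {p : Fin m → Prop} :
    (∀ k, p k) ↔ (∀ j, p (Fin.castLE hmn j)) ∧ ∀ l : Fin (m - n), p (tailIndex l) := by
  refine ⟨fun h => ⟨fun j => h _, fun l => h _⟩, fun h k => ?_⟩
  by_cases hk : (k : ℕ) < n
  · exact h.1 ⟨k, hk⟩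
  · have h1 : k = tailIndex (n := n) ⟨k - n, by omega⟩ := Fin.ext (by simp [tailIndex]; omega)
    rw [h1]
    exact h.2 _

end

/-- The diagonal entries `d, …, d, 1, …, 1` of `T M'`. -/
def degree (n d : ℕ) {m : ℕ} (k : Fin m) : ℤ := if (k : ℕ) < n then (d : ℤ) else 1

theorem degree_castLE {m n : ℕ} (hmn : n ≤ m) (d : ℕ) (j : Fin n) :
    degree n d (Fin.castLE hmn j) = d := by
  simp [degree]

theorem degree_tailIndex {m n : ℕ} (d : ℕ) (l : Fin (m - n)) :
    degree n d (tailIndex l : Fin m) = 1 := by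
  simp [degree, tailIndex]

/-! ### Monomial maps -/

/-- The expression of `torusHom A` in the coordinates of `ℂ ^ m`. -/
def monomialMap {m : ℕ} (A : Matrix (Fin m) (Fin m) ℤ) (l : Fin m → ℂ) (k : Fin m) : ℂ :=
  ∏ j, l j ^ A k j

section

variable {m : ℕ} {A B : Matrix (Fin m) (Fin m) ℤ}

theorem val_torusHom (A : Matrix (Fin m) (Fin m) ℤ) (l : Fin m → ℂˣ) (k : Fin m) :
    (torusHom A l k : ℂ) = monomialMap A (fun j => l j) k := by
  simp [torusHom, monomialMap]

theorem monomialMap_ne_zero {l : Fin m → ℂ} (hl : ∀ j, l j ≠ 0) (k : Fin m) :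
    monomialMap A l k ≠ 0 :=
  Finset.prod_ne_zero_iff.2 fun j _ => zpow_ne_zero _ (hl j)

theorem monomialMap_mul {l : Fin m → ℂ} (hl : ∀ j, l j ≠ 0) :
    monomialMap A (monomialMap B l) = monomialMap (A * B) l := by
  lift l to Fin m → ℂˣ using fun j => (hl j).isUnit
  have h : monomialMap B (fun j => (l j : ℂ)) = fun k => (torusHom B l k : ℂ) :=
    funext fun k => (val_torusHom B l k).symm
  ext k
  rw [h, ← val_torusHom, ← val_torusHom, torusHom_mul]

theorem monomialMap_diagonal (a : Fin m → ℤ) {l : Fin m → ℂ} (hl : ∀ j, l j ≠ 0) (k : Fin m) :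
    monomialMap (Matrix.diagonal a) l k = l k ^ a k := by
  lift l to Fin m → ℂˣ using fun j => (hl j).isUnit
  rw [← val_torusHom, torusHom_diagonal, Units.val_zpow_eq_zpow_val]

theorem log_norm_monomialMap {l : Fin m → ℂ} (hl : ∀ j, l j ≠ 0) (k : Fin m) :
    Real.log ‖monomialMap A l k‖ = ∑ j, A k j * Real.log ‖l j‖ := by
  unfold monomialMap
  rw [norm_prod, Real.log_prod fun j _ => norm_ne_zero_iff.2 (zpow_ne_zero _ (hl j))]
  simp [Real.log_zpow]

theorem contDiffAt_zpow_complex {z : ℂ} (hz : z ≠ 0) (k : ℤ) :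
    ContDiffAt ℂ ω (fun z : ℂ => z ^ k) z := by
  cases k with
  | ofNat k => simpa using! contDiffAt_id.pow k
  | negSucc k =>
    simp only [zpow_negSucc]
    exact (contDiffAt_id.pow (k + 1)).inv (pow_ne_zero _ hz)

theorem contDiffAt_monomialMap {l : Fin m → ℂ} (hl : ∀ j, l j ≠ 0) :
    ContDiffAt ℝ ∞ (monomialMap A) l := by
  have : ContDiffAt ℂ ω (monomialMap A) l := by
    refine contDiffAt_pi.2 fun k => contDiffAt_prod fun j _ => ?_
    exact (contDiffAt_zpow_complex (hl j) _).comp (f := fun l : Fin m → ℂ => l j) l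
      (contDiff_apply ℂ ℂ j).contDiffAt
  exact (this.restrict_scalars ℝ).of_le le_top

end

/-! ### The diffeomorphism of the bases -/

/-- The logarithmic form of `monomialMap Aᵀ`. -/
def logMap {m : ℕ} (A : Matrix (Fin m) (Fin m) ℤ) (l : Fin m → ℝ) (k : Fin m) : ℝ :=
  ∑ i, A i k * l i

section

variable {m : ℕ}

theorem logMap_eq (A : Matrix (Fin m) (Fin m) ℤ) (l : Fin m → ℝ) :
    logMap A l = (A.map (Int.cast : ℤ → ℝ)).transpose.mulVec l := by
  ext k
  simp [logMap, Matrix.mulVec, dotProduct]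

theorem logMap_injective {A : Matrix (Fin m) (Fin m) ℤ} (hA : A.det ≠ 0) :
    Function.Injective (logMap A) := by
  have h : IsUnit (A.map (Int.cast : ℤ → ℝ)).transpose := by
    rw [Matrix.isUnit_iff_isUnit_det, Matrix.det_transpose, isUnit_iff_ne_zero,
      ← Int.cast_det]
    exact_mod_cast hA
  intro l l' hl
  rw [logMap_eq, logMap_eq] at hl
  exact Matrix.mulVec_injective_iff_isUnit.2 h hl

theorem logMap_logMap {A B : Matrix (Fin m) (Fin m) ℤ} {a : Fin m → ℤ}
    (h : A * B = Matrix.diagonal a) (l : Fin m → ℝ) (k : Fin m) :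
    logMap B (logMap A l) k = a k * l k := by
  have h1 : (B.map (Int.cast : ℤ → ℝ)).transpose * (A.map (Int.cast : ℤ → ℝ)).transpose =
      Matrix.diagonal fun k => (a k : ℝ) := by
    rw [← Matrix.transpose_mul, ← Matrix.map_mul_intCast, h]
    ext i j
    by_cases hij : i = j
    · subst hij; simp
    · simp [Matrix.diagonal_apply_ne _ hij, Matrix.diagonal_apply_ne' _ hij]
  rw [logMap_eq, logMap_eq, Matrix.mulVec_mulVec, h1, Matrix.mulVec_diagonal]

theorem contDiff_logMap (A : Matrix (Fin m) (Fin m) ℤ) : ContDiff ℝ ∞ (logMap A) := by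
  unfold logMap
  fun_prop

end

/-- The map from the base of `h` to `D ^ n × ℝ ^ (m - n)`, in terms of `M'`. -/
def toBase {m n : ℕ} (hmn : n ≤ m) (M' : Matrix (Fin m) (Fin m) ℤ)
    (p : (Fin n → ℝ) × (Fin m → ℝ)) : TateQuotient.polydisk n × (Fin (m - n) → ℝ) :=
  (⟨fun j => baseMap (p.1 j, logMap M' p.2 (Fin.castLE hmn j) / 2),
    fun _ => norm_baseMap_lt _⟩, fun l => logMap M' p.2 (tailIndex l))

/-- The inverse of `toBase`, in terms of `T`. -/
def ofBase {m n : ℕ} (d : ℕ) (T : Matrix (Fin m) (Fin m) ℤ)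
    (p : TateQuotient.polydisk n × (Fin (m - n) → ℝ)) : (Fin n → ℝ) × (Fin m → ℝ) :=
  (fun j => (baseInv (p.1.1 j)).1,
    logMap T (joinVec (fun j => 2 * (baseInv (p.1.1 j)).2 / d) p.2))

section

variable {m n d : ℕ} {hmn : n ≤ m} {M' T : Matrix (Fin m) (Fin m) ℤ}

theorem toBase_ofBase (hd : d ≠ 0) (h : T * M' = Matrix.diagonal (degree n d))
    (p : TateQuotient.polydisk n × (Fin (m - n) → ℝ)) :
    toBase hmn M' (ofBase d T p) = p := by
  have hd : (d : ℝ) ≠ 0 := by exact_mod_cast hd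
  refine Prod.ext (Subtype.ext (funext fun j => ?_)) (funext fun l => ?_)
  · simp only [toBase, ofBase, logMap_logMap h, joinVec_castLE, degree_castLE]
    conv_rhs => rw [← baseMap_baseInv (p.1.2 j)]
    congr 1
    refine Prod.ext rfl ?_
    push_cast
    field_simp
  · simp only [toBase, ofBase, logMap_logMap h, joinVec_tailIndex, degree_tailIndex]
    simp

theorem ofBase_toBase (hd : d ≠ 0) (hM' : M'.det ≠ 0) (h : T * M' = Matrix.diagonal (degree n d))
    (p : (Fin n → ℝ) × (Fin m → ℝ)) : ofBase d T (toBase hmn M' p) = p := by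
  have hd : (d : ℝ) ≠ 0 := by exact_mod_cast hd
  refine Prod.ext (funext fun j => ?_) (logMap_injective hM' (funext ?_))
  · simp only [toBase, ofBase, baseInv_baseMap]
  · simp only [ofBase, logMap_logMap h]
    refine (forall_index_iff hmn).2 ⟨fun j => ?_, fun l => ?_⟩
    · rw [joinVec_castLE, degree_castLE]
      simp only [toBase, baseInv_baseMap]
      push_cast
      field_simp
    · rw [joinVec_tailIndex, degree_tailIndex]
      simp [toBase]

theorem contMDiff_toBase (hmn : n ≤ m) (M' : Matrix (Fin m) (Fin m) ℤ) :
    ContMDiff 𝓘(ℝ, (Fin n → ℝ) × (Fin m → ℝ)) (𝓘(ℝ, Fin n → ℂ).prod 𝓘(ℝ, Fin (m - n) → ℝ)) ∞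
      (toBase hmn M') := by
  have h0 : ContDiff ℝ ∞ fun p : (Fin n → ℝ) × (Fin m → ℝ) => logMap M' p.2 :=
    (contDiff_logMap M').comp contDiff_snd
  have h1 : ContDiff ℝ ∞ fun p : (Fin n → ℝ) × (Fin m → ℝ) => fun j : Fin n =>
      baseMap (p.1 j, logMap M' p.2 (Fin.castLE hmn j) / 2) := by
    refine contDiff_pi.2 fun j => contDiff_baseMap.comp (ContDiff.prodMk ?_ ?_)
    · fun_prop
    · simp only [div_eq_mul_inv]
      exact (contDiff_pi.1 h0 _).mul contDiff_const
  have h2 : ContDiff ℝ ∞ fun p : (Fin n → ℝ) × (Fin m → ℝ) => fun l : Fin (m - n) =>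
      logMap M' p.2 (tailIndex l) := contDiff_pi.2 fun l => contDiff_pi.1 h0 _
  refine ContMDiff.prodMk (fun p => ?_) h2.contMDiff
  rw [contMDiffAt_iff_target]
  exact ⟨IsInducing.subtypeVal.continuousAt_iff.2 h1.continuous.continuousAt,
    h1.contDiffAt.contMDiffAt⟩

theorem contMDiff_ofBase (n d : ℕ) (T : Matrix (Fin m) (Fin m) ℤ) :
    ContMDiff (𝓘(ℝ, Fin n → ℂ).prod 𝓘(ℝ, Fin (m - n) → ℝ)) 𝓘(ℝ, (Fin n → ℝ) × (Fin m → ℝ)) ∞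
      (ofBase (n := n) d T) := by
  have h : ∀ p : (Fin n → ℂ) × (Fin (m - n) → ℝ), (∀ j, ‖p.1 j‖ < 1) →
      ContDiffAt ℝ ∞ (fun p : (Fin n → ℂ) × (Fin (m - n) → ℝ) =>
        ((fun j => (baseInv (p.1 j)).1,
          logMap T (joinVec (fun j => 2 * (baseInv (p.1 j)).2 / d) p.2)) :
            (Fin n → ℝ) × (Fin m → ℝ))) p := by
    intro p hp
    have h1 : ∀ j, ContDiffAt ℝ ∞
        (fun p : (Fin n → ℂ) × (Fin (m - n) → ℝ) => baseInv (p.1 j)) p := fun j =>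
      (contDiffAt_baseInv (hp j)).comp
        (f := fun p : (Fin n → ℂ) × (Fin (m - n) → ℝ) => p.1 j) p (by fun_prop)
    refine (contDiffAt_pi.2 fun j => (h1 j).fst).prodMk
      ((contDiff_logMap T).contDiffAt.comp
        (f := fun p : (Fin n → ℂ) × (Fin (m - n) → ℝ) =>
          joinVec (m := m) (fun j => 2 * (baseInv (p.1 j)).2 / d) p.2) p
            (contDiffAt_pi.2 fun k => ?_))
    unfold joinVec
    split_ifs with hk
    · simp only [div_eq_mul_inv]
      exact (contDiffAt_const.mul (h1 _).snd).mul contDiffAt_const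
    · fun_prop
  intro p
  have h2 : ContMDiffAt (𝓘(ℝ, Fin n → ℂ).prod 𝓘(ℝ, Fin (m - n) → ℝ))
      𝓘(ℝ, (Fin n → ℂ) × (Fin (m - n) → ℝ)) ∞
      (fun p : TateQuotient.polydisk n × (Fin (m - n) → ℝ) => (p.1.1, p.2)) p :=
    ((contMDiff_subtype_val.comp contMDiff_fst).contMDiffAt).prodMk_space contMDiffAt_snd
  exact (h (p.1.1, p.2) p.1.2).contMDiffAt.comp p h2

end

/-- The diffeomorphism from the base of `h` to `D ^ n × ℝ ^ (m - n)`. -/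
def baseDiffeomorph {m n d : ℕ} (hmn : n ≤ m) {M' T : Matrix (Fin m) (Fin m) ℤ} (hd : d ≠ 0)
    (hM' : M'.det ≠ 0) (h : T * M' = Matrix.diagonal (degree n d)) :
    Diffeomorph 𝓘(ℝ, (Fin n → ℝ) × (Fin m → ℝ))
      (𝓘(ℝ, Fin n → ℂ).prod 𝓘(ℝ, Fin (m - n) → ℝ))
      ((Fin n → ℝ) × (Fin m → ℝ)) (TateQuotient.polydisk n × (Fin (m - n) → ℝ)) ∞ where
  toFun := toBase hmn M'
  invFun := ofBase d T
  left_inv := ofBase_toBase hd hM' h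
  right_inv := toBase_ofBase hd h
  contMDiff_toFun := contMDiff_toBase hmn M'
  contMDiff_invFun := contMDiff_ofBase n d T

/-! ### The trivial torus fibration -/

theorem isProperMap_log_norm (k : ℕ) :
    IsProperMap fun (w : algTorus k) (j : Fin k) => Real.log ‖w.1 j‖ := by
  rw [isProperMap_iff_isCompact_preimage]
  constructor
  · refine continuous_pi fun j => Continuous.log ?_ fun w => norm_ne_zero_iff.2 (w.2 j)
    exact ((continuous_apply j).comp continuous_subtype_val).norm
  · intro K hK
    let Φ : (Fin k → ℝ) × (Fin k → ℝ) → algTorus k := fun p =>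
      ⟨fun j => Complex.exp (p.1 j + p.2 j * Complex.I), fun j => Complex.exp_ne_zero _⟩
    have hΦ : Continuous Φ := by
      refine Continuous.subtype_mk ?_ _
      fun_prop
    have hc : IsCompact (K ×ˢ (univ.pi fun _ : Fin k => Icc (-Real.pi) Real.pi)) :=
      hK.prod (isCompact_univ_pi fun _ => isCompact_Icc)
    convert hc.image hΦ using 1
    ext w
    constructor
    · intro hw
      refine ⟨(fun j => Real.log ‖w.1 j‖, fun j => Complex.arg (w.1 j)), ⟨hw, fun j _ =>
        ⟨(Complex.neg_pi_lt_arg _).le, Complex.arg_le_pi _⟩⟩, Subtype.ext (funext fun j => ?_)⟩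
      have h0 : 0 < ‖w.1 j‖ := norm_pos_iff.2 (w.2 j)
      simp only [Φ]
      rw [Complex.exp_add, ← Complex.ofReal_exp, Real.exp_log h0, Complex.norm_mul_exp_arg_mul_I]
    · rintro ⟨p, ⟨hp, -⟩, rfl⟩
      rw [mem_preimage]
      convert hp using 1
      ext j
      simp only [Φ]
      rw [Complex.norm_exp, Real.log_exp]
      simp

open TateFibration

/-! ### The map from `Y_d ^ n / 𝒩(Tᵀ) × (ℂˣ) ^ (m - n)` to `Y(M)` -/

theorem rootVector_eq_joinVec {m n d : ℕ} [NeZero d] (a : Fin n → ZMod d) (k : Fin m) :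
    (rootVector m a k : ℂ) =
      joinVec (m := m) (fun j => (ZMod.toCircle (a j) : ℂ)) (fun _ => 1) k := by
  unfold rootVector joinVec
  split_ifs <;> simp

theorem monomialMap_transpose_mul {m n d : ℕ} {T M' : Matrix (Fin m) (Fin m) ℤ}
    (h : T * M' = Matrix.diagonal (degree n d)) {l : Fin m → ℂ} (hl : ∀ k, l k ≠ 0) (k : Fin m) :
    monomialMap M'.transpose (monomialMap T.transpose l) k = l k ^ degree n d k := by
  rw [monomialMap_mul hl, ← Matrix.transpose_mul, h, Matrix.diagonal_transpose,
    monomialMap_diagonal _ hl]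

variable {m n d : ℕ} [NeZero d]

/-- The vector `(L(y_1), …, L(y_n), w)`. -/
def rootJoin (y : Fin n → TateFibration d) (w : Fin (m - n) → ℂ) : Fin m → ℂ :=
  joinVec (fun j => lFun (y j)) w

theorem rootJoin_ne_zero (y : Fin n → TateFibration d) (w : algTorus (m - n)) (k : Fin m) :
    rootJoin y w.1 k ≠ 0 := by
  unfold rootJoin joinVec
  split_ifs
  · exact lFun_ne_zero _
  · exact w.2 _

theorem rootVector_mul_rootJoin (a : Fin n → ZMod d) (y : Fin n → TateFibration d)
    (w : Fin (m - n) → ℂ) (k : Fin m) :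
    (rootVector m a k : ℂ) * rootJoin (fun j => a j +ᵥ y j) w k = rootJoin y w k := by
  rw [rootVector_eq_joinVec]
  unfold rootJoin joinVec
  split_ifs with h
  · change (ZMod.toCircle (a _) : ℂ) * lFun (a _ +ᵥ y _) = lFun (y _)
    rw [lFun_vadd, ← mul_assoc, ← Circle.coe_mul, ← AddChar.map_add_eq_mul]
    simp
  · simp

/-- The map `Y_d ^ n × (ℂˣ) ^ (m - n) → Y(M)`. -/
def coverMap (T : Matrix (Fin m) (Fin m) ℤ) (y : Fin n → TateFibration d)
    (w : Fin (m - n) → ℂ) : (Fin n → ℂ) × (Fin n → ℂ) × (Fin m → ℂ) :=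
  (fun j => xFun (y j), fun j => yFun (y j), monomialMap T.transpose (rootJoin y w))

variable {T : Matrix (Fin m) (Fin m) ℤ}

theorem monomialMap_rootVector_mul {a : Fin n → ZMod d} (ha : a ∈ deckGroup n d T)
    (l : Fin m → ℂ) :
    monomialMap T.transpose (fun k => rootVector m a k * l k) = monomialMap T.transpose l := by
  have h : torusHom T.transpose (rootVector m a) = 1 := ha
  ext k
  have hk := congrArg (Units.val) (congrFun h k)
  rw [val_torusHom] at hk
  unfold monomialMap at hk ⊢
  simp only [mul_zpow, Finset.prod_mul_distrib, hk]
  simp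

theorem coverMap_vadd {a : Fin n → ZMod d} (ha : a ∈ deckGroup n d T)
    (y : Fin n → TateFibration d) (w : Fin (m - n) → ℂ) :
    coverMap T (fun j => a j +ᵥ y j) w = coverMap T y w := by
  unfold coverMap
  rw [← monomialMap_rootVector_mul ha]
  simp only [xFun_vadd, yFun_vadd, rootVector_mul_rootJoin]

/-- The map `Y_d ^ n / 𝒩(Tᵀ) × (ℂˣ) ^ (m - n) → Y(M)` induced by `coverMap`. -/
def clusterMap (T : Matrix (Fin m) (Fin m) ℤ)
    (p : TateQuotient (deckGroup n d T) × algTorus (m - n)) :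
    (Fin n → ℂ) × (Fin n → ℂ) × (Fin m → ℂ) :=
  Quotient.lift (s := AddAction.orbitRel (deckGroup n d T) (Fin n → TateFibration d))
    (fun y => coverMap T y p.2.1) (by
    intro y z h
    obtain ⟨a, ha, h⟩ := TateQuotient.mk_eq_iff.1
      (Quotient.sound h : TateQuotient.mk _ y = TateQuotient.mk _ z)
    rw [← coverMap_vadd ha z]
    exact congrArg (coverMap T · p.2.1) (funext fun j => (h j).symm)) p.1

theorem clusterMap_mk (y : Fin n → TateFibration d) (w : algTorus (m - n)) :
    clusterMap T (TateQuotient.mk (deckGroup n d T) y, w) = coverMap T y w.1 := rfl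

variable {hmn : n ≤ m} {M' : Matrix (Fin m) (Fin m) ℤ}

theorem clusterMap_mem {M : Matrix (Fin m) (Fin n) ℤ}
    (hM : ∀ i j, M' i (Fin.castLE hmn j) = M i j)
    (h : T * M' = Matrix.diagonal (degree n d))
    (p : TateQuotient (deckGroup n d T) × algTorus (m - n)) :
    clusterMap T p ∈ clusterVariety M := by
  obtain ⟨y, w⟩ := p
  induction y using Quotient.ind with
  | _ y =>
    have hl := rootJoin_ne_zero y w
    refine ⟨fun k => monomialMap_ne_zero hl k, fun j => ?_⟩
    change xFun (y j) * yFun (y j) =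
      ∏ i, monomialMap T.transpose (rootJoin y w.1) i ^ M i j + 1
    have h1 := monomialMap_transpose_mul h hl (Fin.castLE hmn j)
    rw [degree_castLE, zpow_natCast, rootJoin, joinVec_castLE] at h1
    rw [xFun_mul_yFun, ← h1]
    simp [monomialMap, hM, rootJoin]

/-- A point `(a, b, z)` of `Y(M)` is reached by writing `z` as the image of some `l` under `Tᵀ`: the
first `n` entries of `l` are `d`-th roots of the monomials in the equations. -/
theorem exists_clusterMap_eq {M : Matrix (Fin m) (Fin n) ℤ} (hT : T.det ≠ 0)
    (hM : ∀ i j, M' i (Fin.castLE hmn j) = M i j)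
    (h : T * M' = Matrix.diagonal (degree n d))
    {v : (Fin n → ℂ) × (Fin n → ℂ) × (Fin m → ℂ)} (hv : v ∈ clusterVariety M) :
    ∃ p : TateQuotient (deckGroup n d T) × algTorus (m - n), clusterMap T p = v := by
  obtain ⟨a, b, z⟩ := v
  obtain ⟨hz, hab⟩ := hv
  simp only at hz hab
  lift z to Fin m → ℂˣ using fun k => (hz k).isUnit
  obtain ⟨l, rfl⟩ := torusHom_surjective (A := T.transpose) (by rwa [Matrix.det_transpose]) z
  have h0 : ∀ k, (l k : ℂ) ≠ 0 := fun k => (l k).ne_zero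
  have h1 : ∀ j, a j * b j = (l (Fin.castLE hmn j) : ℂ) ^ d + 1 := fun j => by
    have h2 := monomialMap_transpose_mul h h0 (Fin.castLE hmn j)
    rw [degree_castLE, zpow_natCast] at h2
    rw [hab, ← h2]
    simp [monomialMap, hM, val_torusHom]
  choose y hy1 hy2 hy3 using fun j => exists_functions_eq (d := d) (h0 _) (h1 j)
  refine ⟨(TateQuotient.mk _ y, ⟨fun i => l (tailIndex i), fun i => h0 _⟩), ?_⟩
  have h3 : rootJoin y (fun i => (l (tailIndex i) : ℂ)) = fun k => (l k : ℂ) := by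
    refine funext ((forall_index_iff hmn).2 ⟨fun j => ?_, fun i => ?_⟩)
    · rw [rootJoin, joinVec_castLE, hy3]
    · rw [rootJoin, joinVec_tailIndex]
  rw [clusterMap_mk]
  refine Prod.ext (funext hy1) (Prod.ext (funext hy2) (funext fun k => ?_))
  simp only [coverMap]
  rw [h3, val_torusHom]

/-- If two points have the same image, `M'ᵀ` shows that `w` agrees, and the vectors `(L, w)` differ
by an element of the kernel `𝒩(Tᵀ)`, that is, of `(ℤ/d) ^ n`; it moves one point to the other as
`X`, `Y` and `L` separate points. -/
theorem clusterMap_injective {M : Matrix (Fin m) (Fin n) ℤ} (hc : IsCoveringData hmn M d T)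
    (h : T * M' = Matrix.diagonal (degree n d)) :
    Function.Injective (clusterMap (n := n) (d := d) T) := by
  rintro ⟨y, w⟩ ⟨y', w'⟩ e
  induction y using Quotient.ind with
  | _ y =>
  induction y' using Quotient.ind with
  | _ y' =>
    change coverMap T y w.1 = coverMap T y' w'.1 at e
    have hX : ∀ j, xFun (y j) = xFun (y' j) := congrFun (congrArg Prod.fst e)
    have hY : ∀ j, yFun (y j) = yFun (y' j) := congrFun (congrArg (fun p => p.2.1) e)
    have hz : monomialMap T.transpose (rootJoin y w.1) =
      monomialMap T.transpose (rootJoin y' w'.1) := congrArg (fun p => p.2.2) e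
    have hl := rootJoin_ne_zero y w
    have hl' := rootJoin_ne_zero y' w'
    have hw : w = w' := by
      refine Subtype.ext (funext fun i => ?_)
      have h1 := monomialMap_transpose_mul h hl (tailIndex i)
      have h2 := monomialMap_transpose_mul h hl' (tailIndex i)
      rw [degree_tailIndex, zpow_one, rootJoin, joinVec_tailIndex] at h1 h2
      rw [← h1, ← h2]
      exact congrFun (congrArg _ hz) _
    subst hw
    let l : Fin m → ℂˣ := fun k => Units.mk0 _ (hl k)
    let l' : Fin m → ℂˣ := fun k => Units.mk0 _ (hl' k)
    have hk : l' * l⁻¹ ∈ (torusHom T.transpose).ker := by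
      rw [MonoidHom.mem_ker, map_mul, map_inv, mul_inv_eq_one]
      ext k
      rw [val_torusHom, val_torusHom]
      exact congrFun hz.symm k
    obtain ⟨a, ha⟩ := exists_rootVector_eq hc hk
    have ha' : a ∈ deckGroup n d T := by
      change rootVector m a ∈ (torusHom T.transpose).ker
      rwa [ha]
    refine Prod.ext (TateQuotient.mk_eq_iff.2 ⟨a, ha', fun j => ?_⟩) rfl
    refine eq_of_functions_eq ?_ ?_ ?_
    · rw [xFun_vadd, hX]
    · rw [yFun_vadd, hY]
    · have h1 := rootVector_mul_rootJoin a y' w.1 (Fin.castLE hmn j)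
      have h2 : (rootVector m a (Fin.castLE hmn j) : ℂ) * rootJoin y w.1 (Fin.castLE hmn j) =
          rootJoin y' w.1 (Fin.castLE hmn j) := by
        rw [ha]
        simp [l, l', hl]
      have h3 := mul_left_cancel₀ (Units.ne_zero _) (h1.trans h2.symm)
      rwa [rootJoin, rootJoin, joinVec_castLE, joinVec_castLE] at h3

/-- The map `h` corresponds to the product of the projection and the torus fibration. -/
theorem toBase_lagrangianMap (h : T * M' = Matrix.diagonal (degree n d))
    (y : TateQuotient (deckGroup n d T)) (w : algTorus (m - n)) :
    toBase hmn M' (lagrangianMap (clusterMap T (y, w))) =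
      (TateQuotient.proj (deckGroup n d T) y, fun k => Real.log ‖w.1 k‖) := by
  induction y using Quotient.ind with
  | _ y =>
    have hl := rootJoin_ne_zero y w
    have h1 : (fun k => Real.log ‖monomialMap T.transpose (rootJoin y w.1) k‖) =
        logMap T fun k => Real.log ‖rootJoin y w.1 k‖ := funext fun k =>
      log_norm_monomialMap hl k
    have h2 : lagrangianMap (coverMap T y w.1) =
        (fun j => ‖xFun (y j)‖ ^ 2 - ‖yFun (y j)‖ ^ 2,
          logMap T fun k => Real.log ‖rootJoin y w.1 k‖) := Prod.ext rfl h1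
    change toBase hmn M' (lagrangianMap (coverMap T y w.1)) = _
    rw [h2]
    refine Prod.ext (Subtype.ext (funext fun j => ?_)) (funext fun i => ?_)
    · simp only [toBase, logMap_logMap h, degree_castLE, rootJoin, joinVec_castLE]
      have h3 := baseInv_proj (y j)
      change _ = proj (y j)
      rw [← baseMap_baseInv (norm_proj_lt (y j)), h3]
      push_cast
      rfl
    · simp only [toBase, logMap_logMap h, degree_tailIndex, rootJoin, joinVec_tailIndex]
      simp

/-! ### Smoothness and immersivity -/

/-- A map which locally factors as an immersion between vector spaces after local coordinates `p`
(with local inverse `s`) is an immersion. -/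
theorem injective_mfderiv_of_eventuallyEq_comp {B H X P V : Type*} [NormedAddCommGroup B]
    [NormedSpace ℝ B] [TopologicalSpace H] {I : ModelWithCorners ℝ B H} [TopologicalSpace X]
    [ChartedSpace H X] [NormedAddCommGroup P] [NormedSpace ℝ P] [NormedAddCommGroup V]
    [NormedSpace ℝ V] {f : X → V} {p : X → P} {s : P → X} {F : P → V} {x : X}
    (hf : f =ᶠ[𝓝 x] F ∘ p) (hp : MDifferentiableAt I 𝓘(ℝ, P) p x)
    (hs : MDifferentiableAt 𝓘(ℝ, P) I s (p x)) (hsp : s ∘ p =ᶠ[𝓝 x] id)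
    (hF : DifferentiableAt ℝ F (p x)) (hi : ∀ ξ, fderiv ℝ F (p x) ξ = 0 → ξ = 0) :
    Function.Injective (mfderiv I 𝓘(ℝ, V) f x) := by
  have h1 : Function.Injective (mfderiv I 𝓘(ℝ, P) p x) := by
    have h2 := hsp.mfderiv_eq (I := I) (I' := I)
    rw [mfderiv_comp x hs hp, mfderiv_id] at h2
    intro ξ ξ' h
    have h3 := congrArg (mfderiv 𝓘(ℝ, P) I s (p x)) h
    exact (DFunLike.congr_fun h2 ξ).symm.trans (h3.trans (DFunLike.congr_fun h2 ξ'))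
  rw [hf.mfderiv_eq, mfderiv_comp x hF.mdifferentiableAt hp, mfderiv_eq_fderiv]
  exact ((injective_iff_map_eq_zero _).2 hi).comp h1

theorem exists_window_param {n d : ℕ} {Γ : AddSubgroup (Fin n → ZMod d)} (y : TateQuotient Γ) :
    ∃ (i : Fin n → ZMod d) (x : Fin n → ℂ × ℂ), (∀ j, x j ∈ window) ∧
      TateQuotient.param Γ i x = y := by
  induction y using Quotient.ind with
  | _ y =>
    choose i x hx h using fun j => TateFibration.exists_window (y j)
    exact ⟨i, x, hx, congrArg (TateQuotient.mk Γ) (funext h)⟩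

variable {m n d : ℕ} [NeZero d]

open TateFibration

/-- The expression of `clusterMap` in the coordinates of the local models. -/
def localMap (T : Matrix (Fin m) (Fin m) ℤ) (i : Fin n → ZMod d)
    (p : (Fin n → ℂ × ℂ) × (Fin (m - n) → ℂ)) : (Fin n → ℂ) × (Fin n → ℂ) × (Fin m → ℂ) :=
  (fun j => xCoord (p.1 j), fun j => yCoord (p.1 j),
    monomialMap T.transpose (joinVec (fun j => rootCoord (i j) (p.1 j)) p.2))

variable {T : Matrix (Fin m) (Fin m) ℤ} {i : Fin n → ZMod d}
  {p : (Fin n → ℂ × ℂ) × (Fin (m - n) → ℂ)}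

theorem joinVec_rootCoord_ne_zero (hp : ∀ l, p.2 l ≠ 0) (k : Fin m) :
    joinVec (fun j => rootCoord (i j) (p.1 j)) p.2 k ≠ 0 := by
  unfold joinVec
  split_ifs
  · exact rootCoord_ne_zero _ _
  · exact hp _

theorem contDiffAt_fst_apply (p : (Fin n → ℂ × ℂ) × (Fin (m - n) → ℂ)) (j : Fin n) :
    ContDiffAt ℝ ∞ (fun p : (Fin n → ℂ × ℂ) × (Fin (m - n) → ℂ) => p.1 j) p :=
  (contDiffAt_pi.1 contDiffAt_fst) j

theorem contDiffAt_localMap (hw : ∀ j, p.1 j ∈ window) (hp : ∀ l, p.2 l ≠ 0) :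
    ContDiffAt ℝ ∞ (localMap T i) p := by
  refine ContDiffAt.prodMk (contDiffAt_pi.2 fun j => ?_)
    (ContDiffAt.prodMk (contDiffAt_pi.2 fun j => ?_) ?_)
  · exact (contDiffAt_coord (hw j)).1.comp p (contDiffAt_fst_apply p j)
  · exact (contDiffAt_coord (hw j)).2.comp p (contDiffAt_fst_apply p j)
  · refine (contDiffAt_monomialMap (joinVec_rootCoord_ne_zero hp)).comp
      (f := fun p : (Fin n → ℂ × ℂ) × (Fin (m - n) → ℂ) =>
        joinVec (m := m) (fun j => rootCoord (i j) (p.1 j)) p.2) p (contDiffAt_pi.2 fun k => ?_)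
    unfold joinVec
    split_ifs with hk
    · exact (contDiffAt_rootCoord (i ⟨k, hk⟩) (hw _).1).comp p (contDiffAt_fst_apply p _)
    · exact (contDiffAt_pi.1 contDiffAt_snd) _

/-- The functions `X_j`, `Y_j` are components of `localMap`, and applying `M'ᵀ` to the torus
component recovers `Z_j = L_j ^ d` and `w`; these functions have no common kernel vector. -/
theorem eq_zero_of_fderiv_localMap {M' : Matrix (Fin m) (Fin m) ℤ} (hmn : n ≤ m)
    (h : T * M' = Matrix.diagonal (degree n d)) (hw : ∀ j, p.1 j ∈ window)
    (hp : ∀ l, p.2 l ≠ 0) (ξ : (Fin n → ℂ × ℂ) × (Fin (m - n) → ℂ))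
    (h0 : fderiv ℝ (localMap T i) p ξ = 0) : ξ = 0 := by
  have hF := (contDiffAt_localMap (T := T) (i := i) hw hp).differentiableAt (by simp)
  have hev : ∀ᶠ q : (Fin n → ℂ × ℂ) × (Fin (m - n) → ℂ) in 𝓝 p, ∀ l, q.2 l ≠ 0 :=
    eventually_all.2 fun l => ContinuousAt.eventually_ne (by fun_prop) (hp l)
  have hj : ∀ (j : Fin n) (g : ℂ × ℂ → ℂ), DifferentiableAt ℝ g (p.1 j) →
      fderiv ℝ (fun q : (Fin n → ℂ × ℂ) × (Fin (m - n) → ℂ) => g (q.1 j)) p ξ = 0 →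
      fderiv ℝ g (p.1 j) (ξ.1 j) = 0 := by
    intro j g hg h1
    have h2 := fderiv_comp (f := fun q : (Fin n → ℂ × ℂ) × (Fin (m - n) → ℂ) => q.1 j) p hg
      ((contDiffAt_fst_apply p j).differentiableAt (by simp))
    have h3 : HasFDerivAt (fun q : (Fin n → ℂ × ℂ) × (Fin (m - n) → ℂ) => q.1 j)
        ((ContinuousLinearMap.proj (R := ℝ) (φ := fun _ : Fin n => ℂ × ℂ) j).comp
          (ContinuousLinearMap.fst ℝ _ _)) p :=
      ((ContinuousLinearMap.proj (R := ℝ) (φ := fun _ : Fin n => ℂ × ℂ) j).comp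
        (ContinuousLinearMap.fst ℝ (Fin n → ℂ × ℂ) (Fin (m - n) → ℂ))).hasFDerivAt
    rw [h3.fderiv] at h2
    exact (DFunLike.congr_fun h2 ξ).symm.trans h1
  have hz : ∀ k, DifferentiableAt ℝ (fun v : (Fin n → ℂ) × (Fin n → ℂ) × (Fin m → ℂ) =>
      monomialMap M'.transpose v.2.2 k) (localMap T i p) := by
    intro k
    have h1 := contDiffAt_pi.1 (contDiffAt_monomialMap (A := M'.transpose)
      (l := (localMap T i p).2.2)
      fun k => monomialMap_ne_zero (joinVec_rootCoord_ne_zero hp) k) k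
    exact (h1.differentiableAt (by simp)).comp
      (f := fun v : (Fin n → ℂ) × (Fin n → ℂ) × (Fin m → ℂ) => v.2.2) _ (by fun_prop)
  have hk : ∀ {g : (Fin n → ℂ × ℂ) × (Fin (m - n) → ℂ) → ℂ} (k : Fin m),
      (∀ q : (Fin n → ℂ × ℂ) × (Fin (m - n) → ℂ),
        joinVec (fun j => rootCoord (i j) (q.1 j)) q.2 k ^ degree n d k = g q) →
      fderiv ℝ g p ξ = 0 := by
    intro g k hg
    refine fderiv_apply_eq_zero_of_comp hF (hz k) ?_ h0
    filter_upwards [hev] with q hq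
    exact (hg q).symm.trans
      (monomialMap_transpose_mul h (joinVec_rootCoord_ne_zero hq) k).symm
  refine Prod.ext (funext fun j => ?_) (funext fun l => ?_)
  · refine eq_zero_of_fderiv_coord (hw j) (hj j _ ?_ ?_) (hj j _ ?_ ?_) (hj j _ ?_ ?_)
    · exact (contDiffAt_coord (hw j)).1.differentiableAt (by simp)
    · exact fderiv_apply_eq_zero_of_comp (f := localMap T i) (h := fun v => v.1 j) hF
        (by fun_prop) (Eventually.of_forall fun q => rfl) h0
    · exact (contDiffAt_coord (hw j)).2.differentiableAt (by simp)
    · exact fderiv_apply_eq_zero_of_comp (f := localMap T i) (h := fun v => v.2.1 j) hF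
        (by fun_prop) (Eventually.of_forall fun q => rfl) h0
    · exact (contDiffAt_zCoord (hw j).1).differentiableAt (by simp)
    · refine hk (Fin.castLE hmn j) fun q => ?_
      rw [joinVec_castLE, degree_castLE, zpow_natCast, rootCoord_pow]
  · have h1 := hk (g := fun q => q.2 l) (tailIndex l) fun q => by
      rw [joinVec_tailIndex, degree_tailIndex, zpow_one]
    have h3 : HasFDerivAt (fun q : (Fin n → ℂ × ℂ) × (Fin (m - n) → ℂ) => q.2 l)
        ((ContinuousLinearMap.proj (R := ℝ) (φ := fun _ : Fin (m - n) => ℂ) l).comp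
          (ContinuousLinearMap.snd ℝ _ _)) p :=
      ((ContinuousLinearMap.proj (R := ℝ) (φ := fun _ : Fin (m - n) => ℂ) l).comp
        (ContinuousLinearMap.snd ℝ (Fin n → ℂ × ℂ) (Fin (m - n) → ℂ))).hasFDerivAt
    rw [h3.fderiv] at h1
    exact h1

theorem clusterMap_param {x : Fin n → ℂ × ℂ} (hx : ∀ j, x j ∈ window) (w : algTorus (m - n)) :
    clusterMap T (TateQuotient.param (deckGroup n d T) i x, w) = localMap T i (x, w.1) := by
  rw [TateQuotient.param, clusterMap_mk, coverMap, localMap]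
  simp only [rootJoin, xFun_param _ (hx _), yFun_param _ (hx _), lFun_param _ (hx _)]

/-- Near each point, `clusterMap` is the composition of `localMap` with local coordinates `c`,
the latter having the local inverse `s`. -/
theorem exists_localCoordinates (T : Matrix (Fin m) (Fin m) ℤ)
    (p : TateQuotient (deckGroup n d T) × algTorus (m - n)) :
    ∃ (i : Fin n → ZMod d)
      (c : TateQuotient (deckGroup n d T) × algTorus (m - n) →
        (Fin n → ℂ × ℂ) × (Fin (m - n) → ℂ))
      (s : (Fin n → ℂ × ℂ) × (Fin (m - n) → ℂ) →
        TateQuotient (deckGroup n d T) × algTorus (m - n)),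
      (∀ j, (c p).1 j ∈ window) ∧ (∀ l, (c p).2 l ≠ 0) ∧
      clusterMap T =ᶠ[𝓝 p] localMap T i ∘ c ∧
      ContMDiffAt (𝓘(ℝ, Fin n → ℂ × ℂ).prod 𝓘(ℝ, Fin (m - n) → ℂ))
        𝓘(ℝ, (Fin n → ℂ × ℂ) × (Fin (m - n) → ℂ)) ∞ c p ∧
      MDifferentiableAt 𝓘(ℝ, (Fin n → ℂ × ℂ) × (Fin (m - n) → ℂ))
        (𝓘(ℝ, Fin n → ℂ × ℂ).prod 𝓘(ℝ, Fin (m - n) → ℂ)) s (c p) ∧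
      s ∘ c =ᶠ[𝓝 p] id := by
  obtain ⟨y, w⟩ := p
  obtain ⟨i, x, hx, rfl⟩ := exists_window_param y
  have hxd : x ∈ (TateQuotient.etaleAtlas (deckGroup n d T)).dom := fun j _ => (hx j).1
  obtain ⟨e, he, hxe, hei'⟩ := (TateQuotient.etaleAtlas (deckGroup n d T)).exists_chart_param i hxd
  have hei : ∀ z, e.symm z = TateQuotient.param (deckGroup n d T) i z := hei'
  have : IsManifold 𝓘(ℝ, Fin n → ℂ × ℂ) ∞ (TateQuotient (deckGroup n d T)) := .of_le (n := ω) le_top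
  have hy : TateQuotient.param (deckGroup n d T) i x ∈ e.source := hei x ▸ e.map_target hxe
  have hex : e (TateQuotient.param (deckGroup n d T) i x) = x := by rw [← hei, e.right_inv hxe]
  have he1 : ContMDiffAt 𝓘(ℝ, Fin n → ℂ × ℂ) 𝓘(ℝ, Fin n → ℂ × ℂ) ∞ e
      (TateQuotient.param (deckGroup n d T) i x) :=
    (contMDiffOn_of_mem_maximalAtlas (IsManifold.subset_maximalAtlas he)).contMDiffAt
      (e.open_source.mem_nhds hy)
  have he2 : ContMDiffAt 𝓘(ℝ, Fin n → ℂ × ℂ) 𝓘(ℝ, Fin n → ℂ × ℂ) ∞ e.symm x :=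
    (contMDiffOn_symm_of_mem_maximalAtlas (IsManifold.subset_maximalAtlas he)).contMDiffAt
      (e.open_target.mem_nhds hxe)
  let e' := chartAt (Fin (m - n) → ℂ) w
  have hw' : w ∈ e'.source := mem_chart_source _ w
  have hval : ∀ z, e' z = z.1 := fun z => rfl
  have he' : ContMDiffAt 𝓘(ℝ, Fin (m - n) → ℂ) 𝓘(ℝ, Fin (m - n) → ℂ) ∞ e'.symm w.1 :=
    (contMDiffOn_symm_of_mem_maximalAtlas (IsManifold.subset_maximalAtlas
      (chart_mem_atlas _ w))).contMDiffAt (e'.open_target.mem_nhds (e'.map_source hw'))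
  refine ⟨i, fun p => (e p.1, p.2.1), fun z => (e.symm z.1, e'.symm z.2), ?_, fun l => w.2 l, ?_,
    ?_, ?_, ?_⟩
  · intro j
    change e (TateQuotient.param (deckGroup n d T) i x) j ∈ window
    rw [hex]
    exact hx j
  · have h1 : ∀ᶠ p : TateQuotient (deckGroup n d T) × algTorus (m - n) in
        𝓝 (TateQuotient.param (deckGroup n d T) i x, w),
        p.1 ∈ e.source ∧ ∀ j, e p.1 j ∈ window := by
      have h2 : ∀ᶠ z in 𝓝 (e (TateQuotient.param (deckGroup n d T) i x)), ∀ j, z j ∈ window := by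
        rw [hex]
        exact eventually_all.2 fun j =>
          (continuous_apply j).continuousAt.eventually (eventually_mem_window (hx j))
      have h3 := (e.continuousAt hy).eventually h2
      exact (continuousAt_fst (p := (TateQuotient.param (deckGroup n d T) i x, w))).eventually
        ((e.open_source.eventually_mem hy).and h3)
    filter_upwards [h1] with p hp
    obtain ⟨z, v⟩ := p
    rw [Function.comp_apply, ← clusterMap_param hp.2, ← hei, e.left_inv hp.1]
  · exact (ContMDiffAt.comp (f := Prod.fst) (TateQuotient.param (deckGroup n d T) i x, w) he1
      contMDiffAt_fst).prodMk_space (contMDiff_subtype_val.comp contMDiff_snd).contMDiffAt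
  · change MDifferentiableAt _ _ (fun z => (e.symm z.1, e'.symm z.2))
      (e (TateQuotient.param (deckGroup n d T) i x), w.1)
    rw [hex]
    exact ((he2.mdifferentiableAt (by simp)).comp (f := Prod.fst) (x, w.1)
      differentiableAt_fst.mdifferentiableAt).prodMk
        ((he'.mdifferentiableAt (by simp)).comp (f := Prod.snd) (x, w.1)
          differentiableAt_snd.mdifferentiableAt)
  · have h1 : ∀ᶠ p : TateQuotient (deckGroup n d T) × algTorus (m - n) in
        𝓝 (TateQuotient.param (deckGroup n d T) i x, w),
        p.1 ∈ e.source ∧ p.2 ∈ e'.source :=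
      (continuousAt_fst.eventually (e.open_source.mem_nhds hy)).and
        (continuousAt_snd.eventually (e'.open_source.mem_nhds hw'))
    filter_upwards [h1] with p hp
    exact Prod.ext (e.left_inv hp.1) (e'.left_inv hp.2)

theorem contMDiff_clusterMap (T : Matrix (Fin m) (Fin m) ℤ) :
    ContMDiff (𝓘(ℝ, Fin n → ℂ × ℂ).prod 𝓘(ℝ, Fin (m - n) → ℂ))
      𝓘(ℝ, (Fin n → ℂ) × (Fin n → ℂ) × (Fin m → ℂ)) ∞ (clusterMap (n := n) (d := d) T) := by
  intro p
  obtain ⟨i, c, s, h1, h2, h3, h4, -⟩ := exists_localCoordinates T p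
  exact ((contDiffAt_localMap h1 h2).contMDiffAt.comp p h4).congr_of_eventuallyEq h3

theorem injective_mfderiv_clusterMap {M' : Matrix (Fin m) (Fin m) ℤ} (hmn : n ≤ m)
    (h : T * M' = Matrix.diagonal (degree n d))
    (p : TateQuotient (deckGroup n d T) × algTorus (m - n)) :
    Function.Injective (mfderiv (𝓘(ℝ, Fin n → ℂ × ℂ).prod 𝓘(ℝ, Fin (m - n) → ℂ))
      𝓘(ℝ, (Fin n → ℂ) × (Fin n → ℂ) × (Fin m → ℂ)) (clusterMap T) p) := by
  obtain ⟨i, c, s, h1, h2, h3, h4, h5, h6⟩ := exists_localCoordinates T p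
  exact injective_mfderiv_of_eventuallyEq_comp h3 (h4.mdifferentiableAt (by simp)) h5 h6
    ((contDiffAt_localMap h1 h2).differentiableAt (by simp))
    (eq_zero_of_fderiv_localMap hmn h h1 h2)

/-- The map to the open set `z ≠ 0`, on which `h` is defined and continuous, is proper since its
composition with `h` is. An injective proper map is a closed embedding. -/
theorem isEmbedding_clusterMap {hmn : n ≤ m} {M : Matrix (Fin m) (Fin n) ℤ}
    {M' : Matrix (Fin m) (Fin m) ℤ} (hc : IsCoveringData hmn M d T)
    (h : T * M' = Matrix.diagonal (degree n d)) :
    IsEmbedding (clusterMap (n := n) (d := d) T) := by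
  let U : Set ((Fin n → ℂ) × (Fin n → ℂ) × (Fin m → ℂ)) := {v | ∀ k, v.2.2 k ≠ 0}
  have hU : ∀ p, clusterMap (n := n) (d := d) T p ∈ U := by
    rintro ⟨y, w⟩
    induction y using Quotient.ind with
    | _ y => exact fun k => monomialMap_ne_zero (rootJoin_ne_zero y w) k
  have hf := (contMDiff_clusterMap (n := n) (d := d) T).continuous
  let f : TateQuotient (deckGroup n d T) × algTorus (m - n) → U := fun p => ⟨_, hU p⟩
  have hf' : Continuous f := hf.subtype_mk _
  have hg : Continuous fun v : U => toBase hmn M' (lagrangianMap v.1) := by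
    refine (contMDiff_toBase hmn M').continuous.comp (Continuous.prodMk (by fun_prop) ?_)
    exact continuous_pi fun k => Continuous.log (by fun_prop) fun v =>
      norm_ne_zero_iff.2 (v.2 k)
  have hP : IsProperMap ((fun v : U => toBase hmn M' (lagrangianMap v.1)) ∘ f) := by
    have := (TateQuotient.isProperMap_proj (deckGroup n d T)).prodMap
      (isProperMap_log_norm (m - n))
    convert this using 1
    exact funext fun p => toBase_lagrangianMap h p.1 p.2
  have hfp := isProperMap_of_comp_of_t2 hf' hg hP
  have hfi : Function.Injective f := fun p q e =>
    clusterMap_injective hc h (congrArg Subtype.val e)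
  exact IsEmbedding.subtypeVal.comp
    (IsClosedEmbedding.of_continuous_injective_isClosedMap hf' hfi hfp.isClosedMap).isEmbedding

end IsolatedCluster

end

open IsolatedCluster
theorem proposition3p8 {m n : ℕ} (hmn : n ≤ m) (M : Matrix (Fin m) (Fin n) ℤ)
    (hM : (M.map (Int.cast : ℤ → ℚ)).rank = n) :
    -- suitable `d` and `T` exist
    (∃ (d : ℕ) (T : Matrix (Fin m) (Fin m) ℤ), IsCoveringData hmn M d T) ∧
    -- and, for all of them,
    ∀ (d : ℕ) [NeZero d] (T : Matrix (Fin m) (Fin m) ℤ), IsCoveringData hmn M d T →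
      -- `𝒩(Tᵀ)` is a finite group, contained in `(ℤ/d) ^ n`
      (Finite (torusHom T.transpose).ker ∧
        ∀ l ∈ (torusHom T.transpose).ker, ∃ a : Fin n → ZMod d, rootVector m a = l) ∧
      -- `Y_d ^ n / 𝒩(Tᵀ) → D ^ n` is a proper holomorphic map of Kähler manifolds, the quotient
      -- of the product of `n` copies of `Y_d` by automorphisms of Kähler manifolds
      (ContMDiff 𝓘(ℂ, Fin n → ℂ × ℂ) 𝓘(ℂ, Fin n → ℂ) ω (TateQuotient.proj (deckGroup n d T)) ∧
        IsProperMap (TateQuotient.proj (deckGroup n d T)) ∧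
        ∃ η : KahlerForm (ℂ × ℂ) (TateFibration d),
          (∀ k : ZMod d, η.IsPreservedBy fun y => k +ᵥ y) ∧
          ∃ Θ : KahlerForm (Fin n → ℂ × ℂ) (TateQuotient (deckGroup n d T)),
            TateQuotient.IsInducedBy Θ η) ∧
      -- and `h` is its Cartesian product with `(ℂˣ) ^ (m - n) → ℝ ^ (m - n)`
      ∃ (f : TateQuotient (deckGroup n d T) × algTorus (m - n) →
            (Fin n → ℂ) × (Fin n → ℂ) × (Fin m → ℂ))
        (g : Diffeomorph 𝓘(ℝ, (Fin n → ℝ) × (Fin m → ℝ))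
            (𝓘(ℝ, Fin n → ℂ).prod 𝓘(ℝ, Fin (m - n) → ℝ))
            ((Fin n → ℝ) × (Fin m → ℝ)) (TateQuotient.polydisk n × (Fin (m - n) → ℝ)) ∞),
        IsDiffeoOnto (𝓘(ℝ, Fin n → ℂ × ℂ).prod 𝓘(ℝ, Fin (m - n) → ℂ)) (clusterVariety M) f ∧
        ∀ (y : TateQuotient (deckGroup n d T)) (w : algTorus (m - n)),
          g (lagrangianMap (f (y, w))) =
            (TateQuotient.proj (deckGroup n d T) y, fun k => Real.log ‖w.1 k‖) := by
  refine ⟨exists_isCoveringData hmn M hM, fun d _ T hc => ⟨⟨finite_ker_torusHom hc,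
    fun l hl => exists_rootVector_eq hc hl⟩, ⟨TateQuotient.contMDiff_proj _,
    TateQuotient.isProperMap_proj _, TateFibration.kahlerForm d,
    TateFibration.isPreservedBy_vadd, TateQuotient.kahlerForm _,
    TateQuotient.isInducedBy_kahlerForm _⟩, ?_⟩⟩
  obtain ⟨hd, hT, M', hM', hcol, h⟩ := id hc
  refine ⟨clusterMap T, baseDiffeomorph hmn hd.ne' hM' h, ⟨contMDiff_clusterMap T,
    injective_mfderiv_clusterMap hmn h, isEmbedding_clusterMap hc h, ?_⟩,
    toBase_lagrangianMap h⟩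
  exact Set.Subset.antisymm (Set.range_subset_iff.2 (clusterMap_mem hcol h))
    fun v hv => exists_clusterMap_eq hT hcol h hv
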